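/- **Conventions.** Permutations act on the right and are multiplied from left to right; $x^y=y^{-1}xy$, $x^{-y}=(x^{-1})^y$ and $[x,y]=x^{-1}y^{-1}xy$. The bit-length of an element of a group generated by $X$ is the least number of symbols needed to write it in terms of $X$, where each element of $X$ is one symbol and integer exponents (of subexpressions) are written in binary; the bit-length of a presentation $\langle X\mid R\rangle$ is $|X|$ plus the sum of the bit-lengths of the relators in $X$. A relation $u=v$ stands for the relator $uv^{-1}$. **Theorem.** There is an absolute constant $C$ such that the following holds. Let $n$ be an integer with $15\le n\le 20$, $27\le n\le 44$ or $n\ge 51$, and let $p\equiv 11 \pmod{12}$ be a prime with $(n+2)/2\le p\le n-4$. Let $r$ generate the group $\mathbb F_p^{*2}$ of nonzero squares, and let $s$ be an integer with $s(r-1)\equiv-1\pmod p$. Put $k=2p+4-n$. In the free group on $a,g,y$ define $$b=g^3,\quad z=g^{(p-1)/2},\quad z(i)=z^{a^i},\quad d(i,j)=z(i)z(j)^{-1}z(i)\quad (i,j\in\mathbb Z),$$ $$h=(b^2z(1)z(-1))^{(p+1)/2},\qquad x=d(0,1),$$ $$c(i,j)=\begin{cases}a^{-j}(ax)^{j-i}a^i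 & 1\le i\le j\le p-1,\\ z^{(za)^{-2}}c(i,p-2) & 1\le i\le p-2,\ j=p,\\ z^{(za)^{-1}}c(i,p-1)& 1\le i\le p-1,\ j=p+1,\\ z\,c(i,p)&1\le i\le p-2,\ j=p+2,\end{cases}$$ $$\tilde a=z(3)^{z(2)z(1)},\quad d=c(5,p+2),\quad c=\begin{cases}c(1,k)& n\text{ odd}\\ c(2,k)& n\text{ even,}\end{cases}\quad e=\begin{cases}za\,c(2,k+1)^{-1}& n\text{ odd}\\ za\,c(3,k+1)^{-1}& n\text{ even.}\end{cases}$$ If $k=p$ let $w=z^{yz^{-1}}z^{yz}$. If $k\le p-1$ let $$\tilde x=[d(1,k+2)d(2,k+1)]^{d(1,k+2)^yd(2,k+1)^y},\qquad u=(za)(za)^y$$ (in the definition of $\tilde x$ the square brackets are mere brackets) and $$w=\begin{cases}(\tilde xu^{-2})^{(p-k)/2}\,\tilde x\,u^{p-k}& n\text{ odd},\\ d(1,-1)^{zaya^{-1}z^{-2}a^{-1}}\,z(1)^{-ya^{-1}z^{-1}}\,(\tilde xu^{-2})^{(p-k-3)/2}\,\tilde x\,u^{p-k-3}& n\text{ even.}\end{cases}$$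 In all cases $w$ is a word in $a,g,a^y,g^y$. Let $$\bar J=\langle a,g,y\mid a^p=b^{(p-1)/2},\ (a^s)^b=a^{s-1},\ (zz^a)^2=1,\ \tilde a=(\tilde ah)^y,\ c=c^y,\ [d,e^y]=1,\ y=w\rangle .$$ 1. $\bar J\cong A_n$; so this is a presentation of $A_n$ with 3 generators and 7 relators. 2. If $|s|\le n$ (for instance, if $1\le s\le p$), this presentation has bit-length at most $C\log n$. 3. There is $\alpha\in\mathbb F_p^{*2}$ with $\alpha^3=r$. For each such $\alpha$ there is an isomorphism $\bar\varphi$ from $\bar J$ onto $\mathrm{Alt}(\{-p-1+k,\dots,p+2\})$, the alternating group on $n$ points, such that, writing $f\equiv\sigma$ for $\bar\varphi(f)=\sigma$ and using the representatives $1,\dots,p$ of $\mathbb F_p$, * $a\equiv(1,2,\dots,p)$ and $g\equiv(t\mapsto\alpha t:t\in\mathbb F_p^*)(p+2,p+1,p)$; * $y\equiv\bar y$, where $\bar y=(-p-1+k,p+2)(-p+k,p+1)\cdots(-1,k+2)(0,k+1)$ if $n$ is odd, and $\bar y=(-p-1+k,p+2,-p+k,p+1)(-p+1+k,p)(-p+2+k,p-1)\cdots(0,k+1)$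 if $n$ is even; * $b\equiv(t\mapsto rt:t\in\mathbb F_p^*)$, $z\equiv(p,p+1,p+2)$, $h\equiv1$; * $z(i)\equiv(i,p+1,p+2)$ and $d(i,j)\equiv(i,j)(p+1,p+2)$ for $1\le i,j\le p$, $i\ne j$, and for all integers $i,j$ the images of $z(i)$ and $d(i,j)$ depend only on $i,j$ modulo $p$; $x\equiv(1,p)(p+1,p+2)$; * $c(i,j)\equiv(i,i+1,\dots,j)(p+1,p+2)^{j-i}$ whenever $c(i,j)$ is defined; * $\tilde a\equiv(1,2,3)$ and $d\equiv(5,\dots,p+2)$; if $n$ is odd, $c\equiv(1,\dots,k)$ and $e\equiv(1,k+1,\dots,p+2)$; if $n$ is even, $c\equiv(2,\dots,k)$ and $e\equiv(1,2,k+1,\dots,p+2)$; * $\tilde x\equiv(-1,k+2)(0,k+1)$ if $k\le p-2$; * if $k\le p-1$, then $u\equiv(1,\dots,p+2)(1,\dots,k,0,-1,\dots,-p-1+k)$ for $n$ odd and $u\equiv(1,\dots,p+2)(1,\dots,k,0,-1,\dots,-p+1+k,\,-p-1+k,\,-p+k)$ for $n$ even; * $w\equiv\bar y$. -/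

import Mathlib

namespace AltPres

/-! ## Bit-length -/

/-- Formal expressions in symbols `X` built with products and integer powers. -/
inductive PowerExpr (X : Type*) where
  | one : PowerExpr X
  | gen : X → PowerExpr X
  | mul : PowerExpr X → PowerExpr X → PowerExpr X
  | pow : PowerExpr X → ℤ → PowerExpr X

namespace PowerExpr

/-- The group element denoted by an expression. -/
def eval {X G : Type*} [Group G] (f : X → G) : PowerExpr X → G
  | one => 1
  | gen x => f x
  | mul u v => u.eval f * v.eval f
  | pow u m => u.eval f ^ m

/-- The number of symbols written: a letter (or the identity) is one symbol, and a power
`(u)^m` costs, besides the symbols of `u`, two brackets, a possible minus sign and the binary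
digits of `|m|` (at least one digit). -/
def symbols {X : Type*} : PowerExpr X → ℕ
  | one => 1
  | gen _ => 1
  | mul u v => u.symbols + v.symbols
  | pow u m => u.symbols + 2 + (if m < 0 then 1 else 0) + max 1 (Nat.size m.natAbs)

theorem exists_eval_eq {X : Type*} (w : FreeGroup X) :
    ∃ u : PowerExpr X, u.eval FreeGroup.of = w := by
  refine FreeGroup.induction_on w ⟨one, rfl⟩ (fun x => ⟨gen x, rfl⟩)
    (fun x _ => ⟨pow (gen x) (-1), by simp [eval]⟩) ?_
  rintro _ _ ⟨u, rfl⟩ ⟨v, rfl⟩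
  exact ⟨mul u v, rfl⟩

end PowerExpr

/-- Bit-length of `g` in the elements `f x`, `x : X`: the least number of symbols in an expression
for `g` in which exponents are written in binary. -/
noncomputable def bitLength {X G : Type*} [Group G] (f : X → G) (g : G) : ℕ :=
  sInf {l | ∃ u : PowerExpr X, u.eval f = g ∧ u.symbols = l}

/-- Bit-length of the presentation `⟨X ∣ R⟩`: the number of generators plus the sum of
the bit-lengths of the relators (as elements of the free group). -/
noncomputable def presentationBitLength {X : Type*} [Fintype X] {m : ℕ}
    (R : Fin m → FreeGroup X) : ℕ :=
  Fintype.card X + ∑ i, bitLength FreeGroup.of (R i)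

/-! ## The words -/

/-- `x ^ y = y⁻¹ x y` -/
def cj {G : Type*} [Group G] (x y : G) : G := y⁻¹ * x * y

/-- `[x, y] = x⁻¹ y⁻¹ x y` -/
def comm {G : Type*} [Group G] (x y : G) : G := x⁻¹ * y⁻¹ * x * y

/-- Words in three letters `a, g, y`. -/
abbrev Word := FreeGroup (Fin 3)

def a : Word := FreeGroup.of 0
def g : Word := FreeGroup.of 1
def y : Word := FreeGroup.of 2

/-- `k = 2p + 4 - n` -/
def kk (n p : ℤ) : ℤ := 2 * p + 4 - n

def b : Word := g ^ 3

def z (p : ℤ) : Word := g ^ ((p - 1) / 2)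

/-- `z(i) = z ^ (a ^ i)` -/
def zi (p i : ℤ) : Word := cj (z p) (a ^ i)

def h (p : ℤ) : Word := (b ^ 2 * zi p 1 * zi p (-1)) ^ ((p + 1) / 2)

/-- `d(i, j) = z(i) z(j)⁻¹ z(i)` -/
def dij (p i j : ℤ) : Word := zi p i * (zi p j)⁻¹ * zi p i

def x (p : ℤ) : Word := dij p 0 1

/-- The word `c(i, j)` for `j ≤ p - 1`. -/
def cij₀ (p i j : ℤ) : Word := a ^ (-j) * (a * x p) ^ (j - i) * a ^ i

/-- The word `c(i, j)`; the four branches are `j ≤ p - 1`, `j = p`, `j = p + 1`, `j = p + 2`. -/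
def cij (p i j : ℤ) : Word :=
  if j ≤ p - 1 then cij₀ p i j
  else if j = p then cj (z p) ((z p * a) ^ (-2 : ℤ)) * cij₀ p i (p - 2)
  else if j = p + 1 then cj (z p) ((z p * a) ^ (-1 : ℤ)) * cij₀ p i (p - 1)
  else z p * (cj (z p) ((z p * a) ^ (-2 : ℤ)) * cij₀ p i (p - 2))

/-- The pairs `(i, j)` for which `c(i, j)` is defined. -/
def cijDefined (p i j : ℤ) : Prop :=
  (1 ≤ i ∧ i ≤ j ∧ j ≤ p - 1) ∨ (1 ≤ i ∧ i ≤ p - 2 ∧ j = p) ∨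
    (1 ≤ i ∧ i ≤ p - 1 ∧ j = p + 1) ∨ (1 ≤ i ∧ i ≤ p - 2 ∧ j = p + 2)

/-- The word `ã`. -/
def aTilde (p : ℤ) : Word := cj (zi p 3) (zi p 2 * zi p 1)

def c (n p : ℤ) : Word := if Odd n then cij p 1 (kk n p) else cij p 2 (kk n p)

def d (p : ℤ) : Word := cij p 5 (p + 2)

def e (n p : ℤ) : Word :=
  if Odd n then z p * a * (cij p 2 (kk n p + 1))⁻¹ else z p * a * (cij p 3 (kk n p + 1))⁻¹

/-- The word `x̃`. -/
def xt (n p : ℤ) : Word :=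
  cj (dij p 1 (kk n p + 2) * dij p 2 (kk n p + 1))
    (cj (dij p 1 (kk n p + 2)) y * cj (dij p 2 (kk n p + 1)) y)

def u (p : ℤ) : Word := z p * a * cj (z p * a) y

def w (n p : ℤ) : Word :=
  if kk n p = p then cj (z p) (y * (z p)⁻¹) * cj (z p) (y * z p)
  else if Odd n then
    (xt n p * u p ^ (-2 : ℤ)) ^ ((p - kk n p) / 2) * xt n p * u p ^ (p - kk n p)
  else
    cj (dij p 1 (-1)) (z p * a * y * a⁻¹ * z p ^ (-2 : ℤ) * a⁻¹)
      * (cj (zi p 1) (y * a⁻¹ * (z p)⁻¹))⁻¹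
      * (xt n p * u p ^ (-2 : ℤ)) ^ ((p - kk n p - 3) / 2) * xt n p * u p ^ (p - kk n p - 3)

/-- The seven relators; a relation `u = v` is written as the relator `u v⁻¹`. -/
def relators (n p s : ℤ) : Fin 7 → Word :=
  ![a ^ p * (b ^ ((p - 1) / 2))⁻¹,
    cj (a ^ s) b * (a ^ (s - 1))⁻¹,
    (z p * cj (z p) a) ^ 2,
    aTilde p * (cj (aTilde p * h p) y)⁻¹,
    c n p * (cj (c n p) y)⁻¹,
    comm (d p) (cj (e n p) y),
    y * (w n p)⁻¹]

/-- The group `⟨a, g, y ∣ seven relators⟩`. -/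
abbrev J (n p s : ℤ) : Type := PresentedGroup (Set.range (relators n p s))

/-! ## The permutations

Permutations act on the right and are multiplied from left to right, so the groups of
permutations used here are the opposites of Mathlib's ones. -/

/-- Permutations of `ℤ`, multiplied from left to right. -/
abbrev RPerm := (Equiv.Perm ℤ)ᵐᵒᵖ

/-- The list `i, i + 1, …, j`. -/
def run (i j : ℤ) : List ℤ := (List.range (j + 1 - i).toNat).map fun t => i + (t : ℤ)

/-- The cycle `(l₀, l₁, …)`. -/
def cyc (l : List ℤ) : RPerm := MulOpposite.op l.formPerm

theorem mulFun_aux (p : ℕ) (α : (ZMod p)ˣ) (m : ℤ) (hm : 1 ≤ m ∧ m ≤ (p : ℤ) - 1) :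
    (1 ≤ (((α : ZMod p) * (m : ZMod p)).val : ℤ) ∧
      (((α : ZMod p) * (m : ZMod p)).val : ℤ) ≤ (p : ℤ) - 1) ∧
    (((((α⁻¹ : (ZMod p)ˣ) : ZMod p) *
      (((((α : ZMod p) * (m : ZMod p)).val : ℤ)) : ZMod p)).val : ℤ) = m) := by
  have hp : p ≠ 0 := by rintro rfl; norm_num at hm; omega
  have : NeZero p := ⟨hp⟩
  have h0 : (m : ZMod p) ≠ 0 := by
    rw [Ne, ZMod.intCast_zmod_eq_zero_iff_dvd]
    intro hd
    have := Int.le_of_dvd (by omega) hd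
    omega
  have h1 : (α : ZMod p) * (m : ZMod p) ≠ 0 := by
    intro hz
    exact h0 ((Units.mul_right_eq_zero α).1 hz)
  have h2 := (ZMod.val_ne_zero _).2 h1
  have h3 := ZMod.val_lt ((α : ZMod p) * (m : ZMod p))
  refine ⟨⟨by omega, by omega⟩, ?_⟩
  have : ((((α : ZMod p) * (m : ZMod p)).val : ℤ) : ZMod p) = α * m := by simp
  rw [this, Units.inv_mul_cancel_left, ZMod.val_intCast]
  exact Int.emod_eq_of_lt (by omega) (by omega)

/-- `x ↦ α x` on the representatives `1, …, p - 1` of `𝔽ₚ*`; all other integers are fixed. -/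
def mulFun (p : ℕ) (α : (ZMod p)ˣ) (m : ℤ) : ℤ :=
  if 1 ≤ m ∧ m ≤ (p : ℤ) - 1 then (((α : ZMod p) * (m : ZMod p)).val : ℤ) else m

theorem mulFun_inv (p : ℕ) (α : (ZMod p)ˣ) (m : ℤ) : mulFun p α⁻¹ (mulFun p α m) = m := by
  by_cases hm : 1 ≤ m ∧ m ≤ (p : ℤ) - 1
  · have h1 := mulFun_aux p α m hm
    have h2 : mulFun p α m = (((α : ZMod p) * (m : ZMod p)).val : ℤ) := if_pos hm
    rw [h2, mulFun, if_pos h1.1]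
    exact h1.2
  · have h2 : mulFun p α m = m := if_neg hm
    rw [h2]
    exact if_neg hm

/-- The permutation `x ↦ α x` of `𝔽ₚ*`, extended by the identity. -/
def mulPerm (p : ℕ) (α : (ZMod p)ˣ) : RPerm :=
  MulOpposite.op
    { toFun := mulFun p α
      invFun := mulFun p α⁻¹
      left_inv := mulFun_inv p α
      right_inv := fun m => by simpa using mulFun_inv p α⁻¹ m }

/-- `(1-t, k+t) ⋯ (-1, k+2)(0, k+1)` -/
def swaps (k t : ℤ) : RPerm :=
  ((List.range t.toNat).map fun i => cyc [-(i : ℤ), k + 1 + (i : ℤ)]).prod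

/-- The even permutation corresponding to `y`:
`(-p-1+k, p+2)(-p+k, p+1) ⋯ (0, k+1)` for odd `n`,
`(-p-1+k, p+2, -p+k, p+1)(-p+1+k, p) ⋯ (0, k+1)` for even `n`. -/
def yPerm (n p : ℤ) : RPerm :=
  if Odd n then swaps (kk n p) (p + 2 - kk n p)
  else cyc [-p - 1 + kk n p, p + 2, -p + kk n p, p + 1] * swaps (kk n p) (p - kk n p)

/-- The `n` points `-p-1+k, …, p+2`. -/
abbrev Pts (n p : ℤ) : Type := {m : ℤ // m ∈ Finset.Icc (-p - 1 + kk n p) (p + 2)}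

/-- `Alt({-p-1+k, …, p+2})`, multiplied from left to right. -/
abbrev RAlt (n p : ℤ) : Type := (alternatingGroup (Pts n p))ᵐᵒᵖ

/-- An element of `Alt({-p-1+k, …, p+2})` as a permutation of `ℤ` fixing all other integers. -/
noncomputable def incl (n p : ℤ) : RAlt n p →* RPerm :=
  MonoidHom.op (Equiv.Perm.ofSubtype.comp (alternatingGroup (Pts n p)).subtype)

/-- The permutation corresponding to a word under an isomorphism `Φ`. -/
noncomputable def ev {n p s : ℤ} (Φ : J n p s ≃* RAlt n p) (f : Word) : RPerm :=
  incl n p (Φ (PresentedGroup.mk (Set.range (relators n p s)) f))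

end AltPres

/-! The permutations listed in the theorem satisfy the seven relators, so the presented group acts
on `n` points. The work is to show that this action `π` is faithful with image the alternating
group. Faithfulness rests on Carmichael's relations: elements `xᵢ` with `xᵢ³ = (xᵢxⱼ)² = 1` that act
as the 3-cycles `(i, P, Q)` generate a group acting faithfully (`eq_one_of_carmichael`). This is
used twice.

The first use is for the subgroup K generated by `z(1), …, z(p)` (`zSubgroup`). The first two
relations force `a^p = 1` and make `b` act on the powers of `a` as multiplication by `r`. Moreover
`b` centralizes `z`, both being powers of `g`, and `z³ = b^((p-1)/2) = 1`. So `a` and `b` permute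
the `z(i)` by affine maps, and the single relation `(z z^a)² = 1` spreads to all pairs `i ≠ j`
because -1 is not a square (`zi_mul_sq`). Hence K is a copy of the alternating group of degree `p +
2`. As `b` normalizes K, it is `t b'` with `b'` in K and `t` centralizing K. The word `h` evaluates
to `t²`, the relation `ã = (ãh)^y` then gives `t⁶ = 1`, and the order of `t` divides `(p-1)/2`,
which is prime to 6, so `t = 1` (`b_mem_and_h`). A similar argument puts `a` in K, and `g` follows;
so K is the image of the words in `a, g`.

The second use glues K to its conjugate by `y`. Since `y` centralizes `ã` and `c`, it centralizes
Alt{1, …, k} (`commute_y`). The one relation `[d, e^y] = 1` then spreads: Alt{4, …, p+2} commutes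
with the conjugate by `y` of Alt({1, 2, 3} ∪ {k+1, …, p+2}) (`commute_e`, `commute_cj`). This is
enough for Carmichael's relations between the 3-cycles `(i, 1, 4)` of K and those of its conjugate
(`mul_cj_sq`), so the two subgroups together generate a group acting faithfully. The relation `y =
w` puts `y` in it, so it is the whole group (`injective`).

What remains is computation with permutations (`model_h`, `model_w`, `model_relators`) and a count
of symbols: each relator arises by a bounded number of products and powers with exponents at most
`4n` in absolute value. -/

namespace AltPres

/-! ## The right action on `ℤ` -/

/-- The image of `m` under `f`, written `m ^ f` in a right action. -/
def act (f : RPerm) (m : ℤ) : ℤ := f.unop m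

@[simp] theorem act_one (m : ℤ) : act 1 m = m := rfl

@[simp] theorem act_mul (f f' : RPerm) (m : ℤ) : act (f * f') m = act f' (act f m) := rfl

@[simp] theorem act_inv_act (f : RPerm) (m : ℤ) : act f⁻¹ (act f m) = m :=
  f.unop.symm_apply_apply m

@[simp] theorem act_act_inv (f : RPerm) (m : ℤ) : act f (act f⁻¹ m) = m :=
  f.unop.apply_symm_apply m

theorem act_injective (f : RPerm) : Function.Injective (act f) := f.unop.injective

theorem act_inv_eq {f : RPerm} {m m' : ℤ} (hf : act f m = m') : act f⁻¹ m' = m := by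
  rw [← hf, act_inv_act]

theorem rperm_ext {f f' : RPerm} (hf : ∀ m, act f m = act f' m) : f = f' :=
  MulOpposite.unop_injective (Equiv.ext hf)

theorem act_zpow_fixed {f : RPerm} {m : ℤ} (hf : act f m = m) (t : ℤ) : act (f ^ t) m = m := by
  induction t using Int.induction_on with
  | zero => rfl
  | succ i ih => rw [zpow_add_one, act_mul, ih, hf]
  | pred i ih => rw [zpow_sub_one, act_mul, ih, act_inv_eq hf]

/-! ## Cycles -/

theorem act_cyc (l : List ℤ) (m : ℤ) : act (cyc l) m = l.formPerm m := rfl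

theorem act_cyc_of_notMem {l : List ℤ} {m : ℤ} (hm : m ∉ l) : act (cyc l) m = m :=
  List.formPerm_apply_of_notMem hm

theorem act_cyc_pair (i j m : ℤ) :
    act (cyc [i, j]) m = if m = i then j else if m = j then i else m := by
  rw [act_cyc, List.formPerm_pair, Equiv.swap_apply_def]

theorem act_cyc_triple {i j l : ℤ} (hij : i ≠ j) (hil : i ≠ l) (hjl : j ≠ l) (m : ℤ) :
    act (cyc [i, j, l]) m = if m = i then j else if m = j then l else if m = l then i else m := by
  rw [act_cyc, List.formPerm_cons_cons, List.formPerm_pair, Equiv.Perm.mul_apply,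
    Equiv.swap_apply_def, Equiv.swap_apply_def]
  grind

/-- Conjugation relabels the entries of a cycle. Nearly all evaluations of words below reduce to
this, so that only the images of a few points have to be computed. -/
theorem cj_cyc (l : List ℤ) (f : RPerm) : cj (cyc l) f = cyc (l.map (act f)) := by
  have key : ∀ l : List ℤ, ∀ m, (l.map (act f)).formPerm (act f m) = act f (l.formPerm m) := by
    intro l
    induction l with
    | nil => intro m; rfl
    | cons i l ih =>
      intro m
      cases l with
      | nil => simp
      | cons j l =>
        simp only [List.map_cons] at ih ⊢
        rw [List.formPerm_cons_cons, List.formPerm_cons_cons, Equiv.Perm.mul_apply,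
          Equiv.Perm.mul_apply, ih, Equiv.swap_apply_def, Equiv.swap_apply_def]
        simp only [(act_injective f).eq_iff]
        split_ifs <;> rfl
  refine rperm_ext fun m => ?_
  obtain ⟨m, rfl⟩ : ∃ m', act f m' = m := ⟨_, act_act_inv f m⟩
  rw [act_cyc, key, cj, act_mul, act_mul, act_inv_act]
  rfl

theorem cyc_pow_length {l : List ℤ} (hl : l.Nodup) : cyc l ^ l.length = 1 := by
  exact MulOpposite.unop_injective (List.formPerm_pow_length_eq_one_of_nodup l hl)

theorem cyc_commute {l l' : List ℤ} (hl : ∀ m ∈ l, m ∉ l') : Commute (cyc l) (cyc l') := by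
  refine rperm_ext fun m => ?_
  simp only [act_mul]
  by_cases h1 : m ∈ l
  · rw [act_cyc_of_notMem (hl m h1), act_cyc_of_notMem]
    exact hl _ (List.formPerm_apply_mem_of_mem h1)
  · rw [act_cyc_of_notMem h1]
    by_cases h2 : m ∈ l'
    · exact (act_cyc_of_notMem fun h3 => hl _ h3 (List.formPerm_apply_mem_of_mem h2)).symm
    · rw [act_cyc_of_notMem h2, act_cyc_of_notMem h1]

theorem cyc_triple_inv {i j l : ℤ} (hij : i ≠ j) (hil : i ≠ l) (hjl : j ≠ l) :
    (cyc [i, j, l])⁻¹ = cyc [j, i, l] := by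
  rw [inv_eq_iff_mul_eq_one]
  refine rperm_ext fun m => ?_
  rw [act_mul, act_cyc_triple hij hil hjl, act_cyc_triple hij.symm hjl hil, act_one]
  grind

theorem cyc_triple_rotate {i j l : ℤ} (hij : i ≠ j) (hil : i ≠ l) (hjl : j ≠ l) :
    cyc [i, j, l] = cyc [j, l, i] := by
  refine rperm_ext fun m => ?_
  rw [act_cyc_triple hij hil hjl, act_cyc_triple hjl hij.symm hil.symm]
  grind

theorem cyc_pair_comm (i j : ℤ) : cyc [i, j] = cyc [j, i] := by
  rw [cyc, cyc, List.formPerm_pair, List.formPerm_pair, Equiv.swap_comm]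

theorem cyc_pair_mul_self (i j : ℤ) : cyc [i, j] * cyc [i, j] = 1 := by
  refine rperm_ext fun m => ?_
  rw [act_mul, act_cyc_pair, act_cyc_pair, act_one]
  grind

/-- The product of two Carmichael generators is an involution of type (2, 2); this is why `(xᵢxⱼ)² =
1` holds among permutations. -/
theorem cyc_triple_mul_triple {i j P Q : ℤ} (hij : i ≠ j) (hiP : i ≠ P) (hiQ : i ≠ Q) (hjP : j ≠ P)
    (hjQ : j ≠ Q) (hPQ : P ≠ Q) :
    cyc [i, P, Q] * cyc [j, P, Q] = cyc [i, Q] * cyc [P, j] := by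
  refine rperm_ext fun m => ?_
  simp only [act_mul, act_cyc_triple hiP hiQ hPQ, act_cyc_triple hjP hjQ hPQ, act_cyc_pair]
  grind

theorem cyc_triple_double {i j P Q : ℤ} (hij : i ≠ j) (hiP : i ≠ P) (hiQ : i ≠ Q) (hjP : j ≠ P)
    (hjQ : j ≠ Q) (hPQ : P ≠ Q) :
    cyc [i, P, Q] * (cyc [j, P, Q])⁻¹ * cyc [i, P, Q] = cyc [i, j] * cyc [P, Q] := by
  rw [cyc_triple_inv hjP hjQ hPQ]
  refine rperm_ext fun m => ?_
  simp only [act_mul, act_cyc_triple hiP hiQ hPQ, act_cyc_triple hjP.symm hPQ hjQ, act_cyc_pair]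
  grind

theorem cyc_pairs_commute {i j i' j' : ℤ} (h1 : i ≠ i') (h2 : i ≠ j') (h3 : j ≠ i') (h4 : j ≠ j') :
    Commute (cyc [i, j]) (cyc [i', j']) :=
  cyc_commute (by simp; grind)

/-! ## Alternating groups on finite sets of integers -/

/-- The alternating group on `S`, acting on `ℤ` and fixing all other integers. -/
noncomputable def altIncl (S : Finset ℤ) :
    (alternatingGroup {m : ℤ // m ∈ S})ᵐᵒᵖ →* RPerm :=
  MonoidHom.op (Equiv.Perm.ofSubtype.comp (alternatingGroup {m : ℤ // m ∈ S}).subtype)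

/-- The alternating group on `S` as a group of permutations of `ℤ`. -/
noncomputable def altOn (S : Finset ℤ) : Subgroup RPerm := (altIncl S).range

theorem altIncl_injective (S : Finset ℤ) : Function.Injective (altIncl S) := by
  intro σ τ hστ
  exact MulOpposite.unop_injective (Subtype.ext
    (Equiv.Perm.ofSubtype_injective (MulOpposite.op_injective hστ)))

/-- The sign of an element of odd order is an odd-order element of {1, -1}, hence 1. Evenness is
thus obtained without computing signs. -/
theorem mem_altOn_of_odd_pow {S : Finset ℤ} {f : RPerm} (hf : ∀ m, m ∉ S → act f m = m) {N : ℕ}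
    (hN : Odd N) (hfN : f ^ N = 1) : f ∈ altOn S := by
  have h2 : ∀ m, f.unop m ≠ m → m ∈ S := fun m hm => by
    by_contra h; exact hm (hf m h)
  have h1 : ∀ m, f.unop m ∈ S ↔ m ∈ S := fun m => by
    by_cases hm : f.unop m = m
    · rw [hm]
    · exact iff_of_true (h2 _ fun h => hm (f.unop.injective h)) (h2 _ hm)
  have h3 : (f.unop.subtypePerm h1) ^ N = 1 := by
    apply Equiv.Perm.ofSubtype_injective
    rw [map_pow, map_one, Equiv.Perm.ofSubtype_subtypePerm h1 h2, ← MulOpposite.unop_pow, hfN]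
    rfl
  have h4 : Equiv.Perm.sign (f.unop.subtypePerm h1) = 1 := by
    have h5 := congrArg Equiv.Perm.sign h3
    rw [map_pow, map_one] at h5
    rcases Int.units_eq_one_or (Equiv.Perm.sign (f.unop.subtypePerm h1)) with h6 | h6
    · exact h6
    · rw [h6, hN.neg_one_pow] at h5; exact absurd h5 (by decide)
  refine ⟨MulOpposite.op ⟨f.unop.subtypePerm h1, h4⟩, ?_⟩
  apply MulOpposite.unop_injective
  exact Equiv.Perm.ofSubtype_subtypePerm h1 h2

theorem act_of_mem_altOn {S : Finset ℤ} {f : RPerm} (hf : f ∈ altOn S) {m : ℤ} (hm : m ∉ S) :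
    act f m = m := by
  obtain ⟨σ, rfl⟩ := hf
  exact Equiv.Perm.ofSubtype_apply_of_not_mem _ hm

theorem cyc_mem_altOn {S : Finset ℤ} {l : List ℤ} (hl : l.Nodup) (hlS : ∀ m ∈ l, m ∈ S)
    (hodd : Odd l.length) : cyc l ∈ altOn S :=
  mem_altOn_of_odd_pow (fun m hm => act_cyc_of_notMem fun h => hm (hlS m h)) hodd
    (cyc_pow_length hl)

/-- The 3-cycles `(i, P, Q)` yield all `(x, y)(P, Q)`, and an even permutation is a product of an
even number of transpositions, each of which may be paired with `(P, Q)`. -/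
theorem altOn_le {S : Finset ℤ} {P Q : ℤ} (hPQ : P ≠ Q)
    {H : Subgroup RPerm} (hH : ∀ i ∈ S, i ≠ P → i ≠ Q → cyc [i, P, Q] ∈ H) : altOn S ≤ H := by
  have hsw : ∀ x ∈ S, ∀ y ∈ S, x ≠ y → cyc [x, y] * cyc [P, Q] ∈ H := by
    have hPy : ∀ y ∈ S, y ≠ P → cyc [P, y] * cyc [P, Q] ∈ H := by
      intro y hy hyP
      by_cases hyQ : y = Q
      · rw [hyQ, cyc_pair_mul_self]; exact H.one_mem
      · convert H.inv_mem (hH y hy hyP hyQ) using 1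
        rw [cyc_triple_inv hyP hyQ hPQ]
        refine rperm_ext fun m => ?_
        simp only [act_mul, act_cyc_triple hyP.symm hPQ hyQ, act_cyc_pair]
        grind
    have hQy : ∀ y ∈ S, y ≠ Q → cyc [Q, y] * cyc [P, Q] ∈ H := by
      intro y hy hyQ
      by_cases hyP : y = P
      · rw [hyP, cyc_pair_comm, cyc_pair_mul_self]; exact H.one_mem
      · convert hH y hy hyP hyQ using 1
        refine rperm_ext fun m => ?_
        simp only [act_mul, act_cyc_triple hyP hyQ hPQ, act_cyc_pair]
        grind
    intro x hx y hy hxy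
    by_cases h1 : x = P
    · rw [h1]; exact hPy y hy (h1 ▸ hxy.symm)
    by_cases h2 : x = Q
    · rw [h2]; exact hQy y hy (h2 ▸ hxy.symm)
    by_cases h3 : y = P
    · rw [cyc_pair_comm, h3]; exact hPy x hx h1
    by_cases h4 : y = Q
    · rw [cyc_pair_comm, h4]; exact hQy x hx h2
    rw [← cyc_triple_double hxy h1 h2 h3 h4 hPQ]
    exact H.mul_mem (H.mul_mem (hH x hx h1 h2) (H.inv_mem (hH y hy h3 h4))) (hH x hx h1 h2)
  -- Both signs are carried through the induction on transpositions: an odd permutation is corrected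
  -- by a final `(P, Q)`.
  have key : ∀ σ : Equiv.Perm {m : ℤ // m ∈ S},
      (Equiv.Perm.sign σ = 1 → MulOpposite.op (Equiv.Perm.ofSubtype σ) ∈ H) ∧
      (Equiv.Perm.sign σ = -1 → MulOpposite.op (Equiv.Perm.ofSubtype σ) * cyc [P, Q] ∈ H) := by
    intro σ
    induction σ using Equiv.Perm.swap_induction_on with
    | one => exact ⟨fun _ => by simp, fun h => absurd h (by simp)⟩
    | swap_mul f x y hxy ih =>
      have h1 : MulOpposite.op (Equiv.Perm.ofSubtype (Equiv.swap x y * f)) =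
          MulOpposite.op (Equiv.Perm.ofSubtype f) * cyc [(x : ℤ), (y : ℤ)] := by
        rw [map_mul, Equiv.Perm.ofSubtype_swap_eq, MulOpposite.op_mul, cyc, List.formPerm_pair]
      have h2 := hsw x x.2 y y.2 (fun h => hxy (Subtype.ext h))
      rw [h1, map_mul, Equiv.Perm.sign_swap hxy]
      constructor
      · intro h3
        have h4 : Equiv.Perm.sign f = -1 := by
          rcases Int.units_eq_one_or (Equiv.Perm.sign f) with h | h
          · rw [h] at h3; exact absurd h3 (by decide)
          · exact h
        convert H.mul_mem (ih.2 h4) (H.inv_mem h2) using 1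
        rw [mul_inv_rev, inv_eq_of_mul_eq_one_left (cyc_pair_mul_self P Q),
          inv_eq_of_mul_eq_one_left (cyc_pair_mul_self (x : ℤ) y), mul_assoc,
          ← mul_assoc (cyc [P, Q]), cyc_pair_mul_self, one_mul]
      · intro h3
        have h4 : Equiv.Perm.sign f = 1 := by
          rcases Int.units_eq_one_or (Equiv.Perm.sign f) with h | h
          · exact h
          · rw [h] at h3; exact absurd h3 (by decide)
        rw [mul_assoc]
        exact H.mul_mem (ih.1 h4) h2
  rintro _ ⟨σ, rfl⟩
  exact (key σ.unop.1).1 σ.unop.2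

/-! ## Carmichael's relations -/

/-- A group generated by elements `xᵢ` that satisfy Carmichael's relations `xᵢ³ = (xᵢxⱼ)² = 1`
acts faithfully if the `xᵢ` act as the `3`-cycles `(i, P, Q)`. -/
theorem eq_one_of_carmichael {G : Type*} [Group G] (π : G →* RPerm) {P Q : ℤ} (hPQ : P ≠ Q)
    (x : ℤ → G) (T : Finset ℤ) (hP : P ∉ T) (hQ : Q ∉ T) (h3 : ∀ i ∈ T, x i ^ 3 = 1)
    (h2 : ∀ i ∈ T, ∀ j ∈ T, i ≠ j → (x i * x j) ^ 2 = 1)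
    (hπ : ∀ i ∈ T, π (x i) = cyc [i, P, Q]) :
    ∀ f ∈ Subgroup.closure (x '' (T : Set ℤ)), π f = 1 → f = 1 := by
  classical
  induction T using Finset.induction_on with
  | empty => intro f hf _; simpa using hf
  | insert m T hmT ih =>
    have hmP : m ≠ P := fun h => hP (h ▸ Finset.mem_insert_self _ _)
    have hmQ : m ≠ Q := fun h => hQ (h ▸ Finset.mem_insert_self _ _)
    have hne : ∀ j ∈ T, j ≠ m ∧ j ≠ P ∧ j ≠ Q := fun j hj =>
      ⟨fun h => hmT (h ▸ hj), fun h => hP (h ▸ Finset.mem_insert_of_mem hj),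
        fun h => hQ (h ▸ Finset.mem_insert_of_mem hj)⟩
    have ih' := ih (fun h => hP (Finset.mem_insert_of_mem h))
      (fun h => hQ (Finset.mem_insert_of_mem h)) (fun i hi => h3 i (Finset.mem_insert_of_mem hi))
      (fun i hi j hj => h2 i (Finset.mem_insert_of_mem hi) j (Finset.mem_insert_of_mem hj))
      (fun i hi => hπ i (Finset.mem_insert_of_mem hi))
    set H := Subgroup.closure (x '' (T : Set ℤ)) with hH
    have hxH : ∀ j ∈ T, x j ∈ H := fun j hj => Subgroup.subset_closure ⟨j, hj, rfl⟩
    have inv_eq_sq : ∀ i ∈ insert m T, (x i)⁻¹ = x i * x i := fun i hi => by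
      rw [inv_eq_iff_mul_eq_one, ← h3 i hi, pow_three]
    have flip : ∀ i ∈ insert m T, ∀ j ∈ insert m T, i ≠ j → x i * x j = (x j)⁻¹ * (x i)⁻¹ :=
      fun i hi j hj hij => by
        rw [← mul_inv_rev, eq_inv_iff_mul_eq_one, ← h2 i hi j hj hij, pow_two]
    have hm := Finset.mem_insert_self m T
    have hT : ∀ j ∈ T, j ∈ insert m T := fun j hj => Finset.mem_insert_of_mem hj
    -- Coset enumeration: the cosets of `H` represented by 1, `x m`, `(x m)⁻¹` and `x m * (x j)⁻¹`
    -- are closed under right multiplication by the generators, hence exhaust the group. They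
    -- correspond to the images `m`, `P`, `Q`, `j` of the point `m`.
    let C : Set G := {f | f ∈ H ∨ (∃ k ∈ H, f = k * x m) ∨ (∃ k ∈ H, f = k * (x m)⁻¹) ∨
      ∃ j ∈ T, ∃ k ∈ H, f = k * (x m * (x j)⁻¹)}
    have hmul : ∀ f ∈ C, ∀ i ∈ insert m T, f * x i ∈ C := by
      intro f hf i hi
      rcases hf with hf | ⟨k, hk, rfl⟩ | ⟨k, hk, rfl⟩ | ⟨j, hj, k, hk, rfl⟩
      · rcases Finset.mem_insert.1 hi with rfl | hi'
        · exact Or.inr (Or.inl ⟨f, hf, rfl⟩)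
        · exact Or.inl (H.mul_mem hf (hxH i hi'))
      · rcases Finset.mem_insert.1 hi with rfl | hi'
        · exact Or.inr (Or.inr (Or.inl ⟨k, hk, by rw [inv_eq_sq i hm, mul_assoc]⟩))
        · refine Or.inr (Or.inr (Or.inl ⟨k * (x i)⁻¹, H.mul_mem hk (H.inv_mem (hxH i hi')), ?_⟩))
          rw [mul_assoc, flip m hm i hi (hne i hi').1.symm, mul_assoc]
      · rcases Finset.mem_insert.1 hi with rfl | hi'
        · exact Or.inl (by simpa using hk)
        · refine Or.inr (Or.inr (Or.inr ⟨i, hi', k * x i, H.mul_mem hk (hxH i hi'), ?_⟩))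
          have e1 : (x m)⁻¹ * x i = x m * (x i)⁻¹ * (x m)⁻¹ := by
            rw [inv_eq_sq m hm, mul_assoc, flip m hm i hi (hne i hi').1.symm, inv_eq_sq m hm]
            group
          -- This identity turns `(x m)⁻¹ * x i` into `x i * (x m * (x i)⁻¹)`, which lies in the
          -- coset attached to `i`.
          have e2 : x m * (x i)⁻¹ = (x i)⁻¹ * ((x m)⁻¹ * x i) := by
            rw [inv_eq_sq i hi, ← mul_assoc, flip m hm i hi (hne i hi').1.symm, ← inv_eq_sq i hi,
              mul_assoc]
          rw [e2, mul_assoc, mul_assoc, ← mul_assoc (x i), mul_inv_cancel, one_mul]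
      · have e2 : x m * (x j)⁻¹ = (x j)⁻¹ * ((x m)⁻¹ * x j) := by
          rw [inv_eq_sq j (hT j hj), ← mul_assoc, flip m hm j (hT j hj) (hne j hj).1.symm,
            ← inv_eq_sq j (hT j hj), mul_assoc]
        have hkj := H.mul_mem hk (H.inv_mem (hxH j hj))
        rcases Finset.mem_insert.1 hi with rfl | hi'
        · refine Or.inr (Or.inr (Or.inr ⟨j, hj, k * (x j)⁻¹, hkj, ?_⟩))
          calc k * (x i * (x j)⁻¹) * x i = k * (x j)⁻¹ * (x i)⁻¹ * (x j * x i) := by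
                rw [e2]; group
            _ = k * (x j)⁻¹ * (x i * x i)⁻¹ * (x j)⁻¹ := by
                rw [flip j (hT j hj) i hm (hne j hj).1]; group
            _ = _ := by rw [← inv_eq_sq i hm]; group
        · by_cases hij : j = i
          · exact Or.inr (Or.inl ⟨k, hk, by rw [hij]; group⟩)
          · refine Or.inr (Or.inr (Or.inr
              ⟨j, hj, k * (x j)⁻¹ * x i, H.mul_mem hkj (hxH i hi'), ?_⟩))
            calc k * (x m * (x j)⁻¹) * x i = k * (x j)⁻¹ * (x m)⁻¹ * (x j * x i) := by
                  rw [e2]; group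
              _ = k * (x j)⁻¹ * ((x m)⁻¹ * (x i)⁻¹) * (x j)⁻¹ := by
                  rw [flip j (hT j hj) i hi hij]; group
              _ = _ := by rw [← flip i hi m hm (hne i hi').1]; group
    have hC : ∀ f ∈ Subgroup.closure (x '' (↑(insert m T) : Set ℤ)), f ∈ C := by
      intro f hf
      induction hf using Subgroup.closure_induction_right with
      | one => exact Or.inl H.one_mem
      | mul_right f _ _ hi ih =>
        obtain ⟨i, hi, rfl⟩ := hi
        exact hmul f ih i hi
      | mul_inv_cancel f _ _ hi ih =>
        obtain ⟨i, hi, rfl⟩ := hi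
        rw [inv_eq_sq i hi, ← mul_assoc]
        exact hmul _ (hmul f ih i hi) i hi
    have hfix : ∀ k ∈ H, act (π k) m = m := by
      intro k hk
      induction hk using Subgroup.closure_induction with
      | mem _ hi =>
        obtain ⟨i, hi, rfl⟩ := hi
        have := hne i hi
        rw [hπ i (hT i hi), act_cyc_of_notMem]
        simp; grind
      | one => simp
      | mul f f' _ _ hf hf' => rw [map_mul, act_mul, hf, hf']
      | inv f _ hf => rw [map_inv, act_inv_eq hf]
    intro f hf hf1
    -- Everything in `H` fixes `m`, while the three other kinds of representatives move it. So an
    -- element acting trivially lies in `H`, and the induction hypothesis applies.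
    have hm' : act (π f) m = m := by rw [hf1, act_one]
    rcases hC f hf with hf | ⟨k, hk, rfl⟩ | ⟨k, hk, rfl⟩ | ⟨j, hj, k, hk, rfl⟩
    · exact ih' f hf hf1
    · rw [map_mul, act_mul, hfix k hk, hπ m hm, act_cyc_triple hmP hmQ hPQ] at hm'
      grind
    · rw [map_mul, act_mul, hfix k hk, map_inv, hπ m hm, cyc_triple_inv hmP hmQ hPQ,
        act_cyc_triple hmP.symm hPQ hmQ] at hm'
      grind
    · obtain ⟨h4, h5, h6⟩ := hne j hj
      rw [map_mul, act_mul, hfix k hk, map_mul, act_mul, map_inv, hπ m hm, hπ j (hT j hj),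
        cyc_triple_inv h5 h6 hPQ, act_cyc_triple hmP hmQ hPQ, act_cyc_triple h5.symm hPQ h6] at hm'
      grind

end AltPres

namespace AltPres

/-! ## Cycles on intervals -/

/-- Fixes the index type: `t` is a natural number and the cast sits inside the map. -/
theorem run_eq (i j : ℤ) :
    run i j = (List.range (j + 1 - i).toNat).map fun t : ℕ => i + (t : ℤ) := by
  simp [run, ← List.map_eq_flatMap, Function.comp_def]

theorem mem_run {i j m : ℤ} : m ∈ run i j ↔ i ≤ m ∧ m ≤ j := by
  simp only [run_eq, List.mem_map, List.mem_range]
  constructor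
  · rintro ⟨t, ht, rfl⟩; omega
  · rintro ⟨h1, h2⟩; exact ⟨(m - i).toNat, by omega, by omega⟩

theorem nodup_run (i j : ℤ) : (run i j).Nodup := by
  rw [run_eq]
  exact List.nodup_range.map fun s t hst => by simpa using hst

theorem length_run (i j : ℤ) : (run i j).length = (j + 1 - i).toNat := by simp [run_eq]

theorem run_eq_cons {i j : ℤ} (hij : i ≤ j) : run i j = i :: run (i + 1) j := by
  obtain ⟨t, ht⟩ : ∃ t : ℕ, (j + 1 - i).toNat = t + 1 := ⟨(j - i).toNat, by omega⟩
  have ht' : (j + 1 - (i + 1)).toNat = t := by omega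
  rw [run_eq, run_eq, ht, ht', List.range_succ_eq_map]
  simp only [List.map_cons, List.map_map, Function.comp_def]
  push_cast
  rw [add_zero]
  congr 2
  funext t
  ring

theorem run_append {i j l : ℤ} (hij : i ≤ j + 1) (hjl : j ≤ l) :
    run i j ++ run (j + 1) l = run i l := by
  obtain ⟨t, ht⟩ : ∃ t : ℕ, j = i - 1 + t := ⟨(j + 1 - i).toNat, by omega⟩
  subst ht
  induction t generalizing i with
  | zero =>
    have : run i (i - 1 + (0 : ℕ)) = [] := by simp [run]
    rw [this]; simp
  | succ t ih =>
    rw [run_eq_cons (i := i) (j := i - 1 + ((t + 1 : ℕ) : ℤ)) (by push_cast; omega),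
      run_eq_cons (i := i) (j := l) (by push_cast at hjl; omega), List.cons_append]
    have h1 : i - 1 + ((t + 1 : ℕ) : ℤ) = i + 1 - 1 + (t : ℤ) := by push_cast; ring
    rw [h1, ih (by omega) (by omega)]

theorem cyc_cons_cons (i j : ℤ) (l : List ℤ) : cyc (i :: j :: l) = cyc (j :: l) * cyc [i, j] := by
  rw [cyc, List.formPerm_cons_cons, MulOpposite.op_mul, cyc, cyc, List.formPerm_pair]

theorem act_cyc_run {i j : ℤ} (hij : i ≤ j) (m : ℤ) :
    act (cyc (run i j)) m = if i ≤ m ∧ m < j then m + 1 else if m = j then i else m := by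
  obtain ⟨t, ht⟩ : ∃ t : ℕ, i = j - t := ⟨(j - i).toNat, by omega⟩
  subst ht
  induction t with
  | zero =>
    have : run (j - (0 : ℕ)) j = [j] := by simp [run]
    rw [this, act_cyc, List.formPerm_singleton, Equiv.Perm.one_apply]
    grind
  | succ t ih =>
    have h1 : j - ((t + 1 : ℕ) : ℤ) + 1 = j - (t : ℤ) := by push_cast; ring
    rw [run_eq_cons hij, h1, run_eq_cons (i := j - (t : ℤ)) (by omega), cyc_cons_cons,
      ← run_eq_cons (by omega), act_mul, ih (by omega), act_cyc_pair]
    push_cast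
    grind

theorem act_cyc_cons_run {i j l : ℤ} (hij : i < j) (hjl : j ≤ l) (m : ℤ) :
    act (cyc (i :: run j l)) m =
      if m = i then j else if j ≤ m ∧ m < l then m + 1 else if m = l then i else m := by
  rw [run_eq_cons hjl, cyc_cons_cons, ← run_eq_cons hjl, act_mul, act_cyc_run hjl, act_cyc_pair]
  grind

theorem act_cyc_cons_cons_run {h i j l : ℤ} (hh : h < i) (hij : i < j) (hjl : j ≤ l) (m : ℤ) :
    act (cyc (h :: i :: run j l)) m = if m = h then i else
      if m = i then j else if j ≤ m ∧ m < l then m + 1 else if m = l then h else m := by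
  rw [cyc_cons_cons, act_mul, act_cyc_cons_run hij hjl, act_cyc_pair]
  grind

/-- The cycle lives on `1, …, N` and residues on `0, …, N - 1`, whence the shift by one. -/
theorem act_cyc_run_emod {N : ℤ} (hN : 1 ≤ N) (m : ℤ) :
    act (cyc (run 1 N)) (m % N + 1) = (m + 1) % N + 1 := by
  have h1 := Int.emod_nonneg m (by omega : N ≠ 0)
  have h2 := Int.emod_lt_of_pos m (by omega : 0 < N)
  rw [act_cyc_run hN, ← Int.emod_add_emod]
  by_cases h3 : m % N + 1 < N
  · rw [if_pos ⟨by omega, by omega⟩, Int.emod_eq_of_lt (by omega) h3]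
  · have h4 : m % N + 1 = N := by omega
    rw [if_neg (by omega), if_pos h4, h4, Int.emod_self]; rfl

theorem act_cyc_run_zpow_emod {N : ℤ} (hN : 1 ≤ N) (t m : ℤ) :
    act (cyc (run 1 N) ^ t) (m % N + 1) = (m + t) % N + 1 := by
  induction t using Int.induction_on with
  | zero => simp
  | succ t ih => rw [zpow_add_one, act_mul, ih, act_cyc_run_emod hN, add_assoc]
  | pred t ih =>
    rw [zpow_sub_one, act_mul, ih]
    apply act_inv_eq
    rw [act_cyc_run_emod hN]
    congr 2
    ring

/-- The integer `q` records the number of turns around the cycle (with sign), so that applications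
need only linear arithmetic and no residues. -/
theorem act_cyc_run_zpow {N : ℤ} {m t m' : ℤ} (q : ℤ) (h1 : 1 ≤ m) (h2 : m ≤ N) (h3 : 1 ≤ m')
    (h4 : m' ≤ N) (hm : m' = m + t + N * q) : act (cyc (run 1 N) ^ t) m = m' := by
  have h5 := act_cyc_run_zpow_emod (N := N) (by omega) t (m - 1)
  rw [Int.emod_eq_of_lt (by omega) (by omega)] at h5
  have h6 : (m - 1 + t) % N = m' - 1 := by
    have : m - 1 + t = (m' - 1) + N * (-q) := by rw [hm]; ring
    rw [this, Int.add_mul_emod_self_left, Int.emod_eq_of_lt (by omega) (by omega)]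
  rw [h6] at h5
  simpa using h5

/-! ## Multiplication by units -/

theorem act_mulPerm (p : ℕ) (α : (ZMod p)ˣ) (m : ℤ) : act (mulPerm p α) m =
    if 1 ≤ m ∧ m ≤ (p : ℤ) - 1 then (((α : ZMod p) * (m : ZMod p)).val : ℤ) else m := rfl

theorem act_mulPerm_of_not {p : ℕ} {α : (ZMod p)ˣ} {m : ℤ} (hm : ¬(1 ≤ m ∧ m ≤ (p : ℤ) - 1)) :
    act (mulPerm p α) m = m := by rw [act_mulPerm, if_neg hm]

theorem act_mulPerm_val {p : ℕ} [NeZero p] (α β : (ZMod p)ˣ) (hp : 1 < p) :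
    act (mulPerm p α) ((β : ZMod p).val : ℤ) = (((α * β : (ZMod p)ˣ) : ZMod p).val : ℤ) := by
  have h1 := ZMod.val_lt (β : ZMod p)
  have : Fact (1 < p) := ⟨hp⟩
  have h2 : (β : ZMod p).val ≠ 0 := (ZMod.val_ne_zero _).2 β.ne_zero
  rw [act_mulPerm, if_pos (by omega)]
  simp

theorem exists_unit_val {p : ℕ} (hp : p.Prime) {m : ℤ} (hm : 1 ≤ m ∧ m ≤ (p : ℤ) - 1) :
    ∃ β : (ZMod p)ˣ, ((β : ZMod p).val : ℤ) = m := by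
  have : Fact p.Prime := ⟨hp⟩
  have h0 : (m : ZMod p) ≠ 0 := by
    rw [Ne, ZMod.intCast_zmod_eq_zero_iff_dvd]
    intro hd
    have := Int.le_of_dvd (by omega) hd
    omega
  refine ⟨Units.mk0 _ h0, ?_⟩
  rw [Units.val_mk0, ZMod.val_intCast, Int.emod_eq_of_lt (by omega) (by omega)]

theorem mulPerm_mul {p : ℕ} (hp : p.Prime) (α β : (ZMod p)ˣ) :
    mulPerm p (α * β) = mulPerm p α * mulPerm p β := by
  have : Fact p.Prime := ⟨hp⟩
  refine rperm_ext fun m => ?_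
  rw [act_mul]
  by_cases hm : 1 ≤ m ∧ m ≤ (p : ℤ) - 1
  · obtain ⟨γ, rfl⟩ := exists_unit_val hp hm
    rw [act_mulPerm_val _ _ hp.one_lt, act_mulPerm_val _ _ hp.one_lt,
      act_mulPerm_val _ _ hp.one_lt, ← mul_assoc, mul_comm α]
  · rw [act_mulPerm_of_not hm, act_mulPerm_of_not hm, act_mulPerm_of_not hm]

/-- Multiplication by units of `ZMod p` as a homomorphism. -/
def mulPermHom {p : ℕ} (hp : p.Prime) : (ZMod p)ˣ →* RPerm :=
  MonoidHom.mk' (mulPerm p) (mulPerm_mul hp)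

theorem mulPerm_pow {p : ℕ} (hp : p.Prime) (α : (ZMod p)ˣ) (t : ℕ) :
    mulPerm p α ^ t = mulPerm p (α ^ t) := (map_pow (mulPermHom hp) α t).symm

theorem mulPerm_one {p : ℕ} (hp : p.Prime) : mulPerm p 1 = 1 := map_one (mulPermHom hp)

/-- The permutations `x ↦ x + t` and `x ↦ αx` of `𝔽ₚ`. -/
theorem cj_cyc_run_mulPerm {p : ℕ} (hp : p.Prime) (α : (ZMod p)ˣ) {s t : ℤ}
    (hst : (α : ZMod p) * (s : ZMod p) = t) :
    cj (cyc (run 1 p) ^ s) (mulPerm p α) = cyc (run 1 p) ^ t := by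
  have : Fact p.Prime := ⟨hp⟩
  have hp1 := hp.one_lt
  have hrep : ∀ m : ℤ, 1 ≤ m → m ≤ p → (m - 1) % p + 1 = m := fun m h1 h2 => by
    rw [Int.emod_eq_of_lt (by omega) (by omega)]; ring
  have hmod : ∀ m m' : ℤ, (m : ZMod p) = m' → m % p = m' % p := fun m m' h =>
    (ZMod.intCast_eq_intCast_iff' m m' p).1 h
  have hcast : ∀ m : ℤ, (((m - 1) % (p : ℤ) + 1 : ℤ) : ZMod p) = m := fun m => by
    push_cast; simp
  -- The zero residue is represented by `p`, which lies outside the range on which `mulPerm`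
  -- multiplies and is therefore fixed, as it should be.
  have key : ∀ m : ℤ, ((act (mulPerm p α) ((m - 1) % p + 1) : ℤ) : ZMod p) = α * m := by
    intro m
    rw [act_mulPerm]
    split_ifs with h1
    · push_cast [hcast]
      rw [ZMod.natCast_zmod_val]
    · have h2 := Int.emod_nonneg (m - 1) (by omega : (p : ℤ) ≠ 0)
      have h3 := Int.emod_lt_of_pos (m - 1) (by omega : 0 < (p : ℤ))
      have h4 : (m - 1) % p + 1 = (p : ℤ) := by omega
      have h5 := hcast m
      rw [h4] at h5 ⊢
      rw [← h5]; simp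
  have hrange : ∀ m : ℤ, 1 ≤ m → m ≤ p →
      1 ≤ act (mulPerm p α) m ∧ act (mulPerm p α) m ≤ p := by
    intro m h1 h2
    by_cases h3 : m ≤ (p : ℤ) - 1
    · have := (mulFun_aux p α m ⟨h1, h3⟩).1
      rw [act_mulPerm, if_pos ⟨h1, h3⟩]; omega
    · rw [act_mulPerm_of_not (by omega)]; exact ⟨h1, h2⟩
  have hcomm : cyc (run 1 p) ^ s * mulPerm p α = mulPerm p α * cyc (run 1 p) ^ t := by
    refine rperm_ext fun m => ?_
    rw [act_mul, act_mul]
    by_cases hm : 1 ≤ m ∧ m ≤ (p : ℤ)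
    · have h1 := act_cyc_run_zpow_emod (N := p) (by omega) s (m - 1)
      obtain ⟨h2, h3⟩ := hrange m hm.1 hm.2
      have h4 := act_cyc_run_zpow_emod (N := p) (by omega) t (act (mulPerm p α) m - 1)
      rw [hrep _ h2 h3] at h4
      rw [hrep m hm.1 hm.2] at h1
      rw [h1, h4]
      have h5 : m - 1 + s = (m + s) - 1 := by ring
      have h6 := Int.emod_nonneg (m - 1 + s) (by omega : (p : ℤ) ≠ 0)
      have h7 := Int.emod_lt_of_pos (m - 1 + s) (by omega : 0 < (p : ℤ))
      obtain ⟨h8, h9⟩ := hrange ((m - 1 + s) % p + 1) (by omega) (by omega)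
      rw [← hrep _ h8 h9]
      congr 1
      apply hmod
      have h10 := key m
      rw [hrep m hm.1 hm.2] at h10
      rw [h5]
      push_cast
      rw [key, h10, ← hst]
      push_cast
      ring
    · have h1 : act (cyc (run 1 p)) m = m := act_cyc_of_notMem (by rw [mem_run]; exact hm)
      rw [act_zpow_fixed h1, act_mulPerm_of_not (by omega), act_zpow_fixed h1]
  rw [cj, mul_assoc, hcomm, inv_mul_cancel_left]

/-! ## The permutation `ȳ` -/

theorem swaps_eq (k t : ℤ) : swaps k t =
    ((List.range t.toNat).map fun i : ℕ => cyc [-(i : ℤ), k + 1 + (i : ℤ)]).prod := by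
  simp [swaps, ← List.map_eq_flatMap, Function.comp_def]

theorem swaps_succ (k : ℤ) (t : ℕ) :
    swaps k ((t : ℤ) + 1) = swaps k t * cyc [-(t : ℤ), k + 1 + t] := by
  have h1 : ((t : ℤ) + 1).toNat = t + 1 := by omega
  rw [swaps_eq, swaps_eq, h1, Int.toNat_natCast, List.range_succ, List.map_append, List.prod_append]
  simp

theorem act_swaps {k t : ℤ} (hk : 0 ≤ k) (ht : 0 ≤ t) (m : ℤ) : act (swaps k t) m =
    if (k + 1 ≤ m ∧ m ≤ k + t) ∨ (1 - t ≤ m ∧ m ≤ 0) then k + 1 - m else m := by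
  obtain ⟨t, rfl⟩ := Int.eq_ofNat_of_zero_le ht
  induction t with
  | zero => simp [swaps]; grind
  | succ t ih =>
    push_cast
    rw [swaps_succ, act_mul, ih (by omega), act_cyc_pair]
    grind

theorem act_cyc_quad {v u s t : ℤ} (h1 : v ≠ u) (h2 : v ≠ s) (h3 : v ≠ t) (h4 : u ≠ s) (h5 : u ≠ t)
    (h6 : s ≠ t) (m : ℤ) : act (cyc [v, u, s, t]) m =
      if m = v then u else if m = u then s else if m = s then t else if m = t then v else m := by
  rw [cyc_cons_cons, act_mul, act_cyc_triple h4 h5 h6, act_cyc_pair]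
  grind

end AltPres

namespace AltPres

/-! ## The words in the concrete group -/

/-- The hypotheses on the parameters. -/
structure Admissible (n p : ℕ) (r α : (ZMod p)ˣ) (s : ℤ) : Prop where
  prime : p.Prime
  mod : p % 12 = 11
  lower : n + 2 ≤ 2 * p
  upper : p + 4 ≤ n
  gen : ∀ t : (ZMod p)ˣ, t ∈ Subgroup.zpowers r ↔ IsSquare t
  hs : (s : ZMod p) * ((r : ZMod p) - 1) = -1
  sq : IsSquare α
  cube : α ^ 3 = r

/-- The homomorphism from the free group to permutations. -/
def model (n p : ℕ) (α : (ZMod p)ˣ) : Word →* RPerm :=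
  FreeGroup.lift ![cyc (run 1 p), mulPerm p α * cyc [(p : ℤ) + 2, (p : ℤ) + 1, (p : ℤ)], yPerm n p]

/-- The representative of `i` modulo `p` in `{1, …, p}`. -/
def rep (p : ℕ) (i : ℤ) : ℤ := (i - 1) % p + 1

/-- `(p + 1, p + 2)` -/
def tau (p : ℕ) : RPerm := cyc [(p : ℤ) + 1, (p : ℤ) + 2]

theorem map_cj {G H : Type*} [Group G] [Group H] (f : G →* H) (x y : G) :
    f (cj x y) = cj (f x) (f y) := by simp [cj]

theorem cj_mul {G : Type*} [Group G] (x x' y : G) : cj (x * x') y = cj x y * cj x' y := by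
  simp [cj, mul_assoc]

theorem cj_cj {G : Type*} [Group G] (x y y' : G) : cj (cj x y) y' = cj x (y * y') := by
  simp [cj, mul_assoc]

theorem cj_pow {G : Type*} [Group G] (x y : G) (t : ℕ) : cj x y ^ t = cj (x ^ t) y := by
  induction t with
  | zero => simp [cj]
  | succ t ih => rw [pow_succ, ih, pow_succ, cj_mul]

theorem cj_eq_self {G : Type*} [Group G] {x y : G} (h : Commute x y) : cj x y = x := by
  rw [cj, mul_assoc, h.eq, inv_mul_cancel_left]

section

variable {n p : ℕ} {r α : (ZMod p)ˣ} {s : ℤ}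

theorem model_a : model n p α a = cyc (run 1 p) := by simp [model, a]

theorem model_g : model n p α g =
    mulPerm p α * cyc [(p : ℤ) + 2, (p : ℤ) + 1, (p : ℤ)] := by simp [model, g]

theorem model_y : model n p α y = yPerm n p := by simp [model, y]

theorem tau_mul_tau (p : ℕ) : tau p * tau p = 1 := cyc_pair_mul_self _ _

theorem tau_zpow_add_two (p : ℕ) (t : ℤ) : tau p ^ (t + 2) = tau p ^ t := by
  rw [zpow_add, zpow_two, tau_mul_tau, mul_one]

theorem tau_zpow_even {p : ℕ} {t : ℤ} (ht : Even t) : tau p ^ t = 1 := by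
  obtain ⟨t, rfl⟩ := ht
  rw [zpow_add, ← (Commute.refl (tau p)).mul_zpow, tau_mul_tau, one_zpow]

theorem rep_mem (hp : 1 < p) (i : ℤ) : 1 ≤ rep p i ∧ rep p i ≤ p := by
  have h1 := Int.emod_nonneg (i - 1) (by omega : (p : ℤ) ≠ 0)
  have h2 := Int.emod_lt_of_pos (i - 1) (by omega : 0 < (p : ℤ))
  unfold rep
  omega

theorem rep_of_mem {i : ℤ} (h1 : 1 ≤ i) (h2 : i ≤ p) : rep p i = i := by
  rw [rep, Int.emod_eq_of_lt (by omega) (by omega)]; ring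

theorem rep_eq_of_modEq {i j : ℤ} (hij : i ≡ j [ZMOD p]) : rep p i = rep p j := by
  rw [rep, rep, hij.sub_right 1]

theorem rep_eq {i j : ℤ} (q : ℤ) (h1 : 1 ≤ j) (h2 : j ≤ p) (hij : j = i + p * q) :
    rep p i = j := by
  rw [← rep_of_mem h1 h2, hij, rep, rep, add_sub_right_comm, Int.add_mul_emod_self_left]

namespace Admissible

variable (H : Admissible n p r α s)
include H

theorem le_p : 11 ≤ p := by have := H.mod; omega

theorem unit_pow_eq_one {β : (ZMod p)ˣ} (hβ : IsSquare β) : β ^ ((p - 1) / 2) = 1 := by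
  have : Fact p.Prime := ⟨H.prime⟩
  obtain ⟨γ, rfl⟩ := hβ
  have h1 := H.mod
  have h2 : 2 * ((p - 1) / 2) = p - 1 := by omega
  rw [← pow_two, ← pow_mul, h2, ZMod.units_pow_card_sub_one_eq_one]

theorem isSquare_r : IsSquare r := (H.gen r).1 (Subgroup.mem_zpowers r)

theorem commute_g :
    Commute (mulPerm p α) (cyc [(p : ℤ) + 2, (p : ℤ) + 1, (p : ℤ)]) := by
  have hp := H.le_p
  refine rperm_ext fun m => ?_
  rw [act_mul, act_mul]
  by_cases hm : 1 ≤ m ∧ m ≤ (p : ℤ) - 1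
  · rw [act_cyc_of_notMem (m := m) (by simp; omega), act_cyc_of_notMem]
    have := (mulFun_aux p α m hm).1
    rw [act_mulPerm, if_pos hm]
    simp; omega
  · rw [act_mulPerm_of_not hm, act_mulPerm_of_not]
    rw [act_cyc_triple (by omega) (by omega) (by omega)]
    split_ifs <;> omega

theorem model_b : model n p α b = mulPerm p r := by
  have hp := H.le_p
  rw [b, map_pow, model_g, H.commute_g.mul_pow, mulPerm_pow H.prime, H.cube]
  rw [show 3 = [(p : ℤ) + 2, (p : ℤ) + 1, (p : ℤ)].length from rfl, cyc_pow_length, mul_one]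
  simp

/-- Since `α` is a square, the exponent `(p-1)/2` kills its contribution. Since `p ≡ 11` modulo 12
this exponent is 2 modulo 3, so the 3-cycle in `g` is inverted. -/
theorem model_z : model n p α (z p) = cyc [(p : ℤ), (p : ℤ) + 1, (p : ℤ) + 2] := by
  have hp := H.le_p
  obtain ⟨j, hj⟩ : ∃ j : ℕ, (p - 1) / 2 = 3 * j + 2 := ⟨p / 6, by have := H.mod; omega⟩
  have h1 : ((p : ℤ) - 1) / 2 = ((3 * j + 2 : ℕ) : ℤ) := by omega
  have h3 : cyc [(p : ℤ) + 2, (p : ℤ) + 1, (p : ℤ)] ^ 3 = 1 := cyc_pow_length (by simp)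
  rw [z, map_zpow, model_g, h1, zpow_natCast, H.commute_g.mul_pow, mulPerm_pow H.prime, ← hj,
    H.unit_pow_eq_one H.sq, mulPerm_one H.prime, one_mul, hj, pow_add, pow_mul, h3, one_pow,
    one_mul, pow_two]
  refine rperm_ext fun m => ?_
  rw [act_mul, act_cyc_triple (by omega) (by omega) (by omega),
    act_cyc_triple (by omega) (by omega) (by omega), act_cyc_triple (by omega) (by omega) (by omega)]
  grind

theorem model_zi (i : ℤ) :
    model n p α (zi p i) = cyc [rep p i, (p : ℤ) + 1, (p : ℤ) + 2] := by
  have hp := H.le_p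
  have h1 := act_cyc_run_zpow_emod (N := p) (by omega) i (-1)
  have h2 : ((-1 : ℤ) % p + 1) = p := by
    have : (-1 : ℤ) = (p - 1) + p * (-1) := by ring
    rw [this, Int.add_mul_emod_self_left, Int.emod_eq_of_lt (by omega) (by omega)]; ring
  have h3 : act (cyc (run 1 p)) ((p : ℤ) + 1) = p + 1 :=
    act_cyc_of_notMem (by rw [mem_run]; omega)
  have h4 : act (cyc (run 1 p)) ((p : ℤ) + 2) = p + 2 :=
    act_cyc_of_notMem (by rw [mem_run]; omega)
  rw [h2, neg_add_eq_sub] at h1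
  rw [zi, map_cj, H.model_z, map_zpow, model_a, cj_cyc, List.map_cons, List.map_cons,
    List.map_singleton, h1, act_zpow_fixed h3, act_zpow_fixed h4, rep]

theorem model_dij {i j : ℤ} (hij : rep p i ≠ rep p j) :
    model n p α (dij p i j) = cyc [rep p i, rep p j] * tau p := by
  have hp := H.le_p
  have h1 := rep_mem (p := p) (by omega) i
  have h2 := rep_mem (p := p) (by omega) j
  rw [dij, map_mul, map_mul, map_inv, H.model_zi, H.model_zi,
    cyc_triple_double hij (by omega) (by omega) (by omega) (by omega) (by omega), tau]

theorem model_x : model n p α (x p) = cyc [1, (p : ℤ)] * tau p := by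
  have hp := H.le_p
  have h1 : rep p 0 = p := rep_eq 1 (by omega) (by omega) (by omega)
  have h2 : rep p 1 = 1 := rep_of_mem (by omega) (by omega)
  rw [x, H.model_dij (by omega), h1, h2, cyc_pair_comm]

theorem model_za : model n p α (z p * a) = cyc (run 1 (p + 2)) := by
  have hp := H.le_p
  rw [map_mul, H.model_z, model_a]
  refine rperm_ext fun m => ?_
  rw [act_mul, act_cyc_triple (by omega) (by omega) (by omega), act_cyc_run (by omega),
    act_cyc_run (by omega)]
  grind

/-- Here `ax` is `(1, …, p-1)(p+1, p+2)`: it rotates past the point `p`. Rotating back by `j`,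
forward by `j - i` while skipping `p`, and forward by `i` restores every point outside `i, …, j`. A
point `i ≤ m < j` gains one step at the skipped place, and `j` is parked on `p` and comes out at
`i`. -/
theorem model_cij₀ {i j : ℤ} (hi : 1 ≤ i) (hij : i ≤ j) (hj : j ≤ (p : ℤ) - 1) :
    model n p α (cij₀ p i j) = cyc (run i j) * tau p ^ (j - i) := by
  have hp := H.le_p
  have hE : model n p α (a * x p) = cyc (run 1 ((p : ℤ) - 1)) * tau p := by
    rw [map_mul, model_a, H.model_x]
    refine rperm_ext fun m => ?_
    rw [act_mul, act_mul, act_mul, act_cyc_run (by omega), act_cyc_run (by omega), act_cyc_pair]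
    congr 1
    grind
  have hEt : Commute (cyc (run 1 ((p : ℤ) - 1))) (tau p) := cyc_commute (by simp [mem_run]; omega)
  have hAt : Commute (cyc (run 1 (p : ℤ))) (tau p) := cyc_commute (by simp [mem_run]; omega)
  have hA0 : ∀ t m : ℤ, ¬(1 ≤ m ∧ m ≤ p) → act (cyc (run 1 (p : ℤ)) ^ t) m = m := fun t m hm =>
    act_zpow_fixed (act_cyc_of_notMem (by rw [mem_run]; exact hm)) t
  have hE0 : ∀ t m : ℤ, ¬(1 ≤ m ∧ m ≤ (p : ℤ) - 1) →
      act (cyc (run 1 ((p : ℤ) - 1)) ^ t) m = m := fun t m hm =>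
    act_zpow_fixed (act_cyc_of_notMem (by rw [mem_run]; exact hm)) t
  rw [cij₀, map_mul, map_mul, map_zpow, map_zpow, map_zpow, hE, model_a, hEt.mul_zpow]
  rw [mul_assoc, mul_assoc, (hAt.zpow_zpow i (j - i)).symm.eq, ← mul_assoc, ← mul_assoc]
  congr 1
  refine rperm_ext fun m => ?_
  rw [act_mul, act_mul, act_cyc_run hij]
  by_cases hm : 1 ≤ m ∧ m ≤ p
  -- The cases `m > j`, `m = j`, `i ≤ m < j` and `m < i` differ only in which of the three rotations
  -- wraps around, that is, in the values of `q`.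
  · have key : ∀ N m₁ t m₂ q : ℤ, m₂ = m₁ + t + N * q → 1 ≤ m₁ → m₁ ≤ N → 1 ≤ m₂ → m₂ ≤ N →
        act (cyc (run 1 N) ^ t) m₁ = m₂ := fun N m₁ t m₂ q h h1 h2 h3 h4 =>
      act_cyc_run_zpow q h1 h2 h3 h4 h
    by_cases h1 : j < m
    · rw [key p m (-j) (m - j) 0 (by ring), key (p - 1) (m - j) (j - i) (m - i) 0 (by ring),
        key p (m - i) i m 0 (by ring)] <;> grind
    · rw [key p m (-j) (m - j + p) 1 (by ring) (by omega) (by omega) (by omega) (by omega)]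
      by_cases h2 : m = j
      · rw [hE0 _ _ (by omega), key p (m - j + p) i i (-1) (by rw [h2]; ring)] <;> grind
      · by_cases h3 : i ≤ m
        · rw [key (p - 1) (m - j + p) (j - i) (m - i + 1) (-1) (by ring),
            key p (m - i + 1) i (m + 1) 0 (by ring)] <;> grind
        · rw [key (p - 1) (m - j + p) (j - i) (m - i + p) 0 (by ring),
            key p (m - i + p) i m (-1) (by ring)] <;> grind
  · rw [hA0 _ _ hm, hE0 _ _ (by omega), hA0 _ _ hm]
    grind

theorem model_z_conj {t i j l : ℤ} (h1 : -2 ≤ t) (h2 : t ≤ 0) (hi : i = p + t)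
    (hj : j = p + 1 + t) (hl : l = p + 2 + t) :
    model n p α (cj (z p) ((z p * a) ^ t)) = cyc [i, j, l] := by
  have hp := H.le_p
  have key : ∀ m : ℤ, (p : ℤ) ≤ m → m ≤ p + 2 → act (cyc (run 1 ((p : ℤ) + 2)) ^ t) m = m + t :=
    fun m h3 h4 => act_cyc_run_zpow 0 (by omega) (by omega) (by omega) (by omega) (by omega)
  rw [map_cj, H.model_z, map_zpow, H.model_za, cj_cyc]
  simp only [List.map_cons, List.map_nil]
  rw [key _ (by omega) (by omega), key _ (by omega) (by omega), key _ (by omega) (by omega), hi, hj,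
    hl]

/-- A 3-cycle of consecutive points that overlaps the top of the interval lengthens the cycle by two
points, so the parity of the exponent of `(p+1, p+2)` is unaffected. Doing this twice reaches `p +
2`. -/
theorem model_cij {i j : ℤ} (hij : cijDefined p i j) :
    model n p α (cij p i j) = cyc (run i j) * tau p ^ (j - i) := by
  have hp := H.le_p
  have h2 : model n p α (cj (z p) ((z p * a) ^ (-2 : ℤ))) =
      cyc [(p : ℤ) - 2, (p : ℤ) - 1, (p : ℤ)] :=
    H.model_z_conj (by omega) (by omega) (by ring) (by ring) (by ring)
  have h1 : model n p α (cj (z p) ((z p * a) ^ (-1 : ℤ))) =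
      cyc [(p : ℤ) - 1, (p : ℤ), (p : ℤ) + 1] :=
    H.model_z_conj (by omega) (by omega) (by ring) (by ring) (by ring)
  have hcp : 1 ≤ i → i ≤ (p : ℤ) - 2 →
      model n p α (cj (z p) ((z p * a) ^ (-2 : ℤ)) * cij₀ p i (p - 2)) =
        cyc (run i p) * tau p ^ ((p : ℤ) - i) := by
    intro h3 h4
    have h5 : (p : ℤ) - i = (p : ℤ) - 2 - i + 2 := by ring
    rw [map_mul, h2, H.model_cij₀ h3 h4 (by omega), h5, tau_zpow_add_two, ← mul_assoc]
    congr 1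
    refine rperm_ext fun m => ?_
    rw [act_mul, act_cyc_triple (by omega) (by omega) (by omega), act_cyc_run (by omega),
      act_cyc_run (by omega)]
    grind
  rw [cij]
  rcases hij with ⟨h3, h4, h5⟩ | ⟨h3, h4, rfl⟩ | ⟨h3, h4, rfl⟩ | ⟨h3, h4, rfl⟩
  · rw [if_pos h5, H.model_cij₀ h3 h4 h5]
  · rw [if_neg (by omega), if_pos rfl, hcp h3 h4]
  · rw [if_neg (by omega), if_neg (by omega), if_pos rfl]
    have h5 : (p : ℤ) + 1 - i = (p : ℤ) - 1 - i + 2 := by ring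
    rw [map_mul, h1, H.model_cij₀ h3 h4 (by omega), h5, tau_zpow_add_two, ← mul_assoc]
    congr 1
    refine rperm_ext fun m => ?_
    rw [act_mul, act_cyc_triple (by omega) (by omega) (by omega), act_cyc_run (by omega),
      act_cyc_run (by omega)]
    grind
  · rw [if_neg (by omega), if_neg (by omega), if_neg (by omega)]
    have h5 : (p : ℤ) + 2 - i = (p : ℤ) - i + 2 := by ring
    rw [map_mul, H.model_z, hcp h3 h4, h5, tau_zpow_add_two, ← mul_assoc]
    congr 1
    refine rperm_ext fun m => ?_
    rw [act_mul, act_cyc_triple (by omega) (by omega) (by omega), act_cyc_run (by omega),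
      act_cyc_run (by omega)]
    grind

theorem model_aTilde : model n p α (aTilde p) = cyc [1, 2, 3] := by
  have hp := H.le_p
  have hr : ∀ i : ℤ, 1 ≤ i → i ≤ 3 → rep p i = i := fun i h1 h2 => rep_of_mem h1 (by omega)
  rw [aTilde, map_cj, map_mul, H.model_zi, H.model_zi, H.model_zi, hr 1 (by omega) (by omega),
    hr 2 (by omega) (by omega), hr 3 (by omega) (by omega), cj_cyc]
  simp only [List.map_cons, List.map_nil, act_mul]
  rw [cyc_triple_rotate (i := 1) (j := 2) (l := 3) (by omega) (by omega) (by omega),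
    cyc_triple_rotate (i := 2) (j := 3) (l := 1) (by omega) (by omega) (by omega)]
  have ht : ∀ i : ℤ, i ≤ 3 → ∀ m, act (cyc [i, (p : ℤ) + 1, (p : ℤ) + 2]) m =
      if m = i then (p : ℤ) + 1 else if m = (p : ℤ) + 1 then (p : ℤ) + 2 else
        if m = (p : ℤ) + 2 then i else m := fun i hi m =>
    act_cyc_triple (by omega) (by omega) (by omega) m
  simp only [ht 1 (by omega), ht 2 (by omega)]
  congr 1
  grind

end Admissible
end
end AltPres

/-! ### Values of the words c, d, e and h -/

namespace AltPres

theorem act_cj {f f' : RPerm} (m : ℤ) : act (cj f f') (act f' m) = act f' (act f m) := by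
  rw [cj, act_mul, act_mul, act_inv_act]

/-- `(XU⁻²)ᵗXU²ᵗ` is a product of conjugates of `X` by even powers of `U`. -/
theorem telescope_succ {G : Type*} [Group G] (X U : G) (t : ℕ) :
    (X * U ^ (-2 : ℤ)) ^ ((t : ℤ) + 1) * X * U ^ (2 * ((t : ℤ) + 1)) =
      (X * U ^ (-2 : ℤ)) ^ (t : ℤ) * X * U ^ (2 * (t : ℤ)) * cj X (U ^ (2 * ((t : ℤ) + 1))) := by
  rw [zpow_add_one, cj]
  have : U ^ (2 * (t : ℤ)) * (U ^ (2 * ((t : ℤ) + 1)))⁻¹ = U ^ (-2 : ℤ) := by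
    rw [← zpow_neg, ← zpow_add]; congr 1; ring
  rw [← this]
  group

/-- The number `k` has the parity of `n`; this removes the factor `(p+1, p+2)` from `c` and from the
words `c(i, k+1)` inside `e`. -/
theorem even_kk_sub_one {n p : ℕ} (hn : Odd (n : ℤ)) : Even (kk n p - 1) := by
  obtain ⟨m, hm⟩ := hn
  exact ⟨p + 1 - m, by unfold kk; omega⟩

theorem even_kk {n p : ℕ} (hn : ¬Odd (n : ℤ)) : Even (kk n p) := by
  obtain ⟨m, hm⟩ := Int.not_odd_iff_even.1 hn
  exact ⟨p + 2 - m, by unfold kk; omega⟩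

namespace Admissible

variable {n p : ℕ} {r α : (ZMod p)ˣ} {s : ℤ} (H : Admissible n p r α s)
include H

/-- At least six points are fixed by `y`; the decomposition in `mul_cj_sq` uses all of 1, …, 6. -/
theorem kk_ge : 6 ≤ kk n p := by have := H.lower; unfold kk; omega

theorem kk_le : kk n p ≤ p := by have := H.upper; unfold kk; omega

theorem kk_lt (hn : ¬Odd (n : ℤ)) : kk n p ≤ p - 1 := by
  obtain ⟨m, hm⟩ := even_kk (p := p) hn
  have := H.mod
  have := H.kk_le
  omega

theorem kk_le_sub_two (hn : Odd (n : ℤ)) (hk : kk n p ≠ p) : kk n p ≤ p - 2 := by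
  obtain ⟨m, hm⟩ := even_kk_sub_one (p := p) hn
  have := H.mod
  have := H.kk_le
  omega

theorem model_c : model n p α (c n p) =
    if Odd (n : ℤ) then cyc (run 1 (kk n p)) else cyc (run 2 (kk n p)) := by
  have h1 := H.kk_ge
  have h2 := H.kk_le
  rw [c]
  split_ifs with hn
  · rw [H.model_cij (by unfold cijDefined; omega), tau_zpow_even (even_kk_sub_one hn), mul_one]
  · rw [H.model_cij (by unfold cijDefined; omega),
      tau_zpow_even ((even_kk hn).sub even_two), mul_one]

theorem model_d : model n p α (d p) = cyc (run 5 (p + 2)) := by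
  have h1 := H.le_p
  have h2 := H.mod
  rw [d, H.model_cij (by unfold cijDefined; omega), tau_zpow_even ⟨((p : ℤ) - 3) / 2, by omega⟩,
    mul_one]

theorem model_e : model n p α (e n p) =
    if Odd (n : ℤ) then cyc (1 :: run (kk n p + 1) (p + 2))
      else cyc (1 :: 2 :: run (kk n p + 1) (p + 2)) := by
  have h1 := H.kk_ge
  have h2 := H.kk_le
  rw [e]
  split_ifs with hn
  · have h3 : kk n p + 1 - 2 = kk n p - 1 := by ring
    rw [map_mul, map_inv, H.model_za, H.model_cij (by unfold cijDefined; omega), h3,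
      tau_zpow_even (even_kk_sub_one hn), mul_one, mul_inv_eq_iff_eq_mul]
    refine rperm_ext fun m => ?_
    rw [act_mul, act_cyc_run (by omega), act_cyc_run (by omega),
      act_cyc_cons_run (by omega) (by omega)]
    grind
  · have h3 : kk n p + 1 - 3 = kk n p - 2 := by ring
    have h4 := H.kk_lt hn
    rw [map_mul, map_inv, H.model_za, H.model_cij (by unfold cijDefined; omega), h3,
      tau_zpow_even ((even_kk hn).sub even_two), mul_one, mul_inv_eq_iff_eq_mul]
    refine rperm_ext fun m => ?_
    rw [act_mul, act_cyc_run (by omega), act_cyc_run (by omega),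
      act_cyc_cons_cons_run (by omega) (by omega) (by omega)]
    grind

/-! ### The element `h` -/

/-- The squares form a cyclic group of odd order `(p-1)/2` generated by `r`, so `r²` has that same
order. -/
theorem eq_one_of_sq_pow {j : ℕ} (hj : (r ^ 2) ^ j = 1) : (p - 1) / 2 ∣ j := by
  have : Fact p.Prime := ⟨H.prime⟩
  have h0 := H.mod
  obtain ⟨γ, hγ⟩ := IsCyclic.exists_ofOrder_eq_natCard (α := (ZMod p)ˣ)
  obtain ⟨i, hi⟩ := (H.gen (γ * γ)).2 ⟨γ, rfl⟩
  have h1 : γ ^ (4 * j) = 1 := by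
    have : γ ^ (4 * j) = ((γ * γ) ^ 2) ^ j := by rw [← pow_two, ← pow_mul, ← pow_mul]; congr 1; ring
    have h2 : ((r ^ i) ^ 2) ^ j = ((r ^ 2) ^ j) ^ i := by group
    rw [this, ← hi, h2, hj, one_zpow]
  have h2 := orderOf_dvd_of_pow_eq_one h1
  rw [hγ, Nat.card_eq_fintype_card, ZMod.card_units] at h2
  have h3 : Nat.Coprime ((p - 1) / 2) 4 := by
    have : Odd ((p - 1) / 2) := ⟨(p - 3) / 4, by omega⟩
    exact Nat.Coprime.pow_right 2 (Nat.coprime_two_right.2 this)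
  exact h3.dvd_of_dvd_mul_left ((Nat.div_dvd_of_dvd (by omega)).trans h2)

/-- As `q = (p-1)/2` is odd, `(q+1)/2` inverts 2 modulo `q`, and exponents of `r` can be halved. -/
theorem exists_sq_pow {β : (ZMod p)ˣ} (hβ : IsSquare β) :
    ∃ j < (p - 1) / 2, β = (r ^ 2) ^ j := by
  have h0 := H.mod
  obtain ⟨i, hi⟩ := (H.gen β).2 hβ
  simp only at hi
  set q := (p - 1) / 2 with hq
  have h1 : r ^ (q : ℤ) = 1 := by rw [zpow_natCast]; exact H.unit_pow_eq_one H.isSquare_r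
  have h2 := Int.emod_nonneg (i * (((q : ℤ) + 1) / 2)) (by omega : (q : ℤ) ≠ 0)
  have h3 := Int.emod_lt_of_pos (i * (((q : ℤ) + 1) / 2)) (by omega : 0 < (q : ℤ))
  obtain ⟨j, hj⟩ := Int.eq_ofNat_of_zero_le h2
  refine ⟨j, by omega, ?_⟩
  have h4 := Int.emod_add_mul_ediv (i * (((q : ℤ) + 1) / 2)) q
  have h5 : 2 * (((q : ℤ) + 1) / 2) = q + 1 := by omega
  rw [← hi, ← pow_mul, ← zpow_natCast]
  have h6 : i = ((2 * j : ℕ) : ℤ) +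
      q * (2 * ((i * (((q : ℤ) + 1) / 2)) / q) - i) := by
    rw [hj] at h4
    push_cast
    linear_combination 2 * h4.symm - i * h5
  conv_lhs => rw [h6, zpow_add, zpow_mul, h1, one_zpow, mul_one]

/-- Euler's criterion: `p ≡ 3` modulo 4, so -1 is not a square. -/
theorem isSquare_or (β : (ZMod p)ˣ) : IsSquare β ∨ IsSquare (-β) := by
  have : Fact p.Prime := ⟨H.prime⟩
  have h0 := H.mod
  have h1 : ∀ γ : (ZMod p)ˣ, γ ^ (p / 2) = 1 → IsSquare γ := fun γ hγ => by
    obtain ⟨δ, hδ⟩ := (ZMod.euler_criterion_units p γ).2 hγ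
    exact ⟨δ, by rw [← hδ, pow_two]⟩
  rcases ZMod.pow_div_two_eq_neg_one_or_one p β.ne_zero with h3 | h3
  · exact Or.inl (h1 _ (Units.ext (by push_cast; exact h3)))
  · refine Or.inr (h1 _ ?_)
    rw [Odd.neg_pow ⟨p / 4, by omega⟩, show β ^ (p / 2) = -1 from Units.ext (by push_cast; exact h3), neg_neg]


/-- Multiplication by `r²` has two cycles on the nonzero residues, the squares and their negatives,
each of length `(p-1)/2`. The factor `z(1)z(-1) = (1, p+2)(p+1, p-1)` inserts `p + 2` into the cycle
through 1 and `p + 1` into the cycle through -1. The result has two cycles of length `(p+1)/2`,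
which is the exponent in `h`. -/
theorem model_h : model n p α (h p) = 1 := by
  have : Fact p.Prime := ⟨H.prime⟩
  have h0 := H.mod
  have hp := H.le_p
  have hr1 : rep p 1 = 1 := rep_of_mem (by omega) (by omega)
  have hr2 : rep p (-1) = p - 1 := rep_eq 1 (by omega) (by omega) (by omega)
  obtain ⟨q, hq⟩ : ∃ q, q = (p - 1) / 2 := ⟨_, rfl⟩
  have hq1 : ((p : ℤ) + 1) / 2 = ((q + 1 : ℕ) : ℤ) := by omega
  have hone : (1 : ZMod p).val = 1 := ZMod.val_one p
  have hnegone : ((-1 : ZMod p).val : ℤ) = p - 1 := by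
    rw [ZMod.val_neg_of_ne_zero, hone, Nat.cast_sub (by omega)]; rfl
  set B : RPerm := mulPerm p (r ^ 2) * (cyc [1, (p : ℤ) + 2] * cyc [(p : ℤ) + 1, p - 1]) with hB
  have hmB : model n p α (h p) = B ^ (q + 1) := by
    rw [h, map_zpow, hq1, zpow_natCast, map_mul, map_mul, map_pow, H.model_b, H.model_zi,
      H.model_zi, hr1, hr2, mulPerm_pow H.prime, mul_assoc, cyc_triple_mul_triple (by omega)
      (by omega) (by omega) (by omega) (by omega) (by omega)]
  have hactB : ∀ β : (ZMod p)ˣ, act B ((β : ZMod p).val : ℤ) =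
      if r ^ 2 * β = 1 then (p : ℤ) + 2 else if r ^ 2 * β = -1 then (p : ℤ) + 1 else
        ((((r ^ 2 * β : (ZMod p)ˣ) : ZMod p).val : ℕ) : ℤ) := by
    intro β
    rw [hB, act_mul, act_mul, act_mulPerm_val _ _ H.prime.one_lt]
    generalize r ^ 2 * β = γ
    have hγ := ZMod.val_lt (γ : ZMod p)
    by_cases h1 : γ = 1
    · rw [if_pos h1, h1, Units.val_one, hone, act_cyc_pair, act_cyc_pair]
      grind
    have h1' : ((γ : ZMod p).val : ℤ) ≠ 1 := fun h => h1 (Units.ext (ZMod.val_injective p (by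
      rw [Units.val_one, hone]; exact_mod_cast h)))
    by_cases h2 : γ = -1
    · rw [if_neg h1, if_pos h2, h2, Units.val_neg, Units.val_one, hnegone, act_cyc_pair,
        act_cyc_pair]
      grind
    have h2' : ((γ : ZMod p).val : ℤ) ≠ p - 1 := fun h => h2 (Units.ext (ZMod.val_injective p (by
      rw [Units.val_neg, Units.val_one]; zify; rw [hnegone, h])))
    rw [if_neg h1, if_neg h2, act_cyc_pair, act_cyc_pair]
    grind
  have hneg : ∀ β : (ZMod p)ˣ, IsSquare β → β ≠ -1 := by
    rintro β hβ rfl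
    have h1 := H.unit_pow_eq_one hβ
    rw [Odd.neg_one_pow ⟨p / 4, by omega⟩] at h1
    have h2 : ((-1 : (ZMod p)ˣ) : ZMod p).val = ((1 : (ZMod p)ˣ) : ZMod p).val := by rw [h1]
    rw [Units.val_neg, Units.val_one] at h2
    omega
  have hsq : ∀ j : ℕ, IsSquare ((r ^ 2) ^ j) := fun j => (IsSquare.sq r).pow j
  have hrq : (r ^ 2) ^ q = 1 := by
    rw [← pow_mul, mul_comm, pow_mul, hq, H.unit_pow_eq_one H.isSquare_r, one_pow]
  -- One cycle of length `q + 1`: the extra point `m` goes to `ε`, then along `ε r²`, `ε r⁴`, and so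
  -- on back to `m`. It is applied with `ε = 1`, `m = p + 2` and with `ε = -1`, `m = p + 1`.
  have horb : ∀ (ε : (ZMod p)ˣ) (m : ℤ), act B m = ((ε : ZMod p).val : ℤ) →
      (∀ j : ℕ, act B (((ε * (r ^ 2) ^ j : (ZMod p)ˣ) : ZMod p).val : ℤ) =
        if q ∣ j + 1 then m else (((ε * (r ^ 2) ^ (j + 1) : (ZMod p)ˣ) : ZMod p).val : ℤ)) →
      act (B ^ (q + 1)) m = m ∧
      ∀ j < q, act (B ^ (q + 1)) (((ε * (r ^ 2) ^ j : (ZMod p)ˣ) : ZMod p).val : ℤ) =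
        (((ε * (r ^ 2) ^ j : (ZMod p)ˣ) : ZMod p).val : ℤ) := by
    intro ε m h1 h2
    have h3 : ∀ j < q, act (B ^ (j + 1)) m = (((ε * (r ^ 2) ^ j : (ZMod p)ˣ) : ZMod p).val : ℤ) := by
      intro j
      induction j with
      | zero => intro _; rw [zero_add, pow_one, h1, pow_zero, mul_one]
      | succ j ih =>
        intro hj
        rw [pow_succ, act_mul, ih (by omega), h2, if_neg]
        exact fun h => absurd (Nat.le_of_dvd (by omega) h) (by omega)
    have h4 : act (B ^ (q + 1)) m = m := by
      obtain ⟨j, rfl⟩ : ∃ j, q = j + 1 := ⟨q - 1, by omega⟩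
      rw [pow_succ, act_mul, h3 j (by omega), h2, if_pos dvd_rfl]
    refine ⟨h4, fun j hj => ?_⟩
    rw [← h3 j hj, ← act_mul, ← pow_add, add_comm, pow_add, act_mul, h4]
  have horb1 := horb 1 (p + 2) (by
      rw [hB, act_mul, act_mul, act_mulPerm_of_not (by omega), act_cyc_pair, act_cyc_pair,
        Units.val_one, hone]
      grind) (fun j => by
      rw [hactB, one_mul, one_mul, ← pow_succ']
      by_cases hj : q ∣ j + 1
      · obtain ⟨t, ht⟩ := hj
        rw [ht, pow_mul, hrq, one_pow, if_pos rfl, if_pos (Dvd.intro t rfl)]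
      · rw [if_neg hj, if_neg, if_neg (hneg _ (hsq _))]
        intro h
        exact hj (hq ▸ H.eq_one_of_sq_pow h))
  have horb2 := horb (-1) (p + 1) (by
      rw [hB, act_mul, act_mul, act_mulPerm_of_not (by omega), act_cyc_pair, act_cyc_pair,
        Units.val_neg, Units.val_one, hnegone]
      grind) (fun j => by
      rw [hactB, neg_one_mul, neg_one_mul, mul_neg, ← pow_succ']
      by_cases hj : q ∣ j + 1
      · obtain ⟨t, ht⟩ := hj
        rw [ht, pow_mul, hrq, one_pow, if_neg, if_pos rfl, if_pos (Dvd.intro t rfl)]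
        exact fun h => hneg 1 (IsSquare.one) h.symm
      · rw [if_neg hj, if_neg, if_neg]
        · intro h
          exact hj (hq ▸ H.eq_one_of_sq_pow (neg_injective h))
        · intro h
          exact hneg _ (hsq (j + 1)) (by rw [← h, neg_neg]))
  rw [hmB]
  refine rperm_ext fun m => ?_
  rw [act_one]
  by_cases h1 : m = p + 2
  · rw [h1]; exact horb1.1
  by_cases h2 : m = p + 1
  · rw [h2]; exact horb2.1
  by_cases h3 : 1 ≤ m ∧ m ≤ (p : ℤ) - 1
  · obtain ⟨β, rfl⟩ := exists_unit_val H.prime h3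
    rcases H.isSquare_or β with h4 | h4
    · obtain ⟨j, hj, rfl⟩ := H.exists_sq_pow h4
      have := horb1.2 j (hq ▸ hj)
      rwa [one_mul] at this
    · obtain ⟨j, hj, h5⟩ := H.exists_sq_pow h4
      have := horb2.2 j (hq ▸ hj)
      rwa [← h5, neg_one_mul, neg_neg] at this
  · have h4 : act B m = m := by
      rw [hB, act_mul, act_mul, act_mulPerm_of_not h3, act_cyc_pair, act_cyc_pair]
      grind
    rw [← zpow_natCast, act_zpow_fixed h4]

end Admissible
end AltPres

namespace AltPres
namespace Admissible

variable {n p : ℕ} {r α : (ZMod p)ˣ} {s : ℤ} (H : Admissible n p r α s)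
include H

/-! ### The element `y` -/

theorem act_yPerm (m : ℤ) : act (yPerm n p) m =
    if Odd (n : ℤ) then
      if (kk n p + 1 ≤ m ∧ m ≤ p + 2) ∨ (-p - 1 + kk n p ≤ m ∧ m ≤ 0) then kk n p + 1 - m else m
    else
      if (kk n p + 1 ≤ m ∧ m ≤ p) ∨ (-p + 1 + kk n p ≤ m ∧ m ≤ 0) then kk n p + 1 - m
      else if m = p + 1 then -p - 1 + kk n p else if m = p + 2 then -p + kk n p
      else if m = -p - 1 + kk n p then p + 2 else if m = -p + kk n p then p + 1 else m := by
  have h1 := H.kk_ge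
  have h2 := H.kk_le
  rw [yPerm]
  split_ifs with hn
  all_goals
    first
    | have h3 := H.kk_lt hn
      rw [act_mul, act_swaps (by omega) (by omega), act_cyc_quad (by omega) (by omega) (by omega)
        (by omega) (by omega) (by omega)]
      grind
    | rw [act_swaps (by omega) (by omega)]
      grind

theorem act_yPerm_of_le {m : ℤ} (h1 : 1 ≤ m) (h2 : m ≤ kk n p) : act (yPerm n p) m = m := by
  have := H.kk_le
  rw [H.act_yPerm]
  split_ifs <;> omega

/-- The reflection `m ↦ k + 1 - m` fails at `p + 1` and `p + 2` for even `n`, where a 4-cycle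
replaces two transpositions to make the permutation even. -/
theorem act_yPerm_of_lt {m : ℤ} (h1 : kk n p < m) (h2 : m ≤ p + 2)
    (h3 : ¬Odd (n : ℤ) → m ≤ p) : act (yPerm n p) m = kk n p + 1 - m := by
  rw [H.act_yPerm]
  by_cases hn : Odd (n : ℤ)
  · rw [if_pos hn, if_pos (by omega)]
  · have := h3 hn
    rw [if_neg hn, if_pos (by omega)]

theorem act_yPerm_neg {m : ℤ} (h1 : kk n p < m) (h2 : m ≤ p + 2) :
    -p - 1 + kk n p ≤ act (yPerm n p) m ∧ act (yPerm n p) m ≤ 0 := by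
  have := H.kk_le
  rw [H.act_yPerm]
  split_ifs <;> omega

theorem act_yPerm_of_notMem {m : ℤ} (hm : m ∉ Finset.Icc (-p - 1 + kk n p) ((p : ℤ) + 2)) :
    act (yPerm n p) m = m := by
  have := H.kk_le
  rw [Finset.mem_Icc] at hm
  rw [H.act_yPerm]
  split_ifs <;> omega

theorem exists_act_yPerm {m : ℤ} (h1 : -p - 1 + kk n p ≤ m) (h2 : m ≤ 0) :
    ∃ m', kk n p < m' ∧ m' ≤ p + 2 ∧ act (yPerm n p) m' = m := by
  have h3 := H.kk_ge
  have h4 := H.kk_le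
  by_cases hn : Odd (n : ℤ)
  · refine ⟨kk n p + 1 - m, by omega, by omega, ?_⟩
    rw [H.act_yPerm_of_lt (by omega) (by omega) (fun h => absurd hn h)]; ring
  · have h5 := H.kk_lt hn
    by_cases h6 : m = -p - 1 + kk n p
    · refine ⟨p + 1, by omega, by omega, ?_⟩
      rw [H.act_yPerm, if_neg hn, if_neg (by omega), if_pos rfl, h6]
    by_cases h7 : m = -p + kk n p
    · refine ⟨p + 2, by omega, by omega, ?_⟩
      rw [H.act_yPerm, if_neg hn, if_neg (by omega), if_neg (by omega), if_pos rfl, h7]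
    refine ⟨kk n p + 1 - m, by omega, by omega, ?_⟩
    rw [H.act_yPerm_of_lt (by omega) (by omega) (fun _ => by omega)]; ring

/-! ### The words `x̃`, `u`, `w` -/

/-- The two factors `(p+1, p+2)` cancel, leaving `(1, k+2)(2, k+1)`. Its conjugate by `y` is `(1,
-1)(2, 0)`, and conjugating by that replaces 1, 2 by -1, 0. -/
theorem model_xt (hk : kk n p ≤ p - 2) :
    model n p α (xt n p) = cyc [-1, kk n p + 2] * cyc [0, kk n p + 1] := by
  have h1 := H.kk_ge
  have hp := H.le_p
  have hr : ∀ i : ℤ, 1 ≤ i → i ≤ p → rep p i = i := fun i => rep_of_mem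
  have hd : ∀ i j : ℤ, 1 ≤ i → i < j → j ≤ p →
      model n p α (dij p i j) = cyc [i, j] * tau p := fun i j h2 h3 h4 => by
    rw [H.model_dij (by rw [hr i (by omega) (by omega), hr j (by omega) (by omega)]; omega),
      hr i (by omega) (by omega), hr j (by omega) (by omega)]
  have hD : model n p α (dij p 1 (kk n p + 2) * dij p 2 (kk n p + 1)) =
      cyc [1, kk n p + 2] * cyc [2, kk n p + 1] := by
    rw [map_mul, hd _ _ (by omega) (by omega) (by omega), hd _ _ (by omega) (by omega) (by omega),
      mul_assoc, ← mul_assoc (tau p), tau,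
      (cyc_pairs_commute (i := (p : ℤ) + 1) (i' := 2) (by omega) (by omega) (by omega)
        (by omega)).eq, mul_assoc, cyc_pair_mul_self, mul_one]
  have hy1 : act (yPerm n p) 1 = 1 := H.act_yPerm_of_le (by omega) (by omega)
  have hy2 : act (yPerm n p) 2 = 2 := H.act_yPerm_of_le (by omega) (by omega)
  have hy3 : act (yPerm n p) (kk n p + 1) = 0 := by
    rw [H.act_yPerm_of_lt (by omega) (by omega) (fun _ => by omega)]; ring
  have hy4 : act (yPerm n p) (kk n p + 2) = -1 := by
    rw [H.act_yPerm_of_lt (by omega) (by omega) (fun _ => by omega)]; ring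
  rw [xt, map_cj, ← cj_mul, map_cj, hD, model_y]
  simp only [cj_mul, cj_cyc, List.map_cons, List.map_nil, hy1, hy2, hy3, hy4, act_mul]
  have e1 : act (cyc [2, 0]) (act (cyc [1, -1]) 1) = -1 := by simp [act_cyc_pair]
  have e2 : act (cyc [2, 0]) (act (cyc [1, -1]) 2) = 0 := by simp [act_cyc_pair]
  have e3 : act (cyc [2, 0]) (act (cyc [1, -1]) (kk n p + 2)) = kk n p + 2 := by
    rw [act_cyc_pair, act_cyc_pair]; grind
  have e4 : act (cyc [2, 0]) (act (cyc [1, -1]) (kk n p + 1)) = kk n p + 1 := by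
    rw [act_cyc_pair, act_cyc_pair]; grind
  rw [e1, e2, e3, e4]

theorem model_u' : model n p α (u p) =
    cyc (run 1 (p + 2)) * cyc ((run 1 (p + 2)).map (act (yPerm n p))) := by
  rw [u, map_mul, map_cj, H.model_za, model_y, cj_cyc]

theorem map_yPerm_run (hk : kk n p ≤ p - 1) : (run 1 ((p : ℤ) + 2)).map (act (yPerm n p)) =
    if Odd (n : ℤ) then run 1 (kk n p) ++ (run (-p - 1 + kk n p) 0).reverse
    else run 1 (kk n p) ++ (run (-p + 1 + kk n p) 0).reverse ++
      [-p - 1 + kk n p, -p + kk n p] := by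
  have h1 := H.kk_ge
  have hfix : (run 1 (kk n p)).map (act (yPerm n p)) = run 1 (kk n p) := by
    conv_rhs => rw [← List.map_id (run 1 (kk n p))]
    refine List.map_congr_left fun m hm => ?_
    rw [mem_run] at hm
    exact H.act_yPerm_of_le hm.1 hm.2
  have hneg : ∀ j : ℤ, kk n p ≤ j → j ≤ p + 2 → (¬Odd (n : ℤ) → j ≤ p) →
      (run (kk n p + 1) j).map (act (yPerm n p)) = (run (kk n p + 1 - j) 0).reverse := by
    intro j h2 h3 h4
    have h5 : (run (kk n p + 1) j).map (act (yPerm n p)) =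
        (run (kk n p + 1) j).map fun m => kk n p + 1 - m := by
      refine List.map_congr_left fun m hm => ?_
      rw [mem_run] at hm
      exact H.act_yPerm_of_lt (by omega) (by omega) fun h => by have := h4 h; omega
    rw [h5]
    have h6 : (j + 1 - (kk n p + 1)).toNat = (0 + 1 - (kk n p + 1 - j)).toNat := by congr 1; ring
    refine List.ext_getElem (by
      rw [List.length_map, List.length_reverse, length_run, length_run, h6]) fun t h7 h8 => ?_
    simp only [List.length_map, length_run] at h7
    simp only [List.getElem_map, List.getElem_reverse, run_eq, List.getElem_range, List.length_map,
      List.length_range]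
    omega
  rw [← run_append (i := 1) (j := kk n p) (by omega) (by omega), List.map_append, hfix]
  split_ifs with hn
  · rw [hneg _ (by omega) (by omega) (fun h => absurd hn h)]
    congr 3
    ring
  · have h2 := H.act_yPerm (p + 1)
    have h3 := H.act_yPerm (p + 2)
    rw [if_neg hn, if_neg (by omega), if_pos rfl] at h2
    rw [if_neg hn, if_neg (by omega), if_neg (by omega), if_pos rfl] at h3
    rw [← run_append (i := kk n p + 1) (j := p) (by omega) (by omega), List.map_append,
      hneg _ (by omega) (by omega) (fun _ => le_rfl), 
      run_eq_cons (i := (p : ℤ) + 1) (by omega), run_eq_cons (i := (p : ℤ) + 1 + 1) (by omega)]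
    have h4 : run ((p : ℤ) + 1 + 1 + 1) (p + 2) = [] := by
      have : ((p : ℤ) + 2 + 1 - (p + 1 + 1 + 1)).toNat = 0 := by omega
      rw [run_eq, this, List.range_zero, List.map_nil]
    have h5 : (p : ℤ) + 1 + 1 = p + 2 := by ring
    rw [h4, List.map_cons, List.map_cons, List.map_nil, h2, h5, h3, List.append_assoc]
    congr 4
    ring

theorem model_u (hk : kk n p ≤ p - 1) : model n p α (u p) = cyc (run 1 (p + 2)) *
    (if Odd (n : ℤ) then cyc (run 1 (kk n p) ++ (run (-p - 1 + kk n p) 0).reverse)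
      else cyc (run 1 (kk n p) ++ (run (-p + 1 + kk n p) 0).reverse ++
        [-p - 1 + kk n p, -p + kk n p])) := by
  rw [H.model_u', H.map_yPerm_run hk]
  split_ifs <;> rfl

/-- The first factor `za` shifts `m` to `m + 1`, which the conjugate of `za` by `y` does not move.
-/
theorem act_model_u_pos {m : ℤ} (h1 : kk n p < m) (h2 : m < p + 2) :
    act (model n p α (u p)) m = m + 1 := by
  have h3 := H.kk_ge
  rw [H.model_u', act_mul, act_cyc_run (by omega), if_pos (by omega), act_cyc_of_notMem]
  rw [List.mem_map]
  rintro ⟨m', h4, h5⟩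
  rw [mem_run] at h4
  by_cases h6 : m' ≤ kk n p
  · rw [H.act_yPerm_of_le (by omega) h6] at h5; omega
  · have := H.act_yPerm_neg (m := m') (by omega) (by omega); omega

/-- The point `k + 1 - m` is the image of `m` under `y`. It is fixed by `za`, and the conjugate of
`za` by `y` sends it to the image of `m + 1`. -/
theorem act_model_u_neg {m : ℤ} (h1 : kk n p < m) (h2 : m < p + 2)
    (h3 : ¬Odd (n : ℤ) → m < p) :
    act (model n p α (u p)) (kk n p + 1 - m) = kk n p - m := by
  have h4 := H.kk_ge
  have h5 : act (cyc (run 1 ((p : ℤ) + 2))) (kk n p + 1 - m) = kk n p + 1 - m :=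
    act_cyc_of_notMem (by rw [mem_run]; omega)
  rw [H.model_u', act_mul, h5, ← cj_cyc, ← H.act_yPerm_of_lt h1 h2.le (fun h => (h3 h).le), act_cj,
    act_cyc_run (by omega), if_pos (by omega), H.act_yPerm_of_lt (by omega) (by omega)
    (fun h => h3 h)]
  ring

/-- Since `u` shifts positive points up and nonpositive points down by one, conjugating `x̃` by
`u^(2j)` gives the next two transpositions `(-1-2j, k+2+2j)(-2j, k+1+2j)`. The telescoping word
multiplies these for `j = 0, …, t`. The second bound keeps even `n` away from the 4-cycle of `ȳ`. -/
theorem model_telescope (hk : kk n p ≤ p - 2) (t : ℕ) (ht : kk n p + 2 * t + 2 ≤ p + 2)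
    (ht' : ¬Odd (n : ℤ) → kk n p + 2 * t + 2 ≤ p) :
    (model n p α (xt n p) * model n p α (u p) ^ (-2 : ℤ)) ^ (t : ℤ) * model n p α (xt n p) *
      model n p α (u p) ^ (2 * (t : ℤ)) = swaps (kk n p) (2 * t + 2) := by
  have h1 := H.kk_ge
  have hs : ∀ t : ℕ, swaps (kk n p) (2 * t + 2) = swaps (kk n p) (2 * t) *
      (cyc [-1 - 2 * (t : ℤ), kk n p + 2 + 2 * t] * cyc [-(2 * (t : ℤ)), kk n p + 1 + 2 * t]) := by
    intro t
    have h2 := swaps_succ (kk n p) (2 * t)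
    have h3 := swaps_succ (kk n p) (2 * t + 1)
    push_cast at h2 h3
    have h4 : (2 * (t : ℤ) + 2) = 2 * t + 1 + 1 := by ring
    rw [h4, h3, h2, mul_assoc, (cyc_pairs_commute (by omega) (by omega) (by omega) (by omega)).eq]
    congr 4 <;> [skip; congr 1]
    · ring
    · ring
  have hpos : ∀ j : ℕ, ∀ m, kk n p < m → m + j ≤ p + 2 →
      act (model n p α (u p) ^ j) m = m + j := by
    intro j
    induction j with
    | zero => intro m _ _; simp
    | succ j ih =>
      intro m h2 h3
      push_cast at h3
      rw [pow_succ, act_mul, ih m h2 (by omega), H.act_model_u_pos (by omega) (by omega)]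
      push_cast; ring
  have hneg : ∀ j : ℕ, ∀ m, kk n p < m → m + j ≤ p + 2 → (¬Odd (n : ℤ) → m + j ≤ p) →
      act (model n p α (u p) ^ j) (kk n p + 1 - m) = kk n p + 1 - m - j := by
    intro j
    induction j with
    | zero => intro m _ _; simp
    | succ j ih =>
      intro m h2 h3 h4
      push_cast at h3 h4
      have h5 : kk n p + 1 - m - j = kk n p + 1 - (m + j) := by ring
      rw [pow_succ, act_mul, ih m h2 (by omega) (fun h => by have := h4 h; omega), h5,
        H.act_model_u_neg (by omega) (by omega) (fun h => by have := h4 h; omega)]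
      push_cast; ring
  induction t with
  | zero =>
    have := hs 0
    simp only [Nat.cast_zero, mul_zero, zero_add] at this ⊢
    rw [zpow_zero, one_mul, zpow_zero, mul_one, H.model_xt hk, this]
    simp [swaps]
  | succ t ih =>
    push_cast at ht ht' ⊢
    rw [telescope_succ, ih (by omega) (fun h => by have := ht' h; omega)]
    have h2 := hs (t + 1)
    push_cast at h2
    have h3 : (2 * (t : ℤ) + 2) = 2 * (t + 1) := by ring
    rw [h2, h3]
    congr 1
    have h4 : 2 * ((t : ℤ) + 1) = ((2 * (t + 1) : ℕ) : ℤ) := by push_cast; ring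
    have e1 := hneg (2 * (t + 1)) (kk n p + 1) (by omega) (by push_cast; omega)
      (fun h => by have := ht' h; push_cast; omega)
    have e2 := hneg (2 * (t + 1)) (kk n p + 2) (by omega) (by push_cast; omega)
      (fun h => by have := ht' h; push_cast; omega)
    rw [sub_self, zero_sub] at e1
    rw [show kk n p + 1 - (kk n p + 2) = -1 by ring] at e2
    rw [H.model_xt hk, h4, zpow_natCast, cj_mul, cj_cyc, cj_cyc]
    simp only [List.map_cons, List.map_nil]
    rw [hpos _ (kk n p + 2) (by omega) (by push_cast; omega),
      hpos _ (kk n p + 1) (by omega) (by push_cast; omega), e1, e2]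

end Admissible
end AltPres

/-! ### The word w evaluates to ȳ -/

namespace AltPres

theorem cyc_pair_mul_triple {v u s t : ℤ} (h1 : v ≠ u) (h2 : v ≠ s) (h3 : v ≠ t) (h4 : u ≠ s)
    (h5 : u ≠ t) (h6 : s ≠ t) : cyc [s, t] * cyc [v, u, s] = cyc [v, u, s, t] := by
  refine rperm_ext fun m => ?_
  rw [act_mul, act_cyc_quad h1 h2 h3 h4 h5 h6, act_cyc_triple h1 h2 h4, act_cyc_pair]
  grind

namespace Admissible

variable {n p : ℕ} {r α : (ZMod p)ˣ} {s : ℤ} (H : Admissible n p r α s)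
include H

/-- The conjugate of `z` by `y` is `(p, 0, -1)`. Conjugating it further by `z⁻¹` and by `z` moves
`p` to `p + 2` and to `p + 1`, and the product of the two 3-cycles is `(p+2, -1)(0, p+1)`. -/
theorem model_w_of_eq (hk : kk n p = p) : model n p α (w n p) = yPerm n p := by
  have hp := H.le_p
  have hn : Odd (n : ℤ) := by
    by_contra hn
    have := H.kk_lt hn
    omega
  have hz : ∀ m, act (cyc [(p : ℤ), (p : ℤ) + 1, (p : ℤ) + 2]) m =
      if m = p then (p : ℤ) + 1 else if m = (p : ℤ) + 1 then (p : ℤ) + 2 else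
        if m = (p : ℤ) + 2 then (p : ℤ) else m := fun m =>
    act_cyc_triple (by omega) (by omega) (by omega) m
  have y0 : act (yPerm n p) p = p := H.act_yPerm_of_le (by omega) (by omega)
  have y1 : act (yPerm n p) (p + 1) = 0 := by
    rw [H.act_yPerm_of_lt (by omega) (by omega) (fun h => absurd hn h)]; omega
  have y2 : act (yPerm n p) (p + 2) = -1 := by
    rw [H.act_yPerm_of_lt (by omega) (by omega) (fun h => absurd hn h)]; omega
  have z0 : act (cyc [(p : ℤ), (p : ℤ) + 1, (p : ℤ) + 2])⁻¹ p = p + 2 :=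
    act_inv_eq (by rw [hz]; grind)
  have z1 : act (cyc [(p : ℤ), (p : ℤ) + 1, (p : ℤ) + 2])⁻¹ 0 = 0 :=
    act_inv_eq (by rw [hz]; grind)
  have z2 : act (cyc [(p : ℤ), (p : ℤ) + 1, (p : ℤ) + 2])⁻¹ (-1) = -1 :=
    act_inv_eq (by rw [hz]; grind)
  have z3 : act (cyc [(p : ℤ), (p : ℤ) + 1, (p : ℤ) + 2]) p = p + 1 := by rw [hz]; grind
  have z4 : act (cyc [(p : ℤ), (p : ℤ) + 1, (p : ℤ) + 2]) 0 = 0 := by rw [hz]; grind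
  have z5 : act (cyc [(p : ℤ), (p : ℤ) + 1, (p : ℤ) + 2]) (-1) = -1 := by rw [hz]; grind
  rw [w, if_pos hk, map_mul, map_cj, map_cj, map_mul, map_mul, map_inv, H.model_z, model_y, cj_cyc,
    cj_cyc]
  simp only [List.map_cons, List.map_nil, act_mul, y0, y1, y2, z0, z1, z2, z3, z4, z5]
  rw [cyc_triple_mul_triple (by omega) (by omega) (by omega) (by omega) (by omega) (by omega)]
  refine rperm_ext fun m => ?_
  rw [H.act_yPerm, if_pos hn, act_mul, act_cyc_pair, act_cyc_pair]
  grind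

theorem model_w_odd (hn : Odd (n : ℤ)) (hk : kk n p ≠ p) : model n p α (w n p) = yPerm n p := by
  have h1 := H.kk_le_sub_two hn hk
  have h2 := H.mod
  obtain ⟨m, hm⟩ := even_kk_sub_one (p := p) hn
  obtain ⟨t, ht⟩ := Int.eq_ofNat_of_zero_le (show 0 ≤ ((p : ℤ) - kk n p) / 2 by omega)
  have ht' : (p : ℤ) - kk n p = 2 * t := by omega
  rw [w, if_neg hk, if_pos hn, map_mul, map_mul, map_zpow, map_mul, map_zpow, map_zpow, ht, ht',
    H.model_telescope h1 t (by omega) (fun h => absurd hn h), yPerm, if_pos hn]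
  congr 1
  omega

theorem act_model_a_inv_of_nonpos {m : ℤ} (hm : m ≤ 0) : act (model n p α a)⁻¹ m = m := by
  have hp := H.le_p
  refine act_inv_eq ?_
  rw [model_a, act_cyc_run (by omega), if_neg (by omega), if_neg (by omega)]

theorem act_model_z_inv_of_lt {m : ℤ} (hm : m < p) : act (model n p α (z p))⁻¹ m = m := by
  refine act_inv_eq ?_
  rw [H.model_z, act_cyc_triple (by omega) (by omega) (by omega), if_neg (by omega),
    if_neg (by omega), if_neg (by omega)]

set_option maxHeartbeats 1000000 in
/-- The first two factors of `w` for even `n`. -/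
theorem model_w_even_start (hn : ¬Odd (n : ℤ)) :
    model n p α (cj (dij p 1 (-1)) (z p * a * y * a⁻¹ * z p ^ (-2 : ℤ) * a⁻¹)
      * (cj (zi p 1) (y * a⁻¹ * (z p)⁻¹))⁻¹) =
    cyc [-p - 1 + kk n p, (p : ℤ) + 2, -p + kk n p, (p : ℤ) + 1] * cyc [kk n p + 1 - p, (p : ℤ)] := by
  have h1 := H.kk_lt hn
  have h0 := H.kk_ge
  have hp := H.le_p
  have hr1 : rep p 1 = 1 := rep_of_mem (by omega) (by omega)
  have hr2 : rep p (-1) = p - 1 := rep_eq 1 (by omega) (by omega) (by omega)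
  have a1 : act (model n p α a)⁻¹ 1 = p := act_inv_eq (by
    rw [model_a, act_cyc_run (by omega), if_neg (by omega), if_pos rfl])
  have a2 : act (model n p α a)⁻¹ 2 = 1 := act_inv_eq (by
    rw [model_a, act_cyc_run (by omega), if_pos (by omega)]; rfl)
  have a3 : act (model n p α a)⁻¹ (p + 1) = p + 1 := act_inv_eq (by
    rw [model_a, act_cyc_run (by omega), if_neg (by omega), if_neg (by omega)])
  have z1 : act (model n p α (z p))⁻¹ p = p + 2 := act_inv_eq (by
    rw [H.model_z, act_cyc_triple (by omega) (by omega) (by omega), if_neg (by omega),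
      if_neg (by omega), if_pos rfl])
  have z2 : act (model n p α (z p))⁻¹ (p + 2) = p + 1 := act_inv_eq (by
    rw [H.model_z, act_cyc_triple (by omega) (by omega) (by omega), if_neg (by omega),
      if_pos rfl])
  have hza : ∀ m m' : ℤ, m + 1 = m' → 1 ≤ m → m < p + 2 → act (model n p α (z p * a)) m = m' :=
    fun m m' h h3 h4 => by rw [H.model_za, act_cyc_run (by omega), if_pos ⟨h3, h4⟩, h]
  have hza' : act (model n p α (z p * a)) (p + 2) = 1 := by
    rw [H.model_za, act_cyc_run (by omega), if_neg (by omega), if_pos rfl]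
  have y1 : act (yPerm n p) 1 = 1 := H.act_yPerm_of_le (by omega) (by omega)
  have y2 : act (yPerm n p) 2 = 2 := H.act_yPerm_of_le (by omega) (by omega)
  have y3 : act (yPerm n p) p = kk n p + 1 - p :=
    H.act_yPerm_of_lt (by omega) (by omega) (fun _ => le_rfl)
  have y4 : act (yPerm n p) (p + 1) = -p - 1 + kk n p := by
    rw [H.act_yPerm, if_neg hn, if_neg (by omega), if_pos rfl]
  have y5 : act (yPerm n p) (p + 2) = -p + kk n p := by
    rw [H.act_yPerm, if_neg hn, if_neg (by omega), if_neg (by omega), if_pos rfl]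
  have hz2 : model n p α (z p ^ (-2 : ℤ)) = (model n p α (z p))⁻¹ * (model n p α (z p))⁻¹ := by
    rw [map_zpow]; group
  have hW : ∀ m, act (model n p α (z p * a * y * a⁻¹ * z p ^ (-2 : ℤ) * a⁻¹)) m =
      act (model n p α a)⁻¹ (act (model n p α (z p))⁻¹ (act (model n p α (z p))⁻¹
        (act (model n p α a)⁻¹ (act (yPerm n p) (act (model n p α (z p * a)) m))))) := fun m => by
    rw [map_mul, map_mul, map_mul, map_mul, hz2, model_y, map_inv]; rfl
  have hV : ∀ m, act (model n p α (y * a⁻¹ * (z p)⁻¹)) m =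
      act (model n p α (z p))⁻¹ (act (model n p α a)⁻¹ (act (yPerm n p) m)) := fun m => by
    rw [map_mul, map_mul, model_y, map_inv, map_inv]; rfl
  have hfix : ∀ m : ℤ, m ≤ 0 → act (model n p α a)⁻¹ (act (model n p α (z p))⁻¹
      (act (model n p α (z p))⁻¹ (act (model n p α a)⁻¹ m))) = m := fun m hm => by
    have hz := H.act_model_z_inv_of_lt (m := m) (by omega)
    rw [H.act_model_a_inv_of_nonpos hm, hz, hz, H.act_model_a_inv_of_nonpos hm]
  have hfix' : ∀ m : ℤ, m ≤ 0 →
      act (model n p α (z p))⁻¹ (act (model n p α a)⁻¹ m) = m := fun m hm => by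
    rw [H.act_model_a_inv_of_nonpos hm, H.act_model_z_inv_of_lt (by omega)]
  -- The conjugator of `d(1, -1) = (1, p-1)(p+1, p+2)` turns it into `(p, k+1-p)(k-p, p+1)`. The
  -- second factor of the word is the 3-cycle `(k-p-1, p+2, k-p)`, which together with `(k-p, p+1)`
  -- makes up the 4-cycle.
  have w1 : act (model n p α (z p * a * y * a⁻¹ * z p ^ (-2 : ℤ) * a⁻¹)) 1 = p := by
    have hz := H.act_model_z_inv_of_lt (m := 1) (by omega)
    rw [hW, hza 1 2 (by omega) (by omega) (by omega), y2, a2, hz, hz, a1]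
  have w2 : act (model n p α (z p * a * y * a⁻¹ * z p ^ (-2 : ℤ) * a⁻¹)) (p - 1) =
      kk n p + 1 - p := by
    rw [hW, hza _ p (by omega) (by omega) (by omega), y3, hfix _ (by omega)]
  have w3 : act (model n p α (z p * a * y * a⁻¹ * z p ^ (-2 : ℤ) * a⁻¹)) (p + 1) =
      -p + kk n p := by
    rw [hW, hza _ (p + 2) (by omega) (by omega) (by omega), y5, hfix _ (by omega)]
  have w4 : act (model n p α (z p * a * y * a⁻¹ * z p ^ (-2 : ℤ) * a⁻¹)) (p + 2) = p + 1 := by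
    rw [hW, hza', y1, a1, z1, z2, a3]
  have v1 : act (model n p α (y * a⁻¹ * (z p)⁻¹)) 1 = p + 2 := by rw [hV, y1, a1, z1]
  have v2 : act (model n p α (y * a⁻¹ * (z p)⁻¹)) (p + 1) = -p - 1 + kk n p := by
    rw [hV, y4, hfix' _ (by omega)]
  have v3 : act (model n p α (y * a⁻¹ * (z p)⁻¹)) (p + 2) = -p + kk n p := by
    rw [hV, y5, hfix' _ (by omega)]
  rw [map_mul, map_cj, map_inv, map_cj, H.model_zi, H.model_dij (by omega), hr1, hr2, tau,
    cj_mul, cj_cyc, cj_cyc, cj_cyc]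
  simp only [List.map_cons, List.map_nil, w1, w2, w3, w4, v1, v2, v3]
  rw [cyc_triple_inv (by omega) (by omega) (by omega)]
  rw [mul_assoc, cyc_pair_mul_triple (by omega) (by omega) (by omega) (by omega) (by omega)
    (by omega), cyc_pair_comm, (cyc_commute _).eq]
  simp only [List.mem_cons, List.not_mem_nil, or_false]
  omega

theorem model_w_even (hn : ¬Odd (n : ℤ)) : model n p α (w n p) = yPerm n p := by
  have h1 := H.kk_lt hn
  have h0 := H.kk_ge
  have h2 := H.mod
  have hp := H.le_p
  obtain ⟨m, hm⟩ := even_kk (p := p) hn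
  have hlast : model n p α ((xt n p * u p ^ (-2 : ℤ)) ^ (((p : ℤ) - kk n p - 3) / 2) * xt n p *
      u p ^ ((p : ℤ) - kk n p - 3)) = swaps (kk n p) (p - kk n p - 1) := by
    -- For `k = p - 1` the exponent `(p-k-3)/2` is -1 and the word cancels in the free group. This
    -- is as needed, since no further transpositions remain and `model_xt` does not apply.
    by_cases h3 : kk n p = p - 1
    · have e1 : (p : ℤ) - kk n p - 3 = -2 := by omega
      have e2 : (p : ℤ) - kk n p - 1 = 0 := by omega
      rw [e1, e2]
      have : (xt n p * u p ^ (-2 : ℤ)) ^ ((-2 : ℤ) / 2) * xt n p * u p ^ (-2 : ℤ) = 1 := by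
        rw [show (-2 : ℤ) / 2 = -1 by norm_num]; group
      rw [this, map_one]
      simp [swaps]
    · obtain ⟨t, ht⟩ := Int.eq_ofNat_of_zero_le (show 0 ≤ ((p : ℤ) - kk n p - 3) / 2 by omega)
      have ht' : (p : ℤ) - kk n p - 3 = 2 * t := by omega
      rw [map_mul, map_mul, map_zpow, map_mul, map_zpow, map_zpow, ht, ht',
        H.model_telescope (by omega) t (by omega) (fun _ => by omega)]
      congr 1
      omega
  rw [w, if_neg (by omega), if_neg hn, mul_assoc, mul_assoc, ← mul_assoc (_ ^ (_ / 2)), map_mul,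
    hlast, H.model_w_even_start hn]
  -- The transposition `(k+1-p, p)` produced along with the 4-cycle is the outermost of the `p - k`
  -- transpositions; telescoping supplies the other `p - k - 1`.
  rw [yPerm, if_neg hn, mul_assoc]
  congr 1
  refine rperm_ext fun m => ?_
  rw [act_mul, act_swaps (by omega) (by omega), act_swaps (by omega) (by omega), act_cyc_pair]
  grind

theorem model_w : model n p α (w n p) = yPerm n p := by
  by_cases hk : kk n p = p
  · exact H.model_w_of_eq hk
  by_cases hn : Odd (n : ℤ)
  · exact H.model_w_odd hn hk
  · exact H.model_w_even hn

/-! ### The relators -/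

theorem cj_model_c : cj (model n p α (c n p)) (yPerm n p) = model n p α (c n p) := by
  have key : ∀ i : ℤ, 1 ≤ i →
      cj (cyc (run i (kk n p))) (yPerm n p) = cyc (run i (kk n p)) := by
    intro i hi
    rw [cj_cyc]
    conv_rhs => rw [← List.map_id (run i (kk n p))]
    congr 1
    refine List.map_congr_left fun m hm => ?_
    rw [mem_run] at hm
    exact H.act_yPerm_of_le (by omega) hm.2
  rw [H.model_c]
  split_ifs <;> exact key _ (by omega)

theorem model_relators (i : Fin 7) : model n p α (relators n p s i) = 1 := by
  have h0 := H.mod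
  have hp := H.le_p
  have hk := H.kk_ge
  have hk' := H.kk_le
  have hA : cyc (run 1 (p : ℤ)) ^ p = 1 := by
    have h1 := cyc_pow_length (nodup_run 1 p)
    rw [length_run] at h1
    have h2 : ((p : ℤ) + 1 - 1).toNat = p := by omega
    rwa [h2] at h1
  have hy : ∀ m : ℤ, 1 ≤ m → m ≤ 6 → act (yPerm n p) m = m := fun m h1 h2 =>
    H.act_yPerm_of_le h1 (by omega)
  fin_cases i
  · have h1 : ((p : ℤ) - 1) / 2 = ((((p - 1) / 2 : ℕ)) : ℤ) := by omega
    change model n p α (a ^ (p : ℤ) * (b ^ (((p : ℤ) - 1) / 2))⁻¹) = 1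
    rw [map_mul, map_inv, map_zpow, map_zpow, model_a, H.model_b, h1, zpow_natCast, zpow_natCast,
      hA, mulPerm_pow H.prime, H.unit_pow_eq_one H.isSquare_r, mulPerm_one H.prime]
    simp
  · change model n p α (cj (a ^ s) b * (a ^ (s - 1))⁻¹) = 1
    rw [map_mul, map_inv, map_cj, map_zpow, map_zpow, model_a, H.model_b,
      cj_cyc_run_mulPerm H.prime (s := s) (t := s - 1), mul_inv_cancel]
    have := H.hs
    push_cast
    linear_combination this
  · change model n p α ((z p * cj (z p) a) ^ 2) = 1
    have h1 : cj (z p) a = zi p 1 := by rw [zi, zpow_one]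
    have h2 : rep p 1 = 1 := rep_of_mem (by omega) (by omega)
    rw [h1, map_pow, map_mul, H.model_z, H.model_zi, h2, cyc_triple_mul_triple (by omega)
      (by omega) (by omega) (by omega) (by omega) (by omega), (cyc_pairs_commute (by omega)
      (by omega) (by omega) (by omega)).mul_pow, pow_two, pow_two, cyc_pair_mul_self,
      cyc_pair_mul_self, mul_one]
  · change model n p α (aTilde p * (cj (aTilde p * h p) y)⁻¹) = 1
    rw [map_mul, map_inv, map_cj, map_mul, H.model_h, H.model_aTilde, model_y, mul_one, cj_cyc]
    simp only [List.map_cons, List.map_nil]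
    rw [hy 1 (by omega) (by omega), hy 2 (by omega) (by omega), hy 3 (by omega) (by omega),
      mul_inv_cancel]
  · change model n p α (c n p * (cj (c n p) y)⁻¹) = 1
    rw [map_mul, map_inv, map_cj, model_y, H.cj_model_c, mul_inv_cancel]
  · change model n p α (comm (d p) (cj (e n p) y)) = 1
    have h1 : Commute (model n p α (d p)) (model n p α (cj (e n p) y)) := by
      have key : ∀ l : List ℤ, (∀ m ∈ l, 1 ≤ m ∧ m ≤ 2 ∨ kk n p < m ∧ m ≤ p + 2) →
          Commute (cyc (run 5 ((p : ℤ) + 2))) (cj (cyc l) (yPerm n p)) := by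
        intro l hl
        rw [cj_cyc]
        refine cyc_commute fun m hm hm' => ?_
        rw [mem_run] at hm
        obtain ⟨m', h2, h3⟩ := List.mem_map.1 hm'
        rcases hl m' h2 with h4 | h4
        · rw [hy m' h4.1 (by omega)] at h3; omega
        · have := H.act_yPerm_neg h4.1 h4.2; omega
      rw [map_cj, H.model_d, H.model_e, model_y]
      split_ifs <;> refine key _ fun m hm => ?_
      · rw [List.mem_cons, mem_run] at hm; omega
      · rw [List.mem_cons, List.mem_cons, mem_run] at hm; omega
    rw [comm, map_mul, map_mul, map_mul, map_inv, map_inv, mul_assoc, mul_assoc, ← mul_assoc,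
      ← mul_inv_rev, h1.eq, inv_mul_cancel]
  · change model n p α (y * (w n p)⁻¹) = 1
    rw [map_mul, map_inv, H.model_w, model_y, mul_inv_cancel]

end Admissible
end AltPres

namespace AltPres

/-! ## Generating alternating groups -/

theorem altOn_mono {S S' : Finset ℤ} {P Q : ℤ} (hP : P ∈ S) (hQ : Q ∈ S) (hPQ : P ≠ Q)
    (hS : S ⊆ S') : altOn S ≤ altOn S' :=
  altOn_le hPQ fun i hi hiP hiQ => cyc_mem_altOn (by simp [hiP, hiQ, hPQ])
    (by simp [hS hi, hS hP, hS hQ]) ⟨1, rfl⟩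

theorem cj_mem {G : Type*} [Group G] {H : Subgroup G} {x y : G} (hx : x ∈ H) (hy : y ∈ H) :
    cj x y ∈ H := H.mul_mem (H.mul_mem (H.inv_mem hy) hx) hy

/-- If `f` fixes `P` and moves `v 0 ↦ v 1 ↦ v 2 ↦ …`, then `f` and `(P, v 0, v 1)` generate all
`(P, v 0, v j)`. -/
theorem cyc_fan_mem {H : Subgroup RPerm} {f : RPerm} (hf : f ∈ H) {P : ℤ} {v : ℕ → ℤ} {N : ℕ}
    (hP : ∀ j ≤ N, v j ≠ P) (hv : ∀ i j, i < j → j ≤ N → v i ≠ v j) (hfP : act f P = P)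
    (hfv : ∀ j < N, act f (v j) = v (j + 1)) (h0 : cyc [P, v 0, v 1] ∈ H) {j : ℕ} (hj1 : 1 ≤ j)
    (hjN : j ≤ N) : cyc [P, v 0, v j] ∈ H := by
  have h1 : ∀ j < N, cyc [P, v j, v (j + 1)] ∈ H := by
    intro j
    induction j with
    | zero => exact fun _ => h0
    | succ j ih =>
      intro hj
      have := cj_mem (ih (by omega)) hf
      rw [cj_cyc] at this
      simp only [List.map_cons, List.map_nil] at this
      rwa [hfP, hfv j (by omega), hfv (j + 1) hj] at this
  induction j, hj1 using Nat.le_induction with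
  | base => exact h0
  | succ j hj ih =>
    -- Conjugation by the inverse of `(P, v j, v (j+1))` turns `(P, v 0, v j)` into `(v (j+1), v 0,
    -- P)`, whose inverse is the next 3-cycle of the fan.
    have h2 := cj_mem (ih (by omega)) (H.inv_mem (h1 j (by omega)))
    have n1 := hP j (by omega)
    have n2 := hP (j + 1) hjN
    have n3 := hP 0 (by omega)
    have n4 := hv j (j + 1) (by omega) hjN
    have n5 := hv 0 j (by omega) (by omega)
    have n6 := hv 0 (j + 1) (by omega) hjN
    have e1 : act (cyc [P, v j, v (j + 1)])⁻¹ P = v (j + 1) := act_inv_eq (by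
      rw [act_cyc_triple n1.symm n2.symm n4]; grind)
    have e2 : act (cyc [P, v j, v (j + 1)])⁻¹ (v 0) = v 0 := act_inv_eq (by
      rw [act_cyc_triple n1.symm n2.symm n4]; grind)
    have e3 : act (cyc [P, v j, v (j + 1)])⁻¹ (v j) = P := act_inv_eq (by
      rw [act_cyc_triple n1.symm n2.symm n4]; grind)
    rw [cj_cyc] at h2
    simp only [List.map_cons, List.map_nil] at h2
    rw [e1, e2, e3] at h2
    have h3 := H.inv_mem h2
    rwa [cyc_triple_inv n6.symm n2 n3, ← cyc_triple_rotate n3.symm n2.symm n6] at h3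

/-- The long cycle translates `(1, 2, 3)` to all consecutive triples, and these push the last entry
of `(1, 2, i)` up by one at a time. It serves odd `n`; for even `n` the word `c` fixes 1 and
`cyc_fan_mem` is used. -/
theorem cyc_run_three_mem {H : Subgroup RPerm} {k : ℤ} (hC : cyc (run 1 k) ∈ H)
    (h3 : cyc [1, 2, 3] ∈ H) {i : ℤ} (hi : 3 ≤ i) (hik : i ≤ k) : cyc [1, 2, i] ∈ H := by
  have h1 : ∀ j : ℕ, (j : ℤ) + 3 ≤ k → cyc [(j : ℤ) + 1, (j : ℤ) + 2, (j : ℤ) + 3] ∈ H := by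
    intro j
    induction j with
    | zero => intro _; simpa using h3
    | succ j ih =>
      intro hj
      push_cast at hj ⊢
      have := cj_mem (ih (by omega)) hC
      rw [cj_cyc] at this
      simp only [List.map_cons, List.map_nil] at this
      rw [act_cyc_run (by omega), act_cyc_run (by omega), act_cyc_run (by omega),
        if_pos (by omega), if_pos (by omega), if_pos (by omega)] at this
      rwa [show (j : ℤ) + 1 + 2 = j + 2 + 1 by ring, show (j : ℤ) + 1 + 3 = j + 3 + 1 by ring]
  obtain ⟨j, rfl⟩ := Int.le.dest hi
  induction j with
  | zero => simpa using h3
  | succ j ih =>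
    push_cast at hik hi ⊢
    have h2 := ih (by omega) (by omega)
    have h4 := h1 (j + 1) (by push_cast; omega)
    push_cast at h4
    rw [show (j : ℤ) + 1 + 1 = j + 2 by ring, show (j : ℤ) + 1 + 2 = j + 3 by ring,
      show (j : ℤ) + 1 + 3 = j + 4 by ring] at h4
    rw [show 3 + (j : ℤ) = j + 3 by ring] at h2
    rw [show 3 + ((j : ℤ) + 1) = j + 4 by ring]
    -- The triple `(2, 3, 4)` also moves the entry 2, so the step from 3 to 4 needs conjugation by
    -- its inverse instead.
    by_cases hj : j = 0
    · subst hj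
      have h5 := cj_mem h2 (H.inv_mem h4)
      simp only [Nat.cast_zero, zero_add] at h4 h5 ⊢
      have e1 : act (cyc [2, 3, 4])⁻¹ 1 = 1 := act_inv_eq (by
        rw [act_cyc_triple (by omega) (by omega) (by omega)]; rfl)
      have e2 : act (cyc [2, 3, 4])⁻¹ 2 = 4 := act_inv_eq (by
        rw [act_cyc_triple (by omega) (by omega) (by omega)]; rfl)
      have e3 : act (cyc [2, 3, 4])⁻¹ 3 = 2 := act_inv_eq (by
        rw [act_cyc_triple (by omega) (by omega) (by omega)]; rfl)
      rw [cj_cyc] at h5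
      simp only [List.map_cons, List.map_nil] at h5
      rw [e1, e2, e3] at h5
      have h6 := H.inv_mem h5
      rwa [cyc_triple_inv (by omega) (by omega) (by omega), ← cyc_triple_rotate (i := 2) (j := 4)
        (l := 1) (by omega) (by omega) (by omega), ← cyc_triple_rotate (by omega) (by omega)
        (by omega)] at h6
    · have h5 := cj_mem h2 h4
      rw [cj_cyc] at h5
      simp only [List.map_cons, List.map_nil] at h5
      rw [act_cyc_of_notMem (m := 1) (by simp; omega), act_cyc_of_notMem (m := 2) (by simp; omega),
        act_cyc_triple (by omega) (by omega) (by omega), if_neg (by omega), if_pos rfl] at h5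
      exact h5

/-- `w` is a word in `a, g, a ^ y, g ^ y`. -/
theorem w_mem_closure (n p : ℤ) : w n p ∈ Subgroup.closure {a, g, cj a y, cj g y} := by
  set H := Subgroup.closure {a, g, cj a y, cj g y} with hH
  have ha : a ∈ H := Subgroup.subset_closure (by simp)
  have hg : g ∈ H := Subgroup.subset_closure (by simp)
  have hay : cj a y ∈ H := Subgroup.subset_closure (by simp)
  have hgy : cj g y ∈ H := Subgroup.subset_closure (by simp)
  -- The elements of `H` whose conjugate by `y` is again in `H`. This subgroup contains `a` and `g`,
  -- hence every word in them.
  let N : Subgroup Word := H ⊓ H.comap (MulAut.conj y⁻¹).toMonoidHom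
  have hN : ∀ f, f ∈ N ↔ f ∈ H ∧ cj f y ∈ H := fun f => by
    simp [N, Subgroup.mem_inf, Subgroup.mem_comap, cj]
  have haN : a ∈ N := (hN a).2 ⟨ha, hay⟩
  have hgN : g ∈ N := (hN g).2 ⟨hg, hgy⟩
  have hz : z p ∈ N := N.zpow_mem hgN _
  have hzi : ∀ i, zi p i ∈ N := fun i => cj_mem hz (N.zpow_mem haN _)
  have hd : ∀ i j, dij p i j ∈ N := fun i j =>
    N.mul_mem (N.mul_mem (hzi i) (N.inv_mem (hzi j))) (hzi i)
  have hza : z p * a ∈ N := N.mul_mem hz haN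
  have hu : u p ∈ H := H.mul_mem ((hN _).1 hza).1 ((hN _).1 hza).2
  have hxt : xt n p ∈ H := cj_mem (H.mul_mem ((hN _).1 (hd _ _)).1 ((hN _).1 (hd _ _)).1)
    (H.mul_mem ((hN _).1 (hd _ _)).2 ((hN _).1 (hd _ _)).2)
  have hzH := ((hN _).1 hz).1
  have hlast : ∀ i j : ℤ, (xt n p * u p ^ (-2 : ℤ)) ^ i * xt n p * u p ^ j ∈ H := fun i j =>
    H.mul_mem (H.mul_mem (H.zpow_mem (H.mul_mem hxt (H.zpow_mem hu _)) _) hxt) (H.zpow_mem hu _)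
  rw [w]
  split_ifs
  · rw [← cj_cj, ← cj_cj]
    exact H.mul_mem (cj_mem ((hN _).1 hz).2 (H.inv_mem hzH)) (cj_mem ((hN _).1 hz).2 hzH)
  · exact hlast _ _
  · have e1 : cj (dij p 1 (-1)) (z p * a * y * a⁻¹ * z p ^ (-2 : ℤ) * a⁻¹) =
        cj (cj (cj (dij p 1 (-1)) (z p * a)) y) (a⁻¹ * z p ^ (-2 : ℤ) * a⁻¹) := by
      simp only [cj_cj, mul_assoc]
    have e2 : cj (zi p 1) (y * a⁻¹ * (z p)⁻¹) = cj (cj (zi p 1) y) (a⁻¹ * (z p)⁻¹) := by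
      simp only [cj_cj, mul_assoc]
    rw [mul_assoc, mul_assoc, ← mul_assoc (_ ^ (_ / 2)), e1, e2]
    refine H.mul_mem (H.mul_mem ?_ (H.inv_mem ?_)) (hlast _ _)
    · exact cj_mem ((hN _).1 (cj_mem (hd _ _) hza)).2
        (H.mul_mem (H.mul_mem (H.inv_mem ha) (H.zpow_mem hzH _)) (H.inv_mem ha))
    · exact cj_mem ((hN _).1 (hzi _)).2 (H.mul_mem (H.inv_mem ha) (H.inv_mem hzH))

end AltPres

/-! ### Consequences of the relations for the words in a and g -/

namespace AltPres

/-- A group generated by the letters `a, g, y`, satisfying the relations, and acting on `ℤ` as the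
concrete group. -/
structure Realizes {G : Type*} [Group G] (n p : ℕ) (α : (ZMod p)ˣ) (s : ℤ) (φ : Word →* G)
    (π : G →* RPerm) : Prop where
  rel : ∀ i, φ (relators n p s i) = 1
  comp : ∀ f, π (φ f) = model n p α f
  surj : Function.Surjective φ

/-- The subgroup generated by the `z(i)`. -/
def zSubgroup {G : Type*} [Group G] (φ : Word →* G) (p : ℕ) : Subgroup G :=
  Subgroup.closure ((fun i => φ (zi p i)) '' (Finset.Icc (1 : ℤ) p : Set ℤ))

/-- Where `π` is injective on `K`, membership in a smaller subgroup can be tested on permutations.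
With `L` a centralizer inside `K`, commutation relations spread from generators to whole alternating
groups. -/
theorem mem_of_map_mem_map {G G' : Type*} [Group G] [Group G'] {π : G →* G'} {K L : Subgroup G}
    (hK : ∀ f ∈ K, π f = 1 → f = 1) (hL : L ≤ K) {f : G} (hf : f ∈ K) (h : π f ∈ L.map π) :
    f ∈ L := by
  obtain ⟨f', hf', h'⟩ := h
  have : f' * f⁻¹ = 1 := hK _ (K.mul_mem (hL hf') (K.inv_mem hf)) (by
    rw [map_mul, map_inv, h', mul_inv_cancel])
  rwa [← mul_inv_eq_one.1 this]

theorem eq_of_map_eq {G G' : Type*} [Group G] [Group G'] {π : G →* G'} {K : Subgroup G}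
    (hK : ∀ f ∈ K, π f = 1 → f = 1) {f f' : G} (hf : f ∈ K) (hf' : f' ∈ K) (h : π f = π f') :
    f = f' :=
  mul_inv_eq_one.1 (hK _ (K.mul_mem hf (K.inv_mem hf')) (by
    rw [map_mul, map_inv, h, mul_inv_cancel]))

theorem commute_iff_cj {G : Type*} [Group G] {x y : G} : Commute x y ↔ cj x y = x :=
  ⟨cj_eq_self, fun h => by
    rw [cj, mul_assoc, inv_mul_eq_iff_eq_mul] at h
    exact h⟩

namespace Realizes

variable {G : Type*} [Group G] {n p : ℕ} {r α : (ZMod p)ˣ} {s : ℤ} {φ : Word →* G}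
  {π : G →* RPerm} (R : Realizes n p α s φ π) (H : Admissible n p r α s)
include R H

theorem rel_pow : φ a ^ p = φ b ^ ((p - 1) / 2) := by
  have h0 := H.mod
  have h1 : ((p : ℤ) - 1) / 2 = ((((p - 1) / 2 : ℕ)) : ℤ) := by omega
  have h2 : φ (a ^ (p : ℤ) * (b ^ (((p : ℤ) - 1) / 2))⁻¹) = 1 := R.rel 0
  rwa [map_mul, map_inv, mul_inv_eq_one, map_zpow, map_zpow, h1, zpow_natCast, zpow_natCast] at h2

omit H in
theorem rel_cj : cj (φ a ^ s) (φ b) = φ a ^ (s - 1) := by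
  have h2 : φ (cj (a ^ s) b * (a ^ (s - 1))⁻¹) = 1 := R.rel 1
  rwa [map_mul, map_inv, mul_inv_eq_one, map_cj, map_zpow, map_zpow] at h2

/-- By the first relation `a^p` is a power of `b`, so `b` centralizes it. The `p`-th power of
`(a^s)^b = a^(s-1)` then reads `a^(ps) = a^(p(s-1))`. -/
theorem a_pow : φ a ^ p = 1 := by
  have h1 : Commute (φ a ^ p) (φ b) := by
    rw [R.rel_pow H]; exact (Commute.refl _).pow_left _
  have h2 := congrArg (· ^ p) R.rel_cj
  simp only [cj_pow] at h2
  rw [← zpow_natCast, ← zpow_natCast, ← zpow_mul, ← zpow_mul, mul_comm, zpow_mul, mul_comm (s - 1),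
    zpow_mul, zpow_natCast, cj_eq_self (h1.zpow_left s), zpow_sub_one] at h2
  exact (mul_eq_left.1 h2.symm : (φ a ^ p)⁻¹ = 1) |> inv_eq_one.1

theorem b_pow : φ b ^ ((p - 1) / 2) = 1 := by rw [← R.rel_pow H, R.a_pow H]

theorem a_zpow_eq {i j : ℤ} (hij : (i : ZMod p) = j) : φ a ^ i = φ a ^ j := by
  rw [ZMod.intCast_eq_intCast_iff_dvd_sub] at hij
  obtain ⟨t, ht⟩ := hij
  rw [show j = i + p * t by omega, zpow_add, zpow_mul, zpow_natCast, R.a_pow H, one_zpow, mul_one]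

/-- The relation concerns only `a^s`. But `s(r-1) = -1` says `s - 1 = rs`, and `s` is invertible
modulo `p`, so every power of `a` is a power of `a^s`. -/
theorem cj_a_zpow {i j : ℤ} (hij : (r : ZMod p) * i = j) : cj (φ a ^ i) (φ b) = φ a ^ j := by
  have : Fact p.Prime := ⟨H.prime⟩
  have hs := H.hs
  have hs0 : (s : ZMod p) ≠ 0 := by rintro h; rw [h] at hs; simp at hs
  obtain ⟨t, ht⟩ := ZMod.intCast_surjective ((s : ZMod p)⁻¹ * (i : ZMod p))
  have h1 : φ a ^ i = (φ a ^ s) ^ t := by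
    rw [← zpow_mul]
    apply R.a_zpow_eq H
    push_cast
    rw [ht, mul_inv_cancel_left₀ hs0]
  have h2 : φ a ^ j = (φ a ^ (s - 1)) ^ t := by
    rw [← zpow_mul]
    apply R.a_zpow_eq H
    push_cast
    have h3 : (s : ZMod p) - 1 = r * s := by linear_combination -hs
    rw [ht, h3, mul_assoc, mul_inv_cancel_left₀ hs0, hij]
  have h3 : ∀ x y : G, ∀ t : ℤ, cj (x ^ t) y = cj x y ^ t := fun x y t => by
    have := map_zpow (MulAut.conj y⁻¹) x t
    simpa [cj, MulAut.conj_apply] using this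
  rw [h1, h3, R.rel_cj, h2]

theorem zi_pow (i : ℤ) : φ (zi p i) ^ 3 = 1 := by
  have h0 := H.mod
  have h1 : ((p : ℤ) - 1) / 2 = ((((p - 1) / 2 : ℕ)) : ℤ) := by omega
  have h2 : φ (z p) ^ 3 = 1 := by
    have h3 := R.b_pow H
    rw [b, map_pow, ← pow_mul, mul_comm, pow_mul] at h3
    rw [z, map_zpow, h1, zpow_natCast, h3]
  rw [zi, map_cj, cj_pow, h2]
  simp [cj]

theorem zi_eq {i j : ℤ} (hij : (i : ZMod p) = j) : φ (zi p i) = φ (zi p j) := by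
  rw [zi, zi, map_cj, map_cj, map_zpow, map_zpow, R.a_zpow_eq H hij]

omit R H in
theorem cj_zi_a (i : ℤ) : cj (φ (zi p i)) (φ a) = φ (zi p (i + 1)) := by
  rw [zi, zi, ← map_cj, cj_cj, zpow_add_one]

theorem cj_zi_b {i j : ℤ} (hij : (r : ZMod p) * i = j) :
    cj (φ (zi p i)) (φ b) = φ (zi p j) := by
  have h1 : Commute (φ (z p)) (φ b) := by
    rw [z, b, map_zpow, map_pow]
    exact ((Commute.refl _).zpow_left _).pow_right _
  have h2 := R.cj_a_zpow H hij
  have h3 : φ a ^ i * φ b = φ b * φ a ^ j := by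
    rw [← h2, cj, mul_assoc, mul_inv_cancel_left]
  rw [zi, zi, map_cj, map_cj, cj_cj, map_zpow, map_zpow, h3, ← cj_cj, cj_eq_self h1]

/-- Start from the relation for the pair `(0, 1)`. Conjugation by `b` gives the pairs `(0, r^t)`,
and conjugation by `a` gives all pairs whose difference is a nonzero square. -/
theorem zi_mul_sq {i j : ℤ} (hij : (i : ZMod p) ≠ j) :
    (φ (zi p i) * φ (zi p j)) ^ 2 = 1 := by
  have : Fact p.Prime := ⟨H.prime⟩
  have h1 : ∀ t : ℕ, ∀ j : ℤ, (j : ZMod p) = (r : ZMod p) ^ t →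
      (φ (zi p 0) * φ (zi p j)) ^ 2 = 1 := by
    intro t
    induction t with
    | zero =>
      intro j hj
      have h2 : φ ((z p * cj (z p) a) ^ 2) = 1 := R.rel 2
      have h3 : z p = zi p 0 := by simp [zi, cj]
      have h4 : cj (z p) a = zi p 1 := by rw [zi, zpow_one]
      rw [map_pow, map_mul, h4] at h2
      nth_rewrite 1 [h3] at h2
      rw [R.zi_eq H (i := j) (j := 1) (by rw [hj]; simp)]
      exact h2
    | succ t ih =>
      intro j hj
      obtain ⟨j', hj'⟩ := ZMod.intCast_surjective ((r : ZMod p) ^ t)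
      have h2 := ih j' hj'
      have h3 : cj ((φ (zi p 0) * φ (zi p j')) ^ 2) (φ b) = 1 := by rw [h2]; simp [cj]
      rwa [← cj_pow, cj_mul, R.cj_zi_b H (i := 0) (j := 0) (by simp),
        R.cj_zi_b H (i := j') (j := j) (by rw [hj', hj, pow_succ'])] at h3
  have h2 : ∀ i t : ℤ, cj (φ (zi p i)) (φ a ^ t) = φ (zi p (i + t)) := fun i t => by
    rw [zi, zi, ← map_zpow, ← map_cj, cj_cj, zpow_add]
  have h3 : ∀ i j : ℤ, ∀ t : ℕ, (j : ZMod p) - i = (r : ZMod p) ^ t →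
      (φ (zi p i) * φ (zi p j)) ^ 2 = 1 := by
    intro i j t h
    have h4 := h1 t (j - i) (by push_cast; exact h)
    have h5 : cj ((φ (zi p 0) * φ (zi p (j - i))) ^ 2) (φ a ^ i) = 1 := by rw [h4]; simp [cj]
    rw [← cj_pow, cj_mul, h2, h2] at h5
    simpa using h5
  have hne : (j : ZMod p) - i ≠ 0 := sub_ne_zero.2 hij.symm
  -- One of `j - i` and `i - j` is a square; in the second case the two factors are exchanged by
  -- conjugation.
  rcases H.isSquare_or (Units.mk0 _ hne) with h4 | h4
  · obtain ⟨t, -, ht⟩ := H.exists_sq_pow h4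
    refine h3 i j (2 * t) ?_
    have := congrArg Units.val ht
    simpa [pow_mul] using this
  · obtain ⟨t, -, ht⟩ := H.exists_sq_pow h4
    have h5 := h3 j i (2 * t) (by
      have := congrArg Units.val ht
      simpa [pow_mul] using this)
    have h6 : φ (zi p i) * φ (zi p j) = cj (φ (zi p j) * φ (zi p i)) (φ (zi p j)) := by
      simp [cj]
    rw [h6, cj_pow, h5]
    simp [cj]

/-! ### The subgroup generated by the `z(i)` -/

theorem eq_one_of_mem {f : G} (hf : f ∈ zSubgroup φ p) (hf1 : π f = 1) : f = 1 := by
  have hp := H.le_p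
  refine eq_one_of_carmichael π (P := (p : ℤ) + 1) (Q := (p : ℤ) + 2) (by omega)
    (fun i => φ (zi p i)) (Finset.Icc 1 (p : ℤ)) (by simp) (by simp)
    (fun i _ => R.zi_pow H i) (fun i hi j hj hij => R.zi_mul_sq H fun h => hij ?_)
    (fun i hi => ?_) f hf hf1
  · rw [Finset.mem_Icc] at hi hj
    rw [← rep_of_mem hi.1 hi.2, ← rep_of_mem hj.1 hj.2]
    exact rep_eq_of_modEq ((ZMod.intCast_eq_intCast_iff _ _ _).1 h)
  · rw [Finset.mem_Icc] at hi
    rw [R.comp, H.model_zi, rep_of_mem hi.1 hi.2]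

theorem zi_mem (i : ℤ) : φ (zi p i) ∈ zSubgroup φ p := by
  have hp := H.le_p
  have h1 := rep_mem (p := p) (by omega) i
  have h2 : φ (zi p i) = φ (zi p (rep p i)) := by
    apply R.zi_eq H
    rw [rep]
    push_cast
    simp
  rw [h2]
  exact Subgroup.subset_closure ⟨rep p i, by simpa using h1, rfl⟩

theorem exists_mem {f : RPerm} (hf : f ∈ altOn (Finset.Icc 1 ((p : ℤ) + 2))) :
    ∃ f' ∈ zSubgroup φ p, π f' = f := by
  have h1 : altOn (Finset.Icc 1 ((p : ℤ) + 2)) ≤ (zSubgroup φ p).map π := by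
    refine altOn_le (P := (p : ℤ) + 1) (Q := (p : ℤ) + 2) (by omega) fun i hi h1 h2 => ?_
    rw [Finset.mem_Icc] at hi
    refine ⟨_, R.zi_mem H i, ?_⟩
    rw [R.comp, H.model_zi, rep_of_mem hi.1 (by omega)]
  exact h1 hf

theorem map_mem {f : G} (hf : f ∈ zSubgroup φ p) :
    π f ∈ altOn (Finset.Icc 1 ((p : ℤ) + 2)) := by
  have hp := H.le_p
  have h1 : zSubgroup φ p ≤ (altOn (Finset.Icc 1 ((p : ℤ) + 2))).comap π := by
    rw [zSubgroup, Subgroup.closure_le]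
    rintro _ ⟨i, hi, rfl⟩
    simp only [Finset.coe_Icc, Set.mem_Icc] at hi
    change π (φ (zi p i)) ∈ altOn (Finset.Icc 1 ((p : ℤ) + 2))
    rw [R.comp, H.model_zi, rep_of_mem hi.1 hi.2]
    exact cyc_mem_altOn (by simp; omega) (by simp; omega) ⟨1, rfl⟩
  exact h1 hf

/-- An element that normalizes the subgroup generated by the `z(i)` and acts on `ℤ` as one of its
elements differs from that element by one that centralizes the subgroup. -/
theorem exists_eq_mul {f : G} (hf : π f ∈ altOn (Finset.Icc 1 ((p : ℤ) + 2)))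
    (hcj : ∀ i, cj (φ (zi p i)) f ∈ zSubgroup φ p) :
    ∃ t, ∃ f' ∈ zSubgroup φ p, f = t * f' ∧ π t = 1 ∧ ∀ x ∈ zSubgroup φ p, Commute t x := by
  obtain ⟨f', hf', h1⟩ := R.exists_mem H hf
  refine ⟨f * f'⁻¹, f', hf', by group, by rw [map_mul, map_inv, h1, mul_inv_cancel], ?_⟩
  have h2 : zSubgroup φ p ≤ Subgroup.centralizer {f * f'⁻¹} := by
    rw [zSubgroup, Subgroup.closure_le]
    rintro _ ⟨i, -, rfl⟩
    simp only [SetLike.mem_coe, Subgroup.mem_centralizer_singleton_iff]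
    -- Both conjugates lie in the subgroup generated by the `z(i)` and act alike, so they agree;
    -- hence the quotient of `f` and `f'` centralizes every `z(i)`.
    have h3 : cj (φ (zi p i)) f = cj (φ (zi p i)) f' :=
      eq_of_map_eq (fun x hx h => R.eq_one_of_mem H hx h) (hcj i) (cj_mem (R.zi_mem H i) hf')
        (by rw [map_cj, map_cj, h1])
    have h4 : f * cj (φ (zi p i)) f * f'⁻¹ = f * cj (φ (zi p i)) f' * f'⁻¹ := by rw [h3]
    simp only [cj] at h4
    simp only [mul_assoc, mul_inv_cancel, mul_one, mul_inv_cancel_left] at h4 ⊢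
    exact h4
  intro x hx
  have := h2 hx
  rw [Subgroup.mem_centralizer_singleton_iff] at this
  exact this.symm

omit H in
theorem model_mem_altOn {f : Word} {S : Finset ℤ}
    (hS : ∀ m, m ∉ S → act (model n p α f) m = m) {N : ℕ} (hN : Odd N) (hf : φ f ^ N = 1) :
    model n p α f ∈ altOn S := by
  refine mem_altOn_of_odd_pow hS hN ?_
  rw [← R.comp, ← map_pow, hf, map_one]

/-- Write `b = t b'` with `b'` in the subgroup and `t` centralizing it. Then `t^((p-1)/2) = 1` and
`h = t^(p+1) = t²`. Cubing `ã = (ãh)^y`, where `ã³ = 1`, gives `t⁶ = 1`. As `p ≡ 11` modulo 12,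
`(p-1)/2` is 5 modulo 6, so `t = 1`. -/
theorem b_mem_and_h : φ b ∈ zSubgroup φ p ∧ φ (h p) = 1 := by
  have h0 := H.mod
  have hp := H.le_p
  have hq : Odd ((p - 1) / 2) := ⟨(p - 3) / 4, by omega⟩
  have hinj : ∀ f ∈ zSubgroup φ p, π f = 1 → f = 1 := fun f hf h1 => R.eq_one_of_mem H hf h1
  obtain ⟨t, b', hb', e1, ht, hc⟩ := R.exists_eq_mul H (f := φ b) (by
    rw [R.comp]
    refine R.model_mem_altOn (fun m hm => ?_) hq (R.b_pow H)
    rw [Finset.mem_Icc] at hm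
    rw [H.model_b, act_mulPerm_of_not (by omega)]) (fun i => by
    obtain ⟨j, hj⟩ := ZMod.intCast_surjective ((r : ZMod p) * (i : ZMod p))
    rw [R.cj_zi_b H hj.symm]
    exact R.zi_mem H j)
  have htb : Commute t b' := hc b' hb'
  have htq : t ^ ((p - 1) / 2) = 1 := by
    have h1 := R.b_pow H
    rw [e1, htb.mul_pow] at h1
    have h2 : b' ^ ((p - 1) / 2) = 1 := by
      refine hinj _ (Subgroup.pow_mem _ hb' _) ?_
      have h3 := congrArg π h1
      rwa [map_mul, map_pow, ht, one_pow, one_mul, map_one] at h3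
    rwa [h2, mul_one] at h1
  have hh : φ (h p) = t ^ 2 := by
    have h1 : ((p : ℤ) + 1) / 2 = ((((p + 1) / 2 : ℕ)) : ℤ) := by omega
    have h2 : b' ^ 2 * φ (zi p 1) * φ (zi p (-1)) ∈ zSubgroup φ p :=
      Subgroup.mul_mem _ (Subgroup.mul_mem _ (Subgroup.pow_mem _ hb' _) (R.zi_mem H _))
        (R.zi_mem H _)
    have h3 : φ (h p) = (t ^ 2 * (b' ^ 2 * φ (zi p 1) * φ (zi p (-1)))) ^ ((p + 1) / 2) := by
      rw [h, map_zpow, h1, zpow_natCast, map_mul, map_mul, map_pow, e1, htb.mul_pow]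
      simp only [mul_assoc]
    rw [((hc _ h2).pow_left 2).mul_pow] at h3
    have h4 : (b' ^ 2 * φ (zi p 1) * φ (zi p (-1))) ^ ((p + 1) / 2) = 1 := by
      refine hinj _ (Subgroup.pow_mem _ h2 _) ?_
      have h5 := congrArg π h3
      rwa [R.comp, H.model_h, map_mul, map_pow, map_pow, ht, one_pow, one_pow, one_mul,
        eq_comm] at h5
    rw [h3, h4, mul_one, ← pow_mul, show 2 * ((p + 1) / 2) = (p - 1) / 2 * 2 + 2 by omega, pow_add,
      pow_mul, htq, one_pow, one_mul]
  have hat : φ (aTilde p) ∈ zSubgroup φ p := by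
    rw [aTilde, map_cj, map_mul]
    exact cj_mem (R.zi_mem H _) (Subgroup.mul_mem _ (R.zi_mem H _) (R.zi_mem H _))
  have hat3 : φ (aTilde p) ^ 3 = 1 := by
    refine hinj _ (Subgroup.pow_mem _ hat _) ?_
    rw [map_pow, R.comp, H.model_aTilde, show 3 = [(1 : ℤ), 2, 3].length from rfl,
      cyc_pow_length (by simp)]
  have h6 : t ^ 6 = 1 := by
    have h1 : φ (aTilde p * (cj (aTilde p * h p) y)⁻¹) = 1 := R.rel 3
    rw [map_mul, map_inv, mul_inv_eq_one, map_cj, map_mul, hh] at h1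
    have h2 : cj ((φ (aTilde p) * t ^ 2) ^ 3) (φ y) = 1 := by rw [← cj_pow, ← h1, hat3]
    rw [((hc _ hat).pow_left 2).symm.mul_pow, hat3, one_mul, ← pow_mul] at h2
    have h3 : φ y * cj (t ^ (2 * 3)) (φ y) * (φ y)⁻¹ = 1 := by rw [h2]; group
    rw [cj] at h3
    simpa [mul_assoc] using h3
  have ht1 : t = 1 := by
    have h1 : (p - 1) / 2 = 6 * (p / 12) + 5 := by omega
    have h2 : t = t ^ (6 * (p / 12 + 1)) * (t ^ ((p - 1) / 2))⁻¹ := by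
      rw [h1, eq_mul_inv_iff_mul_eq, ← pow_succ']
      congr 1
    rw [h2, htq, pow_mul, h6, one_pow, inv_one, mul_one]
  refine ⟨?_, by rw [hh, ht1, one_pow]⟩
  rw [e1, ht1, one_mul]
  exact hb'

/-- Again `a = t a'` with `t` centralizing the subgroup, which now contains `b`. Comparing `t`-parts
in `(a^s)^b = a^(s-1)` gives `t^s = t^(s-1)`. -/
theorem a_mem : φ a ∈ zSubgroup φ p := by
  have h0 := H.mod
  have hp := H.le_p
  have hinj : ∀ f ∈ zSubgroup φ p, π f = 1 → f = 1 := fun f hf h1 => R.eq_one_of_mem H hf h1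
  obtain ⟨t, a', ha', e1, ht, hc⟩ := R.exists_eq_mul H (f := φ a) (by
    rw [R.comp]
    refine R.model_mem_altOn (fun m hm => ?_) (N := p) ⟨p / 2, by omega⟩ (R.a_pow H)
    rw [Finset.mem_Icc] at hm
    rw [model_a, act_cyc_of_notMem]
    rw [mem_run]; omega) (fun i => by
    rw [cj_zi_a]
    exact R.zi_mem H _)
  have hb := (R.b_mem_and_h H).1
  have h1 := R.rel_cj
  have hta := hc _ ha'
  have htb := hc _ hb
  rw [e1, hta.mul_zpow, hta.mul_zpow, cj_mul, cj_eq_self (htb.zpow_left s)] at h1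
  have h2 : cj (a' ^ s) (φ b) = a' ^ (s - 1) := by
    refine eq_of_map_eq hinj (cj_mem (Subgroup.zpow_mem _ ha' _) hb) (Subgroup.zpow_mem _ ha' _) ?_
    have h3 := congrArg π h1
    rwa [map_mul, map_mul, map_zpow, map_zpow, ht, one_zpow, one_zpow, one_mul, one_mul] at h3
  rw [h2, mul_left_inj, zpow_sub_one, eq_comm, mul_eq_left, inv_eq_one] at h1
  rw [e1, h1, one_mul]
  exact ha'

/-- The exponents `(p-1)/2` of `z` and 3 of `b` are coprime: `2(p-1)/2 - 3(4⌊p/12⌋ + 3) = 1`. -/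
theorem g_mem : φ g ∈ zSubgroup φ p := by
  have h0 := H.mod
  have hz : φ (z p) ∈ zSubgroup φ p := by
    have := R.zi_mem H 0
    rwa [zi, zpow_zero, cj, inv_one, one_mul, mul_one] at this
  have h1 : ((p : ℤ) - 1) / 2 = ((((p - 1) / 2 : ℕ)) : ℤ) := by omega
  have h2 : φ g = φ (z p) ^ 2 * (φ b ^ (4 * (p / 12) + 3))⁻¹ := by
    rw [z, b, map_zpow, map_pow, h1, zpow_natCast, ← pow_mul, ← pow_mul, eq_mul_inv_iff_mul_eq,
      ← pow_succ']
    congr 1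
    omega
  rw [h2]
  exact Subgroup.mul_mem _ (Subgroup.pow_mem _ hz _)
    (Subgroup.inv_mem _ (Subgroup.pow_mem _ (R.b_mem_and_h H).1 _))

theorem word_mem : ((zSubgroup φ p).comap φ : Subgroup Word) ≥ Subgroup.closure {a, g} := by
  rw [ge_iff_le, Subgroup.closure_le]
  rintro _ (rfl | rfl)
  · exact R.a_mem H
  · exact R.g_mem H

end Realizes
end AltPres

/-! ### Spreading the relations that involve y -/

namespace AltPres

theorem z_mem_closure (p : ℤ) : z p ∈ Subgroup.closure {a, g} :=
  Subgroup.zpow_mem _ (Subgroup.subset_closure (by simp)) _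

theorem za_mem_closure (p : ℤ) : z p * a ∈ Subgroup.closure {a, g} :=
  Subgroup.mul_mem _ (z_mem_closure p) (Subgroup.subset_closure (by simp))

theorem zi_mem_closure (p i : ℤ) : zi p i ∈ Subgroup.closure {a, g} :=
  cj_mem (z_mem_closure p) (Subgroup.zpow_mem _ (Subgroup.subset_closure (by simp)) _)

theorem cij_mem_closure (p i j : ℤ) : cij p i j ∈ Subgroup.closure {a, g} := by
  have ha : a ∈ Subgroup.closure {a, g} := Subgroup.subset_closure (by simp)
  have hx : x p ∈ Subgroup.closure {a, g} := Subgroup.mul_mem _ (Subgroup.mul_mem _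
    (zi_mem_closure p 0) (Subgroup.inv_mem _ (zi_mem_closure p 1))) (zi_mem_closure p 0)
  have h0 : ∀ i j, cij₀ p i j ∈ Subgroup.closure {a, g} := fun i j => Subgroup.mul_mem _
    (Subgroup.mul_mem _ (Subgroup.zpow_mem _ ha _) (Subgroup.zpow_mem _ (Subgroup.mul_mem _ ha hx) _))
    (Subgroup.zpow_mem _ ha _)
  have h1 : ∀ t : ℤ, cj (z p) ((z p * a) ^ t) ∈ Subgroup.closure {a, g} := fun t =>
    cj_mem (z_mem_closure p) (Subgroup.zpow_mem _ (za_mem_closure p) _)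
  rw [cij]
  split_ifs
  · exact h0 _ _
  · exact Subgroup.mul_mem _ (h1 _) (h0 _ _)
  · exact Subgroup.mul_mem _ (h1 _) (h0 _ _)
  · exact Subgroup.mul_mem _ (z_mem_closure p) (Subgroup.mul_mem _ (h1 _) (h0 _ _))

theorem e_mem_closure (n p : ℤ) : e n p ∈ Subgroup.closure {a, g} := by
  rw [e]
  split_ifs
  all_goals exact Subgroup.mul_mem _ (za_mem_closure p) (Subgroup.inv_mem _ (cij_mem_closure _ _ _))

theorem c_mem_closure (n p : ℤ) : c n p ∈ Subgroup.closure {a, g} := by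
  rw [c]
  split_ifs
  all_goals exact cij_mem_closure _ _ _

theorem aTilde_mem_closure (p : ℤ) : aTilde p ∈ Subgroup.closure {a, g} :=
  cj_mem (zi_mem_closure p 3) (Subgroup.mul_mem _ (zi_mem_closure p 2) (zi_mem_closure p 1))

namespace Realizes

variable {G : Type*} [Group G] {n p : ℕ} {r α : (ZMod p)ˣ} {s : ℤ} {φ : Word →* G}
  {π : G →* RPerm} (R : Realizes n p α s φ π) (H : Admissible n p r α s)
include R H

theorem hinj : ∀ f ∈ zSubgroup φ p, π f = 1 → f = 1 := fun _ hf h1 => R.eq_one_of_mem H hf h1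

theorem commute_aTilde : Commute (φ (aTilde p)) (φ y) := by
  have h1 : φ (aTilde p * (cj (aTilde p * h p) y)⁻¹) = 1 := R.rel 3
  rw [map_mul, map_inv, mul_inv_eq_one, map_cj, map_mul, (R.b_mem_and_h H).2, mul_one] at h1
  exact commute_iff_cj.2 h1.symm

/-- `y` centralizes the alternating group on `{1, …, k}`. -/
theorem commute_y {f : G} (hf : f ∈ zSubgroup φ p)
    (h : π f ∈ altOn (Finset.Icc 1 (kk n p))) : Commute f (φ y) := by
  have hk := H.kk_ge
  set L := zSubgroup φ p ⊓ Subgroup.centralizer {φ y} with hL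
  have hmem : ∀ f, f ∈ L ↔ f ∈ zSubgroup φ p ∧ Commute f (φ y) := fun f => by
    rw [hL, Subgroup.mem_inf, Subgroup.mem_centralizer_singleton_iff]; exact Iff.rfl
  suffices h1 : altOn (Finset.Icc 1 (kk n p)) ≤ L.map π from
    ((hmem f).1 (mem_of_map_mem_map (R.hinj H) inf_le_left hf (h1 h))).2
  have ht : cyc [1, 2, 3] ∈ L.map π := ⟨φ (aTilde p), (hmem _).2
    ⟨R.word_mem H (aTilde_mem_closure p), R.commute_aTilde H⟩, by rw [R.comp, H.model_aTilde]⟩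
  have hc : π (φ (c n p)) ∈ L.map π := by
    refine ⟨_, (hmem _).2 ⟨R.word_mem H (c_mem_closure n p), ?_⟩, rfl⟩
    have h1 : φ (c n p * (cj (c n p) y)⁻¹) = 1 := R.rel 4
    rw [map_mul, map_inv, mul_inv_eq_one, map_cj] at h1
    exact commute_iff_cj.2 h1.symm
  rw [R.comp, H.model_c] at hc
  have key : ∀ i, 3 ≤ i → i ≤ kk n p → cyc [1, 2, i] ∈ L.map π := by
    intro i h1 h2
    -- For odd `n` the cycle `c` contains 1, 2, 3; for even `n` it fixes 1 and the 3-cycles fan out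
    -- from that point.
    by_cases hn : Odd (n : ℤ)
    · rw [if_pos hn] at hc
      exact cyc_run_three_mem hc ht h1 h2
    · rw [if_neg hn] at hc
      have h3 := cyc_fan_mem hc (P := 1) (v := fun j => 2 + (j : ℤ)) (N := (kk n p - 2).toNat)
        (fun j _ => by omega) (fun i j hij _ => by omega)
        (act_cyc_of_notMem (by rw [mem_run]; omega))
        (fun j hj => by
          rw [act_cyc_run (by omega), if_pos (by omega)]; push_cast; ring)
        (by norm_num; exact ht) (j := (i - 2).toNat) (by omega) (by omega)
      simp only [Nat.cast_zero, add_zero] at h3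
      rwa [show 2 + ((i - 2).toNat : ℤ) = i by omega] at h3
  refine altOn_le (P := 1) (Q := 2) (by omega) fun i hi h1 h2 => ?_
  rw [Finset.mem_Icc] at hi
  rw [cyc_triple_rotate h1 h2 (by omega)]
  exact key i (by omega) (by omega)

/-- The conjugate of `e` by `y` commutes with `d = (5, …, p+2)` by a relation. It also commutes with
`(3, 4, 5)`, since this is centralized by `y` and disjoint from `e`. Conjugating by `d`, which fixes
3 and 4, gives all `(3, 4, i)`. -/
theorem commute_e {f : G} (hf : f ∈ zSubgroup φ p)
    (h : π f ∈ altOn (Finset.Icc 3 ((p : ℤ) + 2))) : Commute f (cj (φ (e n p)) (φ y)) := by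
  have hk := H.kk_ge
  have hk' := H.kk_le
  have hp := H.le_p
  set L := zSubgroup φ p ⊓ Subgroup.centralizer {cj (φ (e n p)) (φ y)} with hL
  have hmem : ∀ f, f ∈ L ↔ f ∈ zSubgroup φ p ∧ Commute f (cj (φ (e n p)) (φ y)) := fun f => by
    rw [hL, Subgroup.mem_inf, Subgroup.mem_centralizer_singleton_iff]; exact Iff.rfl
  suffices h1 : altOn (Finset.Icc 3 ((p : ℤ) + 2)) ≤ L.map π from
    ((hmem f).1 (mem_of_map_mem_map (R.hinj H) inf_le_left hf (h1 h))).2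
  have hd : cyc (run 5 ((p : ℤ) + 2)) ∈ L.map π := by
    refine ⟨φ (d p), (hmem _).2 ⟨R.word_mem H (cij_mem_closure _ _ _), ?_⟩, by
      rw [R.comp, H.model_d]⟩
    have h1 : φ (comm (d p) (cj (e n p) y)) = 1 := R.rel 5
    rw [comm, map_mul, map_mul, map_mul, map_inv, map_inv, map_cj, ← mul_inv_rev, mul_assoc,
      inv_mul_eq_one] at h1
    exact h1.symm
  have ht : cyc [3, 4, 5] ∈ L.map π := by
    obtain ⟨t, ht, ht'⟩ := R.exists_mem H (f := cyc [3, 4, 5])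
      (cyc_mem_altOn (by simp) (by simp; omega) ⟨1, rfl⟩)
    refine ⟨t, (hmem t).2 ⟨ht, ?_⟩, ht'⟩
    have h1 : cj t (φ y) = t := cj_eq_self (R.commute_y H ht (by
      rw [ht']; exact cyc_mem_altOn (by simp) (by simp; omega) ⟨1, rfl⟩))
    have h2 : Commute t (φ (e n p)) := by
      refine eq_of_map_eq (R.hinj H) (Subgroup.mul_mem _ ht (R.word_mem H (e_mem_closure n p)))
        (Subgroup.mul_mem _ (R.word_mem H (e_mem_closure n p)) ht) ?_
      rw [map_mul, map_mul, ht', R.comp, H.model_e]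
      split_ifs
      all_goals exact cyc_commute (by simp [mem_run]; omega)
    rw [← h1, Commute, SemiconjBy, ← cj_mul, h2.eq, cj_mul]
  refine altOn_le (P := 3) (Q := 4) (by omega) fun i hi h1 h2 => ?_
  rw [Finset.mem_Icc] at hi
  rw [cyc_triple_rotate h1 h2 (by omega)]
  obtain ⟨j, rfl⟩ := Int.le.dest (show 5 ≤ i by omega)
  clear h1 h2
  induction j with
  | zero => simpa using ht
  | succ j ih =>
    push_cast at hi ⊢
    have h3 := cj_mem (ih (by omega)) hd
    rw [cj_cyc] at h3
    simp only [List.map_cons, List.map_nil] at h3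
    rw [act_cyc_run (by omega), act_cyc_run (by omega), act_cyc_run (by omega),
      if_neg (by omega), if_neg (by omega), if_neg (by omega), if_neg (by omega),
      if_pos (by omega)] at h3
    rwa [← add_assoc]

/-- Fix `f` on `4, …, p+2`. It commutes with `ã = ã^y` because the supports are disjoint, and with
`e^y` by `commute_e`. The permutations of `ã` and `e` generate a group containing Alt({1, 2, 3} ∪
{k+1, …, p+2}). -/
theorem commute_cj {f f' : G} (hf : f ∈ zSubgroup φ p)
    (h : π f ∈ altOn (Finset.Icc 4 ((p : ℤ) + 2))) (hf' : f' ∈ zSubgroup φ p)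
    (h' : π f' ∈ altOn (Finset.Icc 1 3 ∪ Finset.Icc (kk n p + 1) ((p : ℤ) + 2))) :
    Commute f (cj f' (φ y)) := by
  have hk := H.kk_ge
  have hk' := H.kk_le
  have hp := H.le_p
  set L := zSubgroup φ p ⊓
    (Subgroup.centralizer {f}).comap (MulAut.conj (φ y)⁻¹).toMonoidHom with hL
  have hmem : ∀ x, x ∈ L ↔ x ∈ zSubgroup φ p ∧ Commute (cj x (φ y)) f := fun x => by
    rw [hL, Subgroup.mem_inf, Subgroup.mem_comap, Subgroup.mem_centralizer_singleton_iff]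
    simp [cj, Commute, SemiconjBy]
  suffices h1 : altOn (Finset.Icc 1 3 ∪ Finset.Icc (kk n p + 1) ((p : ℤ) + 2)) ≤ L.map π from
    ((hmem f').1 (mem_of_map_mem_map (R.hinj H) inf_le_left hf' (h1 h'))).2.symm
  have ht : cyc [1, 2, 3] ∈ L.map π := by
    have h1 := R.word_mem H (aTilde_mem_closure p)
    refine ⟨φ (aTilde p), (hmem _).2 ⟨h1, ?_⟩, by rw [R.comp, H.model_aTilde]⟩
    rw [cj_eq_self (R.commute_aTilde H)]
    refine eq_of_map_eq (R.hinj H) (Subgroup.mul_mem _ h1 hf) (Subgroup.mul_mem _ hf h1) ?_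
    rw [map_mul, map_mul, R.comp, H.model_aTilde]
    refine rperm_ext fun m => ?_
    rw [act_mul, act_mul, act_cyc_triple (by omega) (by omega) (by omega),
      act_cyc_triple (by omega) (by omega) (by omega)]
    have hfix : ∀ m ≤ 3, act (π f) m = m := fun m hm =>
      act_of_mem_altOn h (by rw [Finset.mem_Icc]; omega)
    by_cases hm : m ≤ 3
    · rw [hfix m hm, hfix]
      split_ifs <;> omega
    · have h4 : ¬act (π f) m ≤ 3 := fun h5 => hm (by
        have := act_injective _ (hfix _ h5)
        omega)
      rw [if_neg (by omega), if_neg (by omega), if_neg (by omega), if_neg (by omega),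
        if_neg (by omega), if_neg (by omega)]
  have he : π (φ (e n p)) ∈ L.map π := by
    refine ⟨_, (hmem _).2 ⟨R.word_mem H (e_mem_closure n p), (R.commute_e H hf ?_).symm⟩, rfl⟩
    exact altOn_mono (P := 4) (Q := 5) (by simp; omega) (by simp; omega) (by omega)
      (Finset.Icc_subset_Icc (by omega) le_rfl) h
  rw [R.comp, H.model_e] at he
  by_cases hn : Odd (n : ℤ)
  · rw [if_pos hn] at he
    have key : ∀ j : ℕ, kk n p + 1 + j ≤ p + 2 → cyc [kk n p + 1 + j, 2, 3] ∈ L.map π := by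
      intro j
      have hact := act_cyc_cons_run (i := 1) (j := kk n p + 1) (l := (p : ℤ) + 2) (by omega)
        (by omega)
      have hfix : ∀ m, 2 ≤ m → m ≤ 3 →
          act (cyc (1 :: run (kk n p + 1) ((p : ℤ) + 2))) m = m := fun m h1 h2 => by
        rw [hact, if_neg (by omega), if_neg (by omega), if_neg (by omega)]
      induction j with
      | zero =>
        intro hj
        have h3 := cj_mem ht he
        rw [cj_cyc] at h3
        simp only [List.map_cons, List.map_nil] at h3
        rw [hfix 2 (by omega) (by omega), hfix 3 (by omega) (by omega), hact, if_pos rfl] at h3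
        simpa using h3
      | succ j ih =>
        intro hj
        push_cast at hj ⊢
        have h3 := cj_mem (ih (by omega)) he
        rw [cj_cyc] at h3
        simp only [List.map_cons, List.map_nil] at h3
        rw [hfix 2 (by omega) (by omega), hfix 3 (by omega) (by omega), hact, if_neg (by omega),
          if_pos (by omega)] at h3
        rwa [← add_assoc]
    refine altOn_le (P := 2) (Q := 3) (by omega) fun i hi h1 h2 => ?_
    rw [Finset.mem_union, Finset.mem_Icc, Finset.mem_Icc] at hi
    by_cases h3 : i = 1
    · rw [h3]; exact ht
    · obtain ⟨j, rfl⟩ := Int.le.dest (show kk n p + 1 ≤ i by omega)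
      exact key j (by omega)
  · rw [if_neg hn] at he
    have hact := act_cyc_cons_cons_run (h := 1) (i := 2) (j := kk n p + 1) (l := (p : ℤ) + 2)
      (by omega) (by omega) (by omega)
    -- The points in the order in which `e` runs through them: 1, 2, k+1, …, p+2. The point 3, fixed
    -- by `e`, is the centre of the fan.
    let v : ℕ → ℤ := fun j => if j = 0 then 1 else if j = 1 then 2 else kk n p - 1 + j
    have hv : ∀ j, v j = if j = 0 then 1 else if j = 1 then 2 else kk n p - 1 + j := fun _ => rfl
    have key := fun j => cyc_fan_mem he (P := 3) (v := v) (N := (p + 3 - kk n p).toNat)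
      (fun j _ => by rw [hv]; split_ifs <;> omega)
      (fun i j hij _ => by rw [hv, hv]; split_ifs <;> omega)
      (by rw [hact, if_neg (by omega), if_neg (by omega), if_neg (by omega), if_neg (by omega)])
      (fun j hj => by
        rw [hact, hv, hv]
        by_cases h1 : j = 0
        · subst h1; simp
        by_cases h2 : j = 1
        · subst h2; simp; ring
        rw [if_neg h1, if_neg h2, if_neg (by omega), if_neg (by omega), if_pos (by omega),
          if_neg (by omega), if_neg (by omega)]
        push_cast; ring)
      (by
        have h1 : v 0 = 1 := rfl
        have h2 : v 1 = 2 := rfl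
        rw [h1, h2, cyc_triple_rotate (by omega) (by omega) (by omega)]
        exact ht) (j := j)
    refine altOn_le (P := 3) (Q := 1) (by omega) fun i hi h1 h2 => ?_
    rw [cyc_triple_rotate h1 h2 (by omega)]
    rw [Finset.mem_union, Finset.mem_Icc, Finset.mem_Icc] at hi
    by_cases h3 : i = 2
    · rw [h3]; exact key 1 le_rfl (by omega)
    · have h4 := key (i + 1 - kk n p).toNat (by omega) (by omega)
      rw [hv, hv, if_pos rfl, if_neg (by omega), if_neg (by omega)] at h4
      rwa [show kk n p - 1 + ((i + 1 - kk n p).toNat : ℤ) = i by omega] at h4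

end Realizes
end AltPres

namespace AltPres

/-! ## Faithfulness -/

theorem cyc_pairs_mem_altOn {S : Finset ℤ} {i j P Q : ℤ} (hiP : i ≠ P) (hiQ : i ≠ Q) (hjP : j ≠ P)
    (hjQ : j ≠ Q) (hPQ : P ≠ Q) (hij : i ≠ j) (hi : i ∈ S) (hj : j ∈ S) (hP : P ∈ S) (hQ : Q ∈ S) :
    cyc [i, Q] * cyc [P, j] ∈ altOn S := by
  rw [← cyc_triple_mul_triple hij hiP hiQ hjP hjQ hPQ]
  exact Subgroup.mul_mem _
    (cyc_mem_altOn (by simp [hiP, hiQ, hPQ]) (by simp [hi, hP, hQ]) ⟨1, rfl⟩)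
    (cyc_mem_altOn (by simp [hjP, hjQ, hPQ]) (by simp [hj, hP, hQ]) ⟨1, rfl⟩)

theorem cyc_pairs_sq {i j P Q : ℤ} (hiP : i ≠ P) (hQP : Q ≠ P) (hij : i ≠ j) (hQj : Q ≠ j) :
    (cyc [i, Q] * cyc [P, j]) ^ 2 = 1 := by
  rw [(cyc_pairs_commute hiP hij hQP hQj).mul_pow, pow_two, pow_two, cyc_pair_mul_self,
    cyc_pair_mul_self, one_mul]

theorem mul_sq_comm {G : Type*} [Group G] {x y : G} (h : (x * y) ^ 2 = 1) : (y * x) ^ 2 = 1 := by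
  have h1 : y * x = cj (x * y) x := by simp [cj]
  rw [h1, cj_pow, h]
  simp [cj]

namespace Realizes

variable {G : Type*} [Group G] {n p : ℕ} {r α : (ZMod p)ˣ} {s : ℤ} {φ : Word →* G}
  {π : G →* RPerm} (R : Realizes n p α s φ π) (H : Admissible n p r α s)
include R H

/-- Put `t = (2,3)(1,4)`, `u = (i,4)(5,6)`, `v = (5,6)(2,3)`, `q = (2,3)(1,j)`, so that `f = u v t`
and `f' = t q`. Since `y` centralizes `t`, the two involutions `t` cancel and the product is `u v ·
q^y`. Here `u` commutes with `q^y` by `commute_cj`, and `v` does because it commutes with `q` and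
`y`. So the product is one of commuting elements of square 1. -/
theorem mul_cj_sq {i j : ℤ} (hi : kk n p < i) (hi' : i ≤ p + 2) (hj : kk n p < j) (hj' : j ≤ p + 2)
    {f f' : G} (hf : f ∈ zSubgroup φ p) (hf' : f' ∈ zSubgroup φ p) (h : π f = cyc [i, 1, 4])
    (h' : π f' = cyc [j, 1, 4]) : (f * cj f' (φ y)) ^ 2 = 1 := by
  have hk := H.kk_ge
  have hk' := H.kk_le
  have hp := H.le_p
  obtain ⟨t, ht, e1⟩ := R.exists_mem H (f := cyc [2, 3] * cyc [1, 4])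
    (cyc_pairs_mem_altOn (by omega) (by omega) (by omega) (by omega) (by omega) (by omega)
      (by simp) (by simp; omega) (by simp; omega) (by simp; omega))
  obtain ⟨u, hu, e2⟩ := R.exists_mem H (f := cyc [i, 4] * cyc [5, 6])
    (cyc_pairs_mem_altOn (by omega) (by omega) (by omega) (by omega) (by omega) (by omega)
      (by simp; omega) (by simp; omega) (by simp; omega) (by simp; omega))
  obtain ⟨v, hv, e3⟩ := R.exists_mem H (f := cyc [5, 6] * cyc [2, 3])
    (cyc_pairs_mem_altOn (by omega) (by omega) (by omega) (by omega) (by omega) (by omega)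
      (by simp; omega) (by simp; omega) (by simp) (by simp; omega))
  obtain ⟨q, hq, e4⟩ := R.exists_mem H (f := cyc [2, 3] * cyc [1, j])
    (cyc_pairs_mem_altOn (by omega) (by omega) (by omega) (by omega) (by omega) (by omega)
      (by simp) (by simp; omega) (by simp; omega) (by simp; omega))
  have huv := Subgroup.mul_mem _ hu hv
  have hc : Commute (cyc [5, 6]) (cyc [2, 3]) :=
    cyc_pairs_commute (by omega) (by omega) (by omega) (by omega)
  have e5 : π (u * v) = cyc [i, 4] * cyc [2, 3] := by
    rw [map_mul, e2, e3, mul_assoc, ← mul_assoc (cyc [5, 6]), cyc_pair_mul_self, one_mul]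
  have h1 : f = u * v * t := by
    refine eq_of_map_eq (R.hinj H) hf (Subgroup.mul_mem _ huv ht) ?_
    rw [h, map_mul, e5, e1, mul_assoc, ← mul_assoc (cyc [2, 3]), cyc_pair_mul_self, one_mul]
    refine rperm_ext fun m => ?_
    rw [act_mul, act_cyc_triple (by omega) (by omega) (by omega), act_cyc_pair, act_cyc_pair]
    grind
  have h2 : f' = t * q := by
    refine eq_of_map_eq (R.hinj H) hf' (Subgroup.mul_mem _ ht hq) ?_
    rw [h', map_mul, e1, e4, (cyc_pairs_commute (i := 2) (j := 3) (i' := 1) (j' := 4) (by omega)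
      (by omega) (by omega) (by omega)).eq, mul_assoc, ← mul_assoc (cyc [2, 3]),
      cyc_pair_mul_self, one_mul]
    refine rperm_ext fun m => ?_
    rw [act_mul, act_cyc_triple (by omega) (by omega) (by omega), act_cyc_pair, act_cyc_pair]
    grind
  have h3 : cj t (φ y) = t := cj_eq_self (R.commute_y H ht (by
    rw [e1]
    exact cyc_pairs_mem_altOn (by omega) (by omega) (by omega) (by omega) (by omega) (by omega)
      (by simp; omega) (by simp; omega) (by simp; omega) (by simp; omega)))
  have h4 : cj v (φ y) = v := cj_eq_self (R.commute_y H hv (by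
    rw [e3]
    exact cyc_pairs_mem_altOn (by omega) (by omega) (by omega) (by omega) (by omega) (by omega)
      (by simp; omega) (by simp; omega) (by simp; omega) (by simp; omega)))
  have h5 : t ^ 2 = 1 := R.hinj H _ (Subgroup.pow_mem _ ht _) (by
    rw [map_pow, e1, cyc_pairs_sq (by omega) (by omega) (by omega) (by omega)])
  have h6 : q ^ 2 = 1 := R.hinj H _ (Subgroup.pow_mem _ hq _) (by
    rw [map_pow, e4, cyc_pairs_sq (by omega) (by omega) (by omega) (by omega)])
  have h7 : (u * v) ^ 2 = 1 := R.hinj H _ (Subgroup.pow_mem _ huv _) (by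
    rw [map_pow, e5, cyc_pairs_sq (by omega) (by omega) (by omega) (by omega)])
  have h8 : Commute u (cj q (φ y)) := by
    refine R.commute_cj H hu ?_ hq ?_
    · rw [e2]
      exact cyc_pairs_mem_altOn (by omega) (by omega) (by omega) (by omega) (by omega) (by omega)
        (by simp; omega) (by simp; omega) (by simp; omega) (by simp; omega)
    · rw [e4]
      exact cyc_pairs_mem_altOn (by omega) (by omega) (by omega) (by omega) (by omega) (by omega)
        (by simp) (by simp; omega) (by simp) (by simp)
  have h9 : Commute v q := by
    refine eq_of_map_eq (R.hinj H) (Subgroup.mul_mem _ hv hq) (Subgroup.mul_mem _ hq hv) ?_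
    rw [map_mul, map_mul, e3, e4]
    have c1 : Commute (cyc [5, 6]) (cyc [1, j]) :=
      cyc_pairs_commute (by omega) (by omega) (by omega) (by omega)
    have c2 : Commute (cyc [2, 3]) (cyc [1, j]) :=
      cyc_pairs_commute (by omega) (by omega) (by omega) (by omega)
    exact (hc.mul_right c1).mul_left ((Commute.refl _).mul_right c2)
  have h10 : Commute v (cj q (φ y)) := by
    rw [← h4, Commute, SemiconjBy, ← cj_mul, h9.eq, cj_mul]
  have h11 : f * cj f' (φ y) = u * v * cj q (φ y) := by
    rw [h2, cj_mul, h3, h1, mul_assoc (u * v), ← mul_assoc t, ← pow_two, h5, one_mul]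
  rw [h11, (h8.mul_left h10).mul_pow, h7, cj_pow, h6]
  simp [cj]

theorem mul_sq {i j : ℤ} (hij : i ≠ j) (hi1 : i ≠ 1) (hi4 : i ≠ 4) (hj1 : j ≠ 1) (hj4 : j ≠ 4)
    {f f' : G} (hf : f ∈ zSubgroup φ p) (hf' : f' ∈ zSubgroup φ p) (h : π f = cyc [i, 1, 4])
    (h' : π f' = cyc [j, 1, 4]) : (f * f') ^ 2 = 1 := by
  refine R.hinj H _ (Subgroup.pow_mem _ (Subgroup.mul_mem _ hf hf') _) ?_
  rw [map_pow, map_mul, h, h', cyc_triple_mul_triple hij hi1 hi4 hj1 hj4 (by omega),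
    cyc_pairs_sq hi1 (by omega) hij (by omega)]

/-- Carmichael's relations on all `n` points with base points 1 and 4. Both are fixed by `y`, and
they lie on either side of the split {1, 2, 3}, {4, …, p+2} that `mul_cj_sq` exploits. -/
theorem injective : Function.Injective π := by
  have hk := H.kk_ge
  have hk' := H.kk_le
  have hp := H.le_p
  rw [injective_iff_map_eq_one]
  have hcyc : ∀ i : ℤ, 1 ≤ i ∧ i ≤ p + 2 ∧ i ≠ 1 ∧ i ≠ 4 →
      cyc [i, 1, 4] ∈ altOn (Finset.Icc 1 ((p : ℤ) + 2)) := fun i hi =>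
    cyc_mem_altOn (by simp; omega) (by simp; omega) ⟨1, rfl⟩
  choose! v hv hπv using fun i hi => R.exists_mem H (hcyc i hi)
  have hY1 : act (yPerm n p) 1 = 1 := H.act_yPerm_of_le le_rfl (by omega)
  have hY4 : act (yPerm n p) 4 = 4 := H.act_yPerm_of_le (by omega) (by omega)
  -- The 3-cycles at positive points come from the `z(i)`; those at nonpositive points are
  -- conjugates by `y` of 3-cycles at points beyond `k`.
  let X : ℤ → G := fun i => if 1 ≤ i then v i else cj (v (act (yPerm n p)⁻¹ i)) (φ y)
  have hX : ∀ i, 1 ≤ i → X i = v i := fun i hi => if_pos hi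
  have hX' : ∀ i, ¬1 ≤ i → X i = cj (v (act (yPerm n p)⁻¹ i)) (φ y) := fun i hi => if_neg hi
  have hneg : ∀ i, -p - 1 + kk n p ≤ i → ¬1 ≤ i → ∃ m, kk n p < m ∧ m ≤ p + 2 ∧
      i = act (yPerm n p) m ∧ X i = cj (v m) (φ y) := fun i hi hi' => by
    obtain ⟨m, h1, h2, h3⟩ := H.exists_act_yPerm hi (by omega)
    exact ⟨m, h1, h2, h3.symm, by rw [hX' i hi', act_inv_eq h3]⟩
  set T := (Finset.Icc (-p - 1 + kk n p) ((p : ℤ) + 2)).filter fun i => i ≠ 1 ∧ i ≠ 4 with hT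
  have hTmem : ∀ i, i ∈ T ↔ (-p - 1 + kk n p ≤ i ∧ i ≤ (p : ℤ) + 2) ∧ i ≠ 1 ∧ i ≠ 4 := fun i => by
    rw [hT, Finset.mem_filter, Finset.mem_Icc]
  have hsq : ∀ i j : ℤ, (1 ≤ i ∧ i ≤ p + 2 ∧ i ≠ 1 ∧ i ≠ 4) → (1 ≤ j ∧ j ≤ p + 2 ∧ j ≠ 1 ∧ j ≠ 4) →
      i ≠ j → (v i * v j) ^ 2 = 1 := fun i j hi hj hij =>
    R.mul_sq H hij hi.2.2.1 hi.2.2.2 hj.2.2.1 hj.2.2.2 (hv i hi) (hv j hj)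
      (hπv i hi) (hπv j hj)
  have hcjsq : ∀ f : G, f ^ 2 = 1 → (cj f (φ y)) ^ 2 = 1 := fun f hf => by
    rw [cj_pow, hf]; simp [cj]
  have hmixed : ∀ i ∈ T, ∀ j ∈ T, 1 ≤ i → ¬1 ≤ j → (X i * X j) ^ 2 = 1 := by
    intro i hi j hj h1 h2
    rw [hTmem] at hi hj
    obtain ⟨m, h3, h4, -, h5⟩ := hneg j hj.1.1 h2
    rw [hX i h1, h5]
    have hi' : 1 ≤ i ∧ i ≤ (p : ℤ) + 2 ∧ i ≠ 1 ∧ i ≠ 4 := by omega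
    have hm' : 1 ≤ m ∧ m ≤ (p : ℤ) + 2 ∧ m ≠ 1 ∧ m ≠ 4 := by omega
    by_cases h6 : i ≤ kk n p
    · have h7 : cj (v i) (φ y) = v i := cj_eq_self (R.commute_y H (hv i hi') (by
        rw [hπv i hi']
        exact cyc_mem_altOn (by simp; omega) (by simp; omega) ⟨1, rfl⟩))
      rw [← h7, ← cj_mul]
      exact hcjsq _ (hsq i m hi' hm' (by omega))
    · exact R.mul_cj_sq H (by omega) (by omega) h3 h4 (hv i hi') (hv m hm') (hπv i hi') (hπv m hm')
  have hfaith := eq_one_of_carmichael π (P := 1) (Q := 4) (by omega) X T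
    (by simp [hTmem]) (by simp [hTmem])
    (fun i hi => by
      rw [hTmem] at hi
      have h1 : ∀ i : ℤ, 1 ≤ i ∧ i ≤ p + 2 ∧ i ≠ 1 ∧ i ≠ 4 → v i ^ 3 = 1 := fun i hi => by
        refine R.hinj H _ (Subgroup.pow_mem _ (hv i hi) _) ?_
        rw [map_pow, hπv i hi, show 3 = [i, 1, 4].length from rfl, cyc_pow_length (by simp; omega)]
      by_cases h2 : 1 ≤ i
      · rw [hX i h2]; exact h1 i (by omega)
      · obtain ⟨m, h3, h4, -, h5⟩ := hneg i hi.1.1 h2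
        rw [h5, cj_pow, h1 m (by omega)]
        simp [cj])
    (fun i hi j hj hij => by
      by_cases h1 : 1 ≤ i
      · by_cases h2 : 1 ≤ j
        · rw [hTmem] at hi hj
          rw [hX i h1, hX j h2]
          exact hsq i j (by omega) (by omega) hij
        · exact hmixed i hi j hj h1 h2
      · by_cases h2 : 1 ≤ j
        · exact mul_sq_comm (hmixed j hj i hi h2 h1)
        · rw [hTmem] at hi hj
          obtain ⟨m, h3, h4, h5, h6⟩ := hneg i hi.1.1 h1
          obtain ⟨m', h3', h4', h5', h6'⟩ := hneg j hj.1.1 h2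
          rw [h6, h6', ← cj_mul]
          refine hcjsq _ (hsq m m' (by omega) (by omega) fun h => hij ?_)
          rw [h5, h5', h])
    (fun i hi => by
      rw [hTmem] at hi
      by_cases h1 : 1 ≤ i
      · rw [hX i h1, hπv i (by omega)]
      · obtain ⟨m, h3, h4, h5, h6⟩ := hneg i hi.1.1 h1
        rw [h6, map_cj, hπv m (by omega), R.comp, model_y, cj_cyc]
        simp only [List.map_cons, List.map_nil]
        rw [hY1, hY4, h5])
  -- The generators `X i` give the whole group: they generate the subgroup of the `z(i)` and its
  -- conjugate by `y`, hence `a, g, a^y, g^y`, hence `w = y`.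
  suffices h : Subgroup.closure (X '' (T : Set ℤ)) = ⊤ from fun f =>
    hfaith f (h ▸ Subgroup.mem_top f)
  set L := Subgroup.closure (X '' (T : Set ℤ)) with hL
  have hXL : ∀ i ∈ T, X i ∈ L := fun i hi => Subgroup.subset_closure ⟨i, hi, rfl⟩
  have key : ∀ M : Subgroup G, (∀ i : ℤ, (1 ≤ i ∧ i ≤ p + 2 ∧ i ≠ 1 ∧ i ≠ 4) → v i ∈ M) →
      zSubgroup φ p ≤ M := fun M hM f hf => by
    have h1 : altOn (Finset.Icc 1 ((p : ℤ) + 2)) ≤ (zSubgroup φ p ⊓ M).map π :=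
      altOn_le (P := 1) (Q := 4) (by omega) fun i hi h1 h2 => by
        rw [Finset.mem_Icc] at hi
        have h3 : 1 ≤ i ∧ i ≤ (p : ℤ) + 2 ∧ i ≠ 1 ∧ i ≠ 4 := ⟨hi.1, hi.2, h1, h2⟩
        exact ⟨v i, ⟨hv i h3, hM i h3⟩, hπv i h3⟩
    exact (mem_of_map_mem_map (R.hinj H) inf_le_left hf (h1 (R.map_mem H hf))).2
  have hK : zSubgroup φ p ≤ L := key L fun i hi => by
    rw [← hX i hi.1]
    exact hXL i ((hTmem i).2 (by omega))
  have hKy : zSubgroup φ p ≤ L.comap (MulAut.conj (φ y)⁻¹).toMonoidHom := key _ fun i hi => by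
    have h0 : cj (v i) (φ y) ∈ L := by
      by_cases h1 : i ≤ kk n p
      · rw [cj_eq_self (R.commute_y H (hv i hi) (by
          rw [hπv i hi]
          exact cyc_mem_altOn (by simp; omega) (by simp; omega) ⟨1, rfl⟩))]
        exact hK (hv i hi)
      · have h2 := H.act_yPerm_neg (m := i) (by omega) (by omega)
        have h3 : X (act (yPerm n p) i) = cj (v i) (φ y) := by
          rw [hX' _ (by omega), act_inv_act]
        rw [← h3]
        exact hXL _ ((hTmem _).2 (by omega))
    simpa [Subgroup.mem_comap, cj] using h0
  have hcjL : ∀ f ∈ zSubgroup φ p, cj f (φ y) ∈ L := fun f hf => by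
    simpa [Subgroup.mem_comap, cj] using hKy hf
  have hw : φ y ∈ L := by
    have h1 : φ (y * (w n p)⁻¹) = 1 := R.rel 6
    rw [map_mul, map_inv, mul_inv_eq_one] at h1
    rw [h1]
    have h2 : Subgroup.closure {a, g, cj a y, cj g y} ≤ L.comap φ := by
      rw [Subgroup.closure_le]
      rintro _ (rfl | rfl | rfl | rfl)
      · exact hK (R.a_mem H)
      · exact hK (R.g_mem H)
      · change φ (cj a y) ∈ L
        rw [map_cj]
        exact hcjL _ (R.a_mem H)
      · change φ (cj g y) ∈ L
        rw [map_cj]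
        exact hcjL _ (R.g_mem H)
    exact h2 (w_mem_closure n p)
  rw [eq_top_iff]
  intro f _
  obtain ⟨f, rfl⟩ := R.surj f
  have h2 : (⊤ : Subgroup Word) ≤ L.comap φ := by
    rw [← FreeGroup.closure_range_of, Subgroup.closure_le]
    rintro _ ⟨i, rfl⟩
    fin_cases i
    · exact hK (R.a_mem H)
    · exact hK (R.g_mem H)
    · exact hw
  exact h2 (Subgroup.mem_top f)

end Realizes
end AltPres

namespace AltPres

/-! ## The isomorphism -/

namespace Realizes

variable {G : Type*} [Group G] {n p : ℕ} {r α : (ZMod p)ˣ} {s : ℤ} {φ : Word →* G}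
  {π : G →* RPerm} (R : Realizes n p α s φ π) (H : Admissible n p r α s)
include R H

/-- Evenness of `y` is not computed: `ȳ` is the value of `w`, a word in `a, g` and their conjugates
by `y`, and all four have odd order. -/
theorem model_mem (f : Word) :
    model n p α f ∈ altOn (Finset.Icc (-p - 1 + kk n p) ((p : ℤ) + 2)) := by
  have hk := H.kk_ge
  have hk' := H.kk_le
  have hp := H.le_p
  set S := Finset.Icc (-p - 1 + kk n p) ((p : ℤ) + 2) with hS
  have hsub : Finset.Icc 1 ((p : ℤ) + 2) ⊆ S := Finset.Icc_subset_Icc (by omega) le_rfl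
  have hle : altOn (Finset.Icc 1 ((p : ℤ) + 2)) ≤ altOn S :=
    altOn_mono (P := 1) (Q := 2) (by simp; omega) (by simp) (by decide) hsub
  have ha : model n p α a ∈ altOn S := hle (by rw [← R.comp]; exact R.map_mem H (R.a_mem H))
  have hg : model n p α g ∈ altOn S := hle (by rw [← R.comp]; exact R.map_mem H (R.g_mem H))
  have hga : φ a ^ p = 1 := R.a_pow H
  have h0 := H.mod
  have hgg : φ g ^ (3 * ((p - 1) / 2)) = 1 := by
    have := R.b_pow H
    rwa [b, map_pow, ← pow_mul] at this
  have hcj : ∀ f : Word, model n p α f ∈ altOn S → ∀ N : ℕ, Odd N → φ f ^ N = 1 →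
      model n p α (cj f y) ∈ altOn S := fun f hf N hN h1 => by
    refine R.model_mem_altOn (fun m hm => ?_) hN (by rw [map_cj, cj_pow, h1]; simp [cj])
    have h2 := H.act_yPerm_of_notMem hm
    rw [map_cj, model_y, cj, act_mul, act_mul, act_inv_eq h2, act_of_mem_altOn hf hm, h2]
  have hw : Subgroup.closure {a, g, cj a y, cj g y} ≤ (altOn S).comap (model n p α) := by
    rw [Subgroup.closure_le]
    rintro _ (rfl | rfl | rfl | rfl)
    · exact ha
    · exact hg
    · exact hcj a ha p ⟨p / 2, by omega⟩ hga
    · exact hcj g hg _ ⟨(3 * ((p - 1) / 2)) / 2, by omega⟩ hgg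
  have hy : model n p α y ∈ altOn S := by
    rw [model_y, ← H.model_w]
    exact hw (w_mem_closure n p)
  have h2 : (⊤ : Subgroup Word) ≤ (altOn S).comap (model n p α) := by
    rw [← FreeGroup.closure_range_of, Subgroup.closure_le]
    rintro _ ⟨i, rfl⟩
    fin_cases i
    · exact ha
    · exact hg
    · exact hy
  exact h2 (Subgroup.mem_top f)

theorem range_eq : π.range = altOn (Finset.Icc (-p - 1 + kk n p) ((p : ℤ) + 2)) := by
  have hk := H.kk_ge
  have hk' := H.kk_le
  have hp := H.le_p
  refine le_antisymm ?_ (altOn_le (P := 1) (Q := 4) (by omega) fun i hi h1 h4 => ?_)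
  · rintro _ ⟨f, rfl⟩
    obtain ⟨f, rfl⟩ := R.surj f
    rw [R.comp]
    exact R.model_mem H f
  · have key : ∀ i : ℤ, 1 ≤ i → i ≤ p + 2 → i ≠ 1 → i ≠ 4 → cyc [i, 1, 4] ∈ π.range :=
      fun i hi hi' h1 h4 => by
        obtain ⟨f, -, hf⟩ := R.exists_mem H (f := cyc [i, 1, 4])
          (cyc_mem_altOn (by simp; omega) (by simp; omega) ⟨1, rfl⟩)
        exact ⟨f, hf⟩
    rw [Finset.mem_Icc] at hi
    by_cases h : 1 ≤ i
    · exact key i h hi.2 h1 h4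
    · obtain ⟨m, h5, h6, h7⟩ := H.exists_act_yPerm hi.1 (by omega)
      have h8 : cj (cyc [m, 1, 4]) (π (φ y)) ∈ π.range :=
        cj_mem (key m (by omega) h6 (by omega) (by omega)) ⟨_, rfl⟩
      rw [R.comp, model_y, cj_cyc] at h8
      simp only [List.map_cons, List.map_nil] at h8
      rwa [h7, H.act_yPerm_of_le le_rfl (by omega), H.act_yPerm_of_le (by omega) (by omega)] at h8

end Realizes

namespace Admissible

variable {n p : ℕ} {r α : (ZMod p)ˣ} {s : ℤ} (H : Admissible n p r α s)
include H

theorem exists_mulEquiv : ∃ Φ : J n p s ≃* RAlt n p, ∀ f, ev Φ f = model n p α f := by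
  have h1 : ∀ f ∈ Set.range (relators n p s), model n p α f = 1 := by
    rintro _ ⟨i, rfl⟩
    exact H.model_relators i
  let π : J n p s →* RPerm := PresentedGroup.toGroup h1
  have R : Realizes n p α s (PresentedGroup.mk (Set.range (relators n p s))) π :=
    ⟨fun i => PresentedGroup.one_of_mem ⟨i, rfl⟩, fun _ => rfl, PresentedGroup.mk_surjective _⟩
  let ι := MonoidHom.ofInjective
    (altIncl_injective (Finset.Icc (-p - 1 + kk n p) ((p : ℤ) + 2)))
  let κ : J n p s ≃* (altIncl (Finset.Icc (-p - 1 + kk n p) ((p : ℤ) + 2))).range :=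
    (MonoidHom.ofInjective (R.injective H)).trans (MulEquiv.subgroupCongr (R.range_eq H))
  refine ⟨κ.trans ι.symm, fun f => ?_⟩
  exact congrArg Subtype.val
    (ι.apply_symm_apply (κ (PresentedGroup.mk (Set.range (relators n p s)) f)))

theorem nonempty_mulEquiv : Nonempty (J n p s ≃* alternatingGroup (Fin n)) := by
  obtain ⟨Φ, -⟩ := H.exists_mulEquiv
  have h1 : Fintype.card (Pts n p) = Fintype.card (Fin n) := by
    have := H.lower
    rw [Fintype.card_coe, Int.card_Icc, Fintype.card_fin, kk]
    omega
  -- Inversion identifies a group with its opposite, which undoes the convention of right actions.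
  exact ⟨Φ.trans ((MulEquiv.inv' _).symm.trans (Equiv.altCongrHom (Fintype.equivOfCardEq h1)))⟩

end Admissible
end AltPres

namespace AltPres

/-! ## Bit-lengths -/

/-- A family of words that have expressions of length `O(log M)`. -/
def Short {ι : Type*} (M : ι → ℕ) (f : ι → Word) : Prop :=
  ∃ N : ℕ, ∀ i, ∃ E : PowerExpr (Fin 3),
    E.eval FreeGroup.of = f i ∧ E.symbols ≤ N * (Nat.size (M i) + 4)

namespace Short

variable {ι : Type*} {M : ι → ℕ} {f f' : ι → Word}

theorem of (j : Fin 3) : Short M (fun _ => FreeGroup.of j) :=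
  ⟨1, fun _ => ⟨.gen j, rfl, by rw [PowerExpr.symbols]; omega⟩⟩

theorem mul (hf : Short M f) (hf' : Short M f') : Short M (fun i => f i * f' i) := by
  obtain ⟨N, hN⟩ := hf
  obtain ⟨N', hN'⟩ := hf'
  refine ⟨N + N', fun i => ?_⟩
  obtain ⟨E, h1, h2⟩ := hN i
  obtain ⟨E', h1', h2'⟩ := hN' i
  refine ⟨.mul E E', by rw [PowerExpr.eval, h1, h1'], ?_⟩
  rw [PowerExpr.symbols, add_mul]
  omega

/-- The summand 4 in the bound pays for two brackets, a sign and the digit that is written even when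
the exponent is 0. -/
theorem zpow (hf : Short M f) {m : ι → ℤ} (hm : ∀ i, (m i).natAbs ≤ M i) :
    Short M (fun i => f i ^ m i) := by
  obtain ⟨N, hN⟩ := hf
  refine ⟨N + 1, fun i => ?_⟩
  obtain ⟨E, h1, h2⟩ := hN i
  refine ⟨.pow E (m i), by rw [PowerExpr.eval, h1], ?_⟩
  have := Nat.size_le_size (hm i)
  rw [PowerExpr.symbols, add_mul, one_mul]
  split_ifs <;> omega

theorem pow (hf : Short M f) {m : ℕ} (hm : ∀ i, m ≤ M i) : Short M (fun i => f i ^ m) := by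
  simpa using hf.zpow (m := fun _ => (m : ℤ)) (by simpa using hm)

theorem inv (hM : ∀ i, 1 ≤ M i) (hf : Short M f) : Short M (fun i => (f i)⁻¹) := by
  simpa using hf.zpow (m := fun _ => -1) (by simpa using hM)

theorem cj (hM : ∀ i, 1 ≤ M i) (hf : Short M f) (hf' : Short M f') :
    Short M (fun i => AltPres.cj (f i) (f' i)) := ((hf'.inv hM).mul hf).mul hf'

theorem ite {P : ι → Prop} [DecidablePred P] (hf : Short M f) (hf' : Short M f') :
    Short M (fun i => if P i then f i else f' i) := by
  obtain ⟨N, hN⟩ := hf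
  obtain ⟨N', hN'⟩ := hf'
  refine ⟨N + N', fun i => ?_⟩
  beta_reduce
  rw [add_mul]
  split_ifs
  · obtain ⟨E, h1, h2⟩ := hN i
    exact ⟨E, h1, by omega⟩
  · obtain ⟨E, h1, h2⟩ := hN' i
    exact ⟨E, h1, by omega⟩

theorem z {p : ι → ℤ} (hp : ∀ i, (p i).natAbs < M i) : Short M (fun i => AltPres.z (p i)) :=
  (of 1).zpow fun i => by have := hp i; omega

theorem zi {p j : ι → ℤ} (hp : ∀ i, (p i).natAbs < M i) (hj : ∀ i, (j i).natAbs ≤ M i) :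
    Short M (fun i => AltPres.zi (p i) (j i)) :=
  cj (fun i => by have := hp i; omega) (z hp) ((of 0).zpow hj)

theorem dij {p j l : ι → ℤ} (hp : ∀ i, (p i).natAbs < M i) (hj : ∀ i, (j i).natAbs ≤ M i)
    (hl : ∀ i, (l i).natAbs ≤ M i) : Short M (fun i => AltPres.dij (p i) (j i) (l i)) :=
  ((zi hp hj).mul ((zi hp hl).inv fun i => by have := hp i; omega)).mul (zi hp hj)

theorem za {p : ι → ℤ} (hp : ∀ i, (p i).natAbs < M i) :
    Short M (fun i => AltPres.z (p i) * AltPres.a) := (z hp).mul (of 0)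

theorem cij₀ {p j l : ι → ℤ} (hp : ∀ i, (p i).natAbs < M i)
    (h : ∀ i, (j i).natAbs + (l i).natAbs ≤ M i) :
    Short M (fun i => AltPres.cij₀ (p i) (j i) (l i)) := by
  have hx : Short M (fun i => AltPres.x (p i)) :=
    dij hp (fun i => by simp) (fun i => by have := hp i; omega)
  exact (((of 0).zpow fun i => by have := h i; omega).mul
    (((of 0).mul hx).zpow fun i => by have := h i; omega)).mul
    ((of 0).zpow fun i => by have := h i; omega)

theorem cij {p j l : ι → ℤ} (hp : ∀ i, (p i).natAbs + (j i).natAbs + 2 ≤ M i)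
    (h : ∀ i, (j i).natAbs + (l i).natAbs ≤ M i) :
    Short M (fun i => AltPres.cij (p i) (j i) (l i)) := by
  have hp' : ∀ i, (p i).natAbs < M i := fun i => by have := hp i; omega
  have hM : ∀ i, 1 ≤ M i := fun i => by have := hp i; omega
  have h1 : Short M (fun i =>
      AltPres.cj (AltPres.z (p i)) ((AltPres.z (p i) * AltPres.a) ^ (-1 : ℤ))) :=
    (z hp').cj hM ((za hp').zpow fun i => by simpa using hM i)
  have h2 : Short M (fun i =>
      AltPres.cj (AltPres.z (p i)) ((AltPres.z (p i) * AltPres.a) ^ (-2 : ℤ))) :=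
    (z hp').cj hM ((za hp').zpow fun i => by have := hp i; simp; omega)
  have h3 : Short M (fun i => AltPres.cij₀ (p i) (j i) (p i - 2)) :=
    cij₀ hp' fun i => by have := hp i; omega
  have h4 : Short M (fun i => AltPres.cij₀ (p i) (j i) (p i - 1)) :=
    cij₀ hp' fun i => by have := hp i; omega
  exact (cij₀ hp' h).ite ((h2.mul h3).ite ((h1.mul h4).ite ((z hp').mul (h2.mul h3))))

end Short

/-- The parameters for which the bit-length is bounded. -/
abbrev Params : Type :=
  {q : ℕ × ℕ × ℤ // 15 ≤ q.1 ∧ q.2.1 ≤ q.1 ∧ |q.2.2| ≤ q.1}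

theorem short_relators (j : Fin 7) :
    Short (fun q : Params => 4 * q.1.1) (fun q => relators q.1.1 q.1.2.1 q.1.2.2 j) := by
  let M : Params → ℕ := fun q => 4 * q.1.1
  let n : Params → ℤ := fun q => q.1.1
  let p : Params → ℤ := fun q => q.1.2.1
  let s : Params → ℤ := fun q => q.1.2.2
  have hb : ∀ q, 60 ≤ M q ∧ 4 * n q = M q ∧ 0 ≤ p q ∧ p q ≤ n q ∧ -n q ≤ s q ∧ s q ≤ n q := by
    intro q
    obtain ⟨h1, h2, h3⟩ := q.2
    rw [abs_le] at h3
    simp only [M, n, p, s]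
    push_cast
    omega
  change Short M (fun q => relators (n q) (p q) (s q) j)
  -- From here only the linear inequalities in `hb` matter; the bound `M = 4n` exceeds every
  -- exponent that occurs.
  clear_value M n p s
  have hM : ∀ q, 1 ≤ M q := fun q => by have := hb q; omega
  have hp : ∀ q, (p q).natAbs < M q := fun q => by have := hb q; omega
  have hk : ∀ q, (kk (n q) (p q)).natAbs + 10 ≤ M q := fun q => by
    have := hb q; rw [kk]; omega
  have hc : ∀ m : ℤ, m.natAbs ≤ 10 → ∀ q, m.natAbs ≤ M q := fun m hm q => by
    have := hb q; omega
  have ha : Short M (fun _ => a) := Short.of 0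
  have hg : Short M (fun _ => g) := Short.of 1
  have hy : Short M (fun _ => y) := Short.of 2
  have hbw : Short M (fun _ => b) := hg.pow fun q => by have := hb q; omega
  have hz : Short M (fun q => z (p q)) := Short.z hp
  have hzi : ∀ m : ℤ, m.natAbs ≤ 10 → Short M (fun q => zi (p q) m) := fun m hm =>
    Short.zi hp (hc m hm)
  have hza : Short M (fun q => z (p q) * a) := Short.za hp
  have hat : Short M (fun q => aTilde (p q)) :=
    (hzi 3 (by decide)).cj hM ((hzi 2 (by decide)).mul (hzi 1 (by decide)))
  have hh : Short M (fun q => h (p q)) :=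
    (((hbw.pow fun q => by have := hb q; omega).mul (hzi 1 (by decide))).mul
      (hzi (-1) (by decide))).zpow fun q => by have := hb q; omega
  have hcij : ∀ m t : ℤ, m.natAbs ≤ 5 → t.natAbs ≤ 5 →
      Short M (fun q => cij (p q) m (kk (n q) (p q) + t)) := fun m t hm ht =>
    Short.cij (fun q => by have := hb q; omega) (fun q => by have := hk q; omega)
  have hcw : Short M (fun q => c (n q) (p q)) := by
    have h1 := hcij 1 0 (by decide) (by decide)
    have h2 := hcij 2 0 (by decide) (by decide)
    simp only [add_zero] at h1 h2
    exact h1.ite h2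
  have hdw : Short M (fun q => d (p q)) :=
    Short.cij (fun q => by have := hb q; omega) (fun q => by have := hb q; omega)
  have hew : Short M (fun q => e (n q) (p q)) :=
    (hza.mul ((hcij 2 1 (by decide) (by decide)).inv hM)).ite
      (hza.mul ((hcij 3 1 (by decide) (by decide)).inv hM))
  have hd : ∀ m t : ℤ, m.natAbs ≤ 5 → t.natAbs ≤ 5 →
      Short M (fun q => dij (p q) m (kk (n q) (p q) + t)) := fun m t hm ht =>
    Short.dij hp (hc m (by omega)) (fun q => by have := hk q; omega)
  have hd1 := hd 1 2 (by decide) (by decide)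
  have hd2 := hd 2 1 (by decide) (by decide)
  have hxt : Short M (fun q => xt (n q) (p q)) :=
    (hd1.mul hd2).cj hM ((hd1.cj hM hy).mul (hd2.cj hM hy))
  have hu : Short M (fun q => u (p q)) := hza.mul (hza.cj hM hy)
  have hlast : ∀ l l' : Params → ℤ, (∀ q, (l q).natAbs ≤ M q) → (∀ q, (l' q).natAbs ≤ M q) →
      Short M (fun q => (xt (n q) (p q) * u (p q) ^ (-2 : ℤ)) ^ l q) ∧
        Short M (fun q => u (p q) ^ l' q) := fun l l' hl hl' =>
    ⟨(hxt.mul (hu.zpow (hc (-2) (by decide)))).zpow hl, hu.zpow hl'⟩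
  have hw1 := hlast (fun q => (p q - kk (n q) (p q)) / 2) (fun q => p q - kk (n q) (p q))
    (fun q => by have := hb q; rw [kk]; omega) (fun q => by have := hb q; rw [kk]; omega)
  have hw2 := hlast (fun q => (p q - kk (n q) (p q) - 3) / 2) (fun q => p q - kk (n q) (p q) - 3)
    (fun q => by have := hb q; rw [kk]; omega) (fun q => by have := hb q; rw [kk]; omega)
  have hw0 : Short M (fun q => cj (dij (p q) 1 (-1))
      (z (p q) * a * y * a⁻¹ * z (p q) ^ (-2 : ℤ) * a⁻¹)) :=
    (Short.dij hp (hc 1 (by decide)) (hc (-1) (by decide))).cj hM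
      ((((hza.mul hy).mul (ha.inv hM)).mul (hz.zpow (hc (-2) (by decide)))).mul (ha.inv hM))
  have hw0' : Short M (fun q => (cj (zi (p q) 1) (y * a⁻¹ * (z (p q))⁻¹))⁻¹) :=
    ((hzi 1 (by decide)).cj hM ((hy.mul (ha.inv hM)).mul (hz.inv hM))).inv hM
  have hw : Short M (fun q => w (n q) (p q)) :=
    ((hz.cj hM (hy.mul (hz.inv hM))).mul (hz.cj hM (hy.mul hz))).ite
      (((hw1.1.mul hxt).mul hw1.2).ite ((((hw0.mul hw0').mul hw2.1).mul hxt).mul hw2.2))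
  fin_cases j
  · exact (ha.zpow fun q => by have := hb q; omega).mul
      ((hbw.zpow fun q => by have := hb q; omega).inv hM)
  · exact ((ha.zpow fun q => by have := hb q; omega).cj hM hbw).mul
      ((ha.zpow fun q => by have := hb q; omega).inv hM)
  · exact (hz.mul (hz.cj hM ha)).pow fun q => by have := hb q; omega
  · exact hat.mul (((hat.mul hh).cj hM hy).inv hM)
  · exact hcw.mul ((hcw.cj hM hy).inv hM)
  · exact (((hdw.inv hM).mul ((hew.cj hM hy).inv hM)).mul hdw).mul (hew.cj hM hy)
  · exact hy.mul (hw.inv hM)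

theorem one_le_log {n : ℕ} (hn : 15 ≤ n) : 1 ≤ Real.log n := by
  rw [Real.le_log_iff_exp_le (by positivity)]
  have := Real.exp_one_lt_d9
  have h2 : (15 : ℝ) ≤ n := by exact_mod_cast hn
  linarith

/-- If `4n` has `t + 1` binary digits then `2^t ≤ 4n ≤ n³`. With `log 2 > 1/2` this gives `t ≤ 6 log
n`, and the remaining 5 is at most `5 log n`. -/
theorem size_le_log {n : ℕ} (hn : 15 ≤ n) : (Nat.size (4 * n) : ℝ) + 4 ≤ 11 * Real.log n := by
  have h1 := one_le_log hn
  have h2 : 0 < Nat.size (4 * n) := Nat.size_pos.2 (by omega)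
  obtain ⟨t, ht⟩ := Nat.exists_eq_succ_of_ne_zero h2.ne'
  have h3 : 2 ^ t ≤ 4 * n := Nat.lt_size.1 (by omega)
  have h4 : 2 ^ t ≤ n ^ 3 := h3.trans (by
    rw [pow_succ]
    exact Nat.mul_le_mul_right n (by nlinarith))
  have h5 : (t : ℝ) * Real.log 2 ≤ 3 * Real.log n := by
    have h6 := Real.log_le_log (by positivity) (show (2 : ℝ) ^ t ≤ (n : ℝ) ^ 3 by exact_mod_cast h4)
    rwa [Real.log_pow, Real.log_pow, Nat.cast_ofNat] at h6
  have h6 := Real.log_two_gt_d9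
  have h7 : (t : ℝ) * (1 / 2) ≤ t * Real.log 2 :=
    mul_le_mul_of_nonneg_left (by linarith) (Nat.cast_nonneg t)
  rw [ht]
  push_cast
  linarith

theorem exists_presentationBitLength_le : ∃ C : ℝ, ∀ n p : ℕ, ∀ s : ℤ, 15 ≤ n → p ≤ n → |s| ≤ n →
    (presentationBitLength (relators n p s) : ℝ) ≤ C * Real.log n := by
  choose N hN using short_relators
  -- The 3 accounts for the generators, and each relator contributes its own constant times the
  -- factor 11 from `size_le_log`.
  refine ⟨3 + ∑ j, (N j : ℝ) * 11, fun n p s h1 h2 h3 => ?_⟩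
  have h4 : ∀ j, bitLength FreeGroup.of (relators n p s j) ≤ N j * (Nat.size (4 * n) + 4) :=
    fun j => by
      obtain ⟨E, h5, h6⟩ := hN j ⟨(n, p, s), h1, h2, h3⟩
      refine le_trans ?_ h6
      rw [bitLength]
      exact Nat.sInf_le ⟨E, h5, rfl⟩
  have h5 := size_le_log h1
  have h6 := one_le_log h1
  rw [presentationBitLength, Fintype.card_fin]
  push_cast
  rw [add_mul, Finset.sum_mul]
  refine add_le_add (by linarith) (Finset.sum_le_sum fun j _ => ?_)
  have h7 : (bitLength FreeGroup.of (relators n p s j) : ℝ) ≤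
      N j * ((Nat.size (4 * n) : ℝ) + 4) := by exact_mod_cast h4 j
  refine h7.trans ?_
  rw [mul_assoc]
  exact mul_le_mul_of_nonneg_left h5 (Nat.cast_nonneg _)

end AltPres

/-! ### Existence of α and assembly of the theorem -/

namespace AltPres

/-- A generator of the group of nonzero squares is the cube of a square. -/
theorem exists_cube_eq {p : ℕ} (hp : p.Prime) (hmod : p % 12 = 11) {r : (ZMod p)ˣ}
    (hr : IsSquare r) : ∃ α : (ZMod p)ˣ, IsSquare α ∧ α ^ 3 = r := by
  have : Fact p.Prime := ⟨hp⟩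
  -- Here 6 divides `p + 1`, and the cube is `r^((p+1)/2) = r · r^((p-1)/2) = r` because `r` is a
  -- square.
  refine ⟨r ^ ((p + 1) / 6), hr.pow _, ?_⟩
  obtain ⟨t, rfl⟩ := hr
  have h1 := ZMod.units_pow_card_sub_one_eq_one p t
  rw [← pow_mul, ← pow_two, ← pow_mul, show 2 * ((p + 1) / 6 * 3) = p - 1 + 2 by omega, pow_add,
    h1, one_mul]

end AltPres

theorem mainTheorem3 :
    ∃ C : ℝ, ∀ n p : ℕ,
      ((15 ≤ n ∧ n ≤ 20) ∨ (27 ≤ n ∧ n ≤ 44) ∨ 51 ≤ n) →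
      p.Prime → p % 12 = 11 → ((n : ℝ) + 2) / 2 ≤ p → (p : ℤ) ≤ (n : ℤ) - 4 →
      ∀ r : (ZMod p)ˣ, (∀ t : (ZMod p)ˣ, t ∈ Subgroup.zpowers r ↔ IsSquare t) →
      ∀ s : ℤ, (s : ZMod p) * ((r : ZMod p) - 1) = -1 →
        -- the presented group is the alternating group of degree `n`
        Nonempty (AltPres.J n p s ≃* alternatingGroup (Fin n)) ∧
        -- the presentation has bit-length `O(log n)`
        (|s| ≤ n →
          (AltPres.presentationBitLength (AltPres.relators n p s) : ℝ) ≤ C * Real.log n) ∧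
        -- `w` is a word in `a, g, a^y, g^y`
        AltPres.w n p ∈ Subgroup.closure {AltPres.a, AltPres.g,
          AltPres.cj AltPres.a AltPres.y, AltPres.cj AltPres.g AltPres.y} ∧
        -- an explicit isomorphism, and the permutations that correspond to the words
        (∃ α : (ZMod p)ˣ, IsSquare α ∧ α ^ 3 = r) ∧
        ∀ α : (ZMod p)ˣ, IsSquare α → α ^ 3 = r →
          ∃ Φ : AltPres.J n p s ≃* AltPres.RAlt n p,
            AltPres.ev Φ AltPres.a = AltPres.cyc (AltPres.run 1 p) ∧
            AltPres.ev Φ AltPres.g =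
              AltPres.mulPerm p α * AltPres.cyc [(p : ℤ) + 2, (p : ℤ) + 1, (p : ℤ)] ∧
            AltPres.ev Φ AltPres.y = AltPres.yPerm n p ∧
            AltPres.ev Φ AltPres.b = AltPres.mulPerm p r ∧
            AltPres.ev Φ (AltPres.z p) = AltPres.cyc [(p : ℤ), (p : ℤ) + 1, (p : ℤ) + 2] ∧
            AltPres.ev Φ (AltPres.h p) = 1 ∧
            (∀ i : ℤ, 1 ≤ i → i ≤ p →
              AltPres.ev Φ (AltPres.zi p i) = AltPres.cyc [i, (p : ℤ) + 1, (p : ℤ) + 2]) ∧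
            (∀ i j : ℤ, 1 ≤ i → i ≤ p → 1 ≤ j → j ≤ p → i ≠ j →
              AltPres.ev Φ (AltPres.dij p i j) =
                AltPres.cyc [i, j] * AltPres.cyc [(p : ℤ) + 1, (p : ℤ) + 2]) ∧
            (∀ i i' j j' : ℤ, i ≡ i' [ZMOD p] → j ≡ j' [ZMOD p] →
              AltPres.ev Φ (AltPres.zi p i) = AltPres.ev Φ (AltPres.zi p i') ∧
              AltPres.ev Φ (AltPres.dij p i j) = AltPres.ev Φ (AltPres.dij p i' j')) ∧
            AltPres.ev Φ (AltPres.x p) =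
              AltPres.cyc [1, (p : ℤ)] * AltPres.cyc [(p : ℤ) + 1, (p : ℤ) + 2] ∧
            (∀ i j : ℤ, AltPres.cijDefined p i j →
              AltPres.ev Φ (AltPres.cij p i j) =
                AltPres.cyc (AltPres.run i j) *
                  AltPres.cyc [(p : ℤ) + 1, (p : ℤ) + 2] ^ (j - i)) ∧
            AltPres.ev Φ (AltPres.aTilde p) = AltPres.cyc [1, 2, 3] ∧
            AltPres.ev Φ (AltPres.c n p) =
              (if Odd n then AltPres.cyc (AltPres.run 1 (AltPres.kk n p))
                else AltPres.cyc (AltPres.run 2 (AltPres.kk n p))) ∧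
            AltPres.ev Φ (AltPres.d p) = AltPres.cyc (AltPres.run 5 (p + 2)) ∧
            AltPres.ev Φ (AltPres.e n p) =
              (if Odd n then AltPres.cyc (1 :: AltPres.run (AltPres.kk n p + 1) (p + 2))
                else AltPres.cyc (1 :: 2 :: AltPres.run (AltPres.kk n p + 1) (p + 2))) ∧
            (AltPres.kk n p ≤ p - 2 →
              AltPres.ev Φ (AltPres.xt n p) =
                AltPres.cyc [-1, AltPres.kk n p + 2] * AltPres.cyc [0, AltPres.kk n p + 1]) ∧
            (AltPres.kk n p ≤ p - 1 →
              AltPres.ev Φ (AltPres.u p) =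
                AltPres.cyc (AltPres.run 1 (p + 2)) *
                  (if Odd n then
                    AltPres.cyc (AltPres.run 1 (AltPres.kk n p) ++
                      (AltPres.run (-p - 1 + AltPres.kk n p) 0).reverse)
                  else
                    AltPres.cyc (AltPres.run 1 (AltPres.kk n p) ++
                      (AltPres.run (-p + 1 + AltPres.kk n p) 0).reverse ++
                      [-p - 1 + AltPres.kk n p, -p + AltPres.kk n p]))) ∧
            AltPres.ev Φ (AltPres.w n p) = AltPres.yPerm n p := by
  obtain ⟨C, hC⟩ := AltPres.exists_presentationBitLength_le
  refine ⟨C, fun n p hn hp hmod hlow hup r hr s hs => ?_⟩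
  have hlow' : n + 2 ≤ 2 * p := by
    have : (n : ℝ) + 2 ≤ 2 * p := by linarith
    exact_mod_cast this
  have hex := AltPres.exists_cube_eq hp hmod ((hr r).1 (Subgroup.mem_zpowers r))
  have H : ∀ α : (ZMod p)ˣ, IsSquare α → α ^ 3 = r → AltPres.Admissible n p r α s :=
    fun α h1 h2 => ⟨hp, hmod, hlow', by omega, hr, hs, h1, h2⟩
  refine ⟨?_, fun h => hC n p s (by omega) (by omega) h, AltPres.w_mem_closure n p, hex, ?_⟩
  · obtain ⟨α, h1, h2⟩ := hex
    exact (H α h1 h2).nonempty_mulEquiv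
  intro α h1 h2
  replace H := H α h1 h2
  obtain ⟨Φ, hΦ⟩ := H.exists_mulEquiv
  have hrep : ∀ i : ℤ, 1 ≤ i → i ≤ p → AltPres.rep p i = i := fun i => AltPres.rep_of_mem
  have hodd : Odd (n : ℤ) ↔ Odd n := Int.odd_coe_nat n
  refine ⟨Φ, ?_⟩
  simp only [hΦ]
  refine ⟨AltPres.model_a, AltPres.model_g, AltPres.model_y, H.model_b, H.model_z, H.model_h,
    fun i hi hi' => ?_, fun i j hi hi' hj hj' hij => ?_, fun i i' j j' hi hj => ?_, H.model_x,
    fun i j hij => H.model_cij hij, H.model_aTilde, ?_, H.model_d, ?_, fun hk => H.model_xt hk,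
    fun hk => ?_, H.model_w⟩
  · rw [H.model_zi, hrep i hi hi']
  · rw [H.model_dij (by rwa [hrep i hi hi', hrep j hj hj']), hrep i hi hi', hrep j hj hj',
      AltPres.tau]
  · have hz : ∀ i i' : ℤ, i ≡ i' [ZMOD p] → AltPres.model n p α (AltPres.zi p i) =
        AltPres.model n p α (AltPres.zi p i') := fun i i' h => by
      rw [H.model_zi, H.model_zi, AltPres.rep_eq_of_modEq h]
    refine ⟨hz i i' hi, ?_⟩
    simp only [AltPres.dij, map_mul, map_inv, hz i i' hi, hz j j' hj]
  · rw [H.model_c]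
    simp only [hodd]
  · rw [H.model_e]
    simp only [hodd]
  · rw [H.model_u hk]
    simp only [hodd]
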